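/- **Conventions.** Let $q$ be a prime power. For a finite set $C$ with a preorder $\preccurlyeq$ let $M^C(q)$ be the set of all $C\times C$ matrices $(x_{ij})$ over $\mathbb F_q$ such that $x_{ij}=0$ unless $i\preccurlyeq j$, let $P^C(q)$ be the group of invertible matrices in $M^C(q)$ and $N^C(q)$ the set of nilpotent matrices in $M^C(q)$, and let $\rho_C(q)$ be the number of orbits of $P^C(q)$ acting on $N^C(q)$ by conjugation. A clot of $C$ is an equivalence class of the relation "$x\preccurlyeq y$ and $y\preccurlyeq x$"; a clot $D$ is minimal if there are no $x\in C\setminus D$ and $y\in D$ with $x\preccurlyeq y$. For a tuple $\mathbf l=(l_1,\dots,l_s)$ of nonnegative integers we also write $\mathbf l$ for the preordered set $\{(i,b): 1\le i\le s,\ 1\le b\le l_i\}$ in which $(i,b)\preccurlyeq(i',b')$ if and only if $i\le i'$. Let $p(n)$ be the number of partitions of $n$ (so $p(0)=1$), and for a finite set $S$ of nonnegative integers let $r(n,S)$ be the number of partitions of $n$ into positive parts whose set of parts is exactly $S$ (so $r(0,\varnothing)=1$). For $m\le 1$ read $[1,m-1]=\varnothing$. **Statement.** Let $(C,\preccurlyeq)$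 be a finite preordered set with a minimal clot $D$, and let $k=|D|$, $\bar D=C\setminus D$, $C'=\{x\in C: y\preccurlyeq x\ \forall y\in D\}\setminus D$ and $m=|C'|$. Suppose that the preordered set $C'$ is isomorphic to some $\mathbf l=(l_1,\dots,l_s)$, and fix an isomorphism $x\mapsto (a(x),b(x))$ from $C'$ to $\mathbf l$. For $S=\{t_1>\cdots>t_u\}\subseteq[1,m-1]$ let $\mathcal A^{\mathbf l}_S$ be the set of tuples $\mathbf n=(n_{ij})_{1\le i\le s,\,1\le j\le u}$ of nonnegative integers such that $l_i\ge n_{i1}\ge\cdots\ge n_{iu}$ for all $i$ and $\sum_{i=1}^s n_{ij}=t_j$ for all $j$; put $n_{i0}=l_i$ and $n_{i,u+1}=0$. For $\mathbf n\in\mathcal A^{\mathbf l}_S$ let $O(S,\mathbf n)$ be the set $\bar D$ with the following preorder $\preccurlyeq'$: if $x,y\in C'$, then $x\preccurlyeq' y$ if and only if $a(x)\le a(y)$ and there exists $c\in\{0,\dots,u\}$ with $b(x)\le n_{a(x),c}$ and $b(y)>n_{a(y),c+1}$; if $x\notin C'$ or $y\notin C'$, then $x\preccurlyeq' y$ if and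 only if $x\preccurlyeq y$. Then $$\rho_C(q)=\sum_{j=0}^k p(k-j)\sum_{S\subseteq[1,m-1]}\bigl(r(j,S)+r(j,S\cup\{m\})\bigr)\sum_{\mathbf n\in\mathcal A^{\mathbf l}_S}\rho_{O(S,\mathbf n)}(q).$$ Moreover $|\bar D|<|C|$, so that this expresses $\rho_C(q)$ through the numbers $\rho_O(q)$ of preordered sets $O$ with fewer elements than $C$. -/

import Mathlib

/-- `l` as a preordered set: the `i`-th clot consists of the `l i` elements `(i, b)`, and
`(i, b) ≤ (i', b')` if and only if `i ≤ i'`. The indices `i` and `b` start at `0`. -/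
def BlockChain {s : ℕ} (l : Fin s → ℕ) : Type := Σ i : Fin s, Fin (l i)

instance BlockChain.instPreorder {s : ℕ} (l : Fin s → ℕ) : Preorder (BlockChain l) :=
  Preorder.lift (fun x : BlockChain l => x.1)

/-- The algebra `M^C` of all `C × C` matrices `X` over `K` such that `X i j = 0` unless
`i ≼ j`, where `≼` is the preorder `P`. -/
def preorderMatrix (K : Type*) [Field K] {C : Type*} [Fintype C] [DecidableEq C]
    (P : Preorder C) : Subalgebra K (Matrix C C K) where
  carrier := {X | ∀ i j, ¬ P.le i j → X i j = 0}
  mul_mem' := by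
    intro X Y hX hY i j hij
    rw [Matrix.mul_apply]
    refine Finset.sum_eq_zero fun a _ => ?_
    by_cases h : P.le i a
    · rw [hY a j (fun h' => hij (P.le_trans _ _ _ h h')), mul_zero]
    · rw [hX i a h, zero_mul]
  add_mem' := by
    intro X Y hX hY i j hij
    rw [Matrix.add_apply, hX i j hij, hY i j hij, add_zero]
  algebraMap_mem' := by
    intro r i j hij
    have hne : i ≠ j := by
      rintro rfl
      exact hij (P.le_refl _)
    simp [Matrix.algebraMap_matrix_apply, hne]

/-- The group `P^C` of all invertible matrices in `M^C`. -/
def preorderGroup (K : Type*) [Field K] [Finite K] {C : Type*} [Fintype C] [DecidableEq C]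
    (P : Preorder C) : Subgroup (Matrix C C K)ˣ where
  carrier := {g | (g : Matrix C C K) ∈ preorderMatrix K P}
  mul_mem' := by
    intro g h hg hh
    exact (preorderMatrix K P).mul_mem hg hh
  one_mem' := one_mem (preorderMatrix K P)
  inv_mem' := by
    intro g hg
    have hfin : Finite (Matrix C C K)ˣ := inferInstance
    have h1 : g⁻¹ = g ^ (orderOf g - 1) := by
      rw [inv_eq_iff_mul_eq_one, ← pow_succ',
        Nat.sub_add_cancel (orderOf_pos g), pow_orderOf_eq_one]
    show ((g⁻¹ : (Matrix C C K)ˣ) : Matrix C C K) ∈ preorderMatrix K P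
    rw [h1, Units.val_pow_eq_pow_val]
    exact pow_mem hg _

/-- The set `N^C` of all nilpotent matrices in `M^C`. -/
def PreorderNilpotent (K : Type*) [Field K] {C : Type*} [Fintype C] [DecidableEq C]
    (P : Preorder C) : Type _ :=
  {X : Matrix C C K // X ∈ preorderMatrix K P ∧ IsNilpotent X}

/-- `P^C` acts on `N^C` by conjugation, `g • X = g X g⁻¹`. -/
instance PreorderNilpotent.instMulAction (K : Type*) [Field K] [Finite K] {C : Type*}
    [Fintype C] [DecidableEq C] (P : Preorder C) :
    MulAction (preorderGroup K P) (PreorderNilpotent K P) where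
  smul g X := ⟨((g : (Matrix C C K)ˣ) : Matrix C C K) * X.1 *
      (((g⁻¹ : preorderGroup K P) : (Matrix C C K)ˣ) : Matrix C C K),
    mul_mem (mul_mem g.2 X.2.1) (g⁻¹).2, by
      obtain ⟨n, hn⟩ := X.2.2
      refine ⟨n, ?_⟩
      rw [Subgroup.coe_inv, Units.conj_pow, hn, mul_zero, zero_mul]⟩
  one_smul X := Subtype.ext (by
    show ((1 : (Matrix C C K)ˣ) : Matrix C C K) * X.1 *
      (((1 : (Matrix C C K)ˣ)⁻¹ : (Matrix C C K)ˣ) : Matrix C C K) = X.1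
    simp)
  mul_smul g h X := Subtype.ext (by
    show (((g * h : preorderGroup K P) : (Matrix C C K)ˣ) : Matrix C C K) * X.1 *
        ((((g * h : preorderGroup K P) : (Matrix C C K)ˣ)⁻¹ : (Matrix C C K)ˣ) : Matrix C C K) =
      ((g : (Matrix C C K)ˣ) : Matrix C C K) *
        (((h : (Matrix C C K)ˣ) : Matrix C C K) * X.1 *
          (((h : (Matrix C C K)ˣ)⁻¹ : (Matrix C C K)ˣ) : Matrix C C K)) *
        (((g : (Matrix C C K)ˣ)⁻¹ : (Matrix C C K)ˣ) : Matrix C C K)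
    rw [Subgroup.coe_mul, mul_inv_rev, Units.val_mul, Units.val_mul]
    simp only [mul_assoc])

/-- `ρ_C(q)`, for the finite field `K` with `q` elements and the preorder `P` on `C`: the number
of orbits of `P^C` on `N^C` under conjugation. -/
noncomputable def rho (K : Type*) [Field K] [Finite K] {C : Type*} [Fintype C] [DecidableEq C]
    (P : Preorder C) : ℕ :=
  Nat.card (MulAction.orbitRel.Quotient (preorderGroup K P) (PreorderNilpotent K P))

/-- `D` is a clot (a class of the relation `x ≤ y ∧ y ≤ x`), and no element outside `D` lies
below an element of `D`. -/
structure IsMinimalClot {C : Type*} [Preorder C] (D : Finset C) : Prop where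
  isClot : ∃ x : C, ∀ y : C, y ∈ D ↔ x ≤ y ∧ y ≤ x
  minimal : ∀ x : C, x ∉ D → ∀ y ∈ D, ¬ x ≤ y

/-- The set `C'` of the elements outside `D` that lie above every element of `D`. -/
def aboveClot {C : Type*} [Preorder C] (D : Finset C) : Set C :=
  {x | x ∉ D ∧ ∀ y ∈ D, y ≤ x}

/-- `p(n)`, the number of partitions of `n`. -/
def partitionCount (n : ℕ) : ℕ := Fintype.card (Nat.Partition n)

/-- `r(n, S)`, the number of partitions of `n` whose set of parts is exactly `S`. -/
def exactPartitionCount (n : ℕ) (S : Finset ℕ) : ℕ :=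
  Fintype.card {μ : Nat.Partition n // μ.parts.toFinset = S}

/-- The finite set `A_S^l` for `S = {t_1 > ⋯ > t_u}`: tuples `n i j` of natural numbers with
`l i ≥ n i 1 ≥ ⋯ ≥ n i u` for all `i` and `∑ i, n i j = t_j` for all `j`. In the code `j` runs
over `0, …, u - 1`, and the bound by `l i` is built into the type of the entries. -/
def FlagTuple {s : ℕ} (l : Fin s → ℕ) (S : Finset ℕ) : Type :=
  {n : (i : Fin s) → Fin S.card → Fin (l i + 1) //
    (∀ i, Antitone (n i)) ∧
      ∀ j : Fin S.card, ∑ i, (n i j : ℕ) = S.orderEmbOfFin rfl (Fin.rev j)}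

noncomputable instance FlagTuple.instFintype {s : ℕ} (l : Fin s → ℕ) (S : Finset ℕ) :
    Fintype (FlagTuple l S) :=
  Fintype.ofInjective (fun n : FlagTuple l S => n.1) Subtype.val_injective

/-- The entry `n_{i,c}` for `c = 0, 1, 2, …`, with `n_{i,0} = l i` and `n_{i,c} = 0` for
`c > u`. -/
def FlagTuple.entry {s : ℕ} {l : Fin s → ℕ} {S : Finset ℕ} (n : FlagTuple l S) (i : Fin s) :
    ℕ → ℕ
  | 0 => l i
  | c + 1 => if h : c < S.card then (n.1 i ⟨c, h⟩ : ℕ) else 0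

theorem FlagTuple.entry_antitone {s : ℕ} {l : Fin s → ℕ} {S : Finset ℕ} (n : FlagTuple l S)
    (i : Fin s) : Antitone (n.entry i) := by
  refine antitone_nat_of_succ_le fun c => ?_
  cases c with
  | zero =>
    show (if h : 0 < S.card then (n.1 i ⟨0, h⟩ : ℕ) else 0) ≤ l i
    split_ifs with h
    · have := (n.1 i ⟨0, h⟩).2
      omega
    · exact Nat.zero_le _
  | succ c =>
    show (if h : c + 1 < S.card then (n.1 i ⟨c + 1, h⟩ : ℕ) else 0) ≤
      (if h : c < S.card then (n.1 i ⟨c, h⟩ : ℕ) else 0)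
    split_ifs with h h'
    · exact n.2.1 i (show (⟨c, h'⟩ : Fin S.card) ≤ ⟨c + 1, h⟩ from Nat.le_succ c)
    · omega
    · exact Nat.zero_le _
    · exact Nat.zero_le _

/-- The relation `≼'` between two elements `(a₁, b₁)` and `(a₂, b₂)` of the preordered set `l`:
`a₁ ≤ a₂` and there is `c ∈ {0, …, u}` such that the `b₁`-th element of the clot `a₁` is among
the first `n_{a₁,c}` ones and the `b₂`-th element of the clot `a₂` is not among the first
`n_{a₂,c+1}` ones. -/
def FlagTuple.rel {s : ℕ} {l : Fin s → ℕ} {S : Finset ℕ} (n : FlagTuple l S)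
    (x y : BlockChain l) : Prop :=
  x.1 ≤ y.1 ∧ ∃ c ≤ S.card, (x.2 : ℕ) < n.entry x.1 c ∧ n.entry y.1 (c + 1) ≤ (y.2 : ℕ)

theorem FlagTuple.rel_refl {s : ℕ} {l : Fin s → ℕ} {S : Finset ℕ} (n : FlagTuple l S)
    (x : BlockChain l) : n.rel x x := by
  refine ⟨le_rfl, ?_⟩
  have hex : ∃ c, n.entry x.1 (c + 1) ≤ (x.2 : ℕ) :=
    ⟨S.card, by simp [FlagTuple.entry]⟩
  classical
  refine ⟨Nat.find hex, Nat.find_min' hex (by simp [FlagTuple.entry]), ?_, Nat.find_spec hex⟩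
  rcases Nat.eq_zero_or_pos (Nat.find hex) with h0 | hpos
  · rw [h0]
    exact x.2.2
  · have := Nat.find_min hex (Nat.sub_lt hpos Nat.one_pos)
    rw [Nat.sub_add_cancel hpos] at this
    exact not_le.mp this

theorem FlagTuple.rel_trans {s : ℕ} {l : Fin s → ℕ} {S : Finset ℕ} (n : FlagTuple l S)
    {x y z : BlockChain l} (hxy : n.rel x y) (hyz : n.rel y z) : n.rel x z := by
  obtain ⟨h1, c, hc, hcx, hcy⟩ := hxy
  obtain ⟨h2, d, hd, hdy, hdz⟩ := hyz
  have hdc : d ≤ c := by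
    by_contra h
    have := n.entry_antitone y.1 (show c + 1 ≤ d by omega)
    omega
  exact ⟨le_trans h1 h2, d, hd, lt_of_lt_of_le hcx (n.entry_antitone x.1 hdc), hdz⟩

theorem FlagTuple.le_of_rel {s : ℕ} {l : Fin s → ℕ} {S : Finset ℕ} (n : FlagTuple l S)
    {x y : BlockChain l} (h : n.rel x y) : x ≤ y := h.1

/-- The relation `≼'` on `C ∖ D`, with respect to an isomorphism `e` from `C'` to `l`: between
two elements of `C'` it is the relation above, transported along `e`; if one of the two elements
is not in `C'`, it is the original preorder. -/
def flagRel {C : Type*} [Preorder C] (D : Finset C) {s : ℕ} {l : Fin s → ℕ}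
    (e : aboveClot D ≃o BlockChain l) {S : Finset ℕ} (n : FlagTuple l S)
    (x y : {x : C // x ∉ D}) : Prop :=
  (∃ (hx : x.1 ∈ aboveClot D) (hy : y.1 ∈ aboveClot D), n.rel (e ⟨x.1, hx⟩) (e ⟨y.1, hy⟩)) ∨
    (¬ (x.1 ∈ aboveClot D ∧ y.1 ∈ aboveClot D) ∧ x.1 ≤ y.1)

/-- The preordered set `O(S, n) = (C ∖ D, ≼')`. -/
@[reducible] def flagPreorder {C : Type*} [Preorder C] (D : Finset C) {s : ℕ} {l : Fin s → ℕ}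
    (e : aboveClot D ≃o BlockChain l) {S : Finset ℕ} (n : FlagTuple l S) :
    Preorder {x : C // x ∉ D} where
  le := flagRel D e n
  lt x y := flagRel D e n x y ∧ ¬ flagRel D e n y x
  lt_iff_le_not_ge _ _ := Iff.rfl
  le_refl x := by
    by_cases hx : x.1 ∈ aboveClot D
    · exact Or.inl ⟨hx, hx, n.rel_refl _⟩
    · exact Or.inr ⟨fun h => hx h.1, le_rfl⟩
  le_trans x y z := by
    have key : ∀ {x y : {x : C // x ∉ D}}, flagRel D e n x y → x.1 ≤ y.1 := by
      rintro x y (⟨hx, hy, h⟩ | h)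
      · exact e.le_iff_le.mp (n.le_of_rel h)
      · exact h.2
    intro hxy hyz
    have hxz : x.1 ≤ z.1 := le_trans (key hxy) (key hyz)
    by_cases hC : x.1 ∈ aboveClot D ∧ z.1 ∈ aboveClot D
    · have hy : y.1 ∈ aboveClot D := ⟨y.2, fun d hd => le_trans (hC.1.2 d hd) (key hxy)⟩
      rcases hxy with ⟨hx, _, h1⟩ | h1
      · rcases hyz with ⟨_, hz, h2⟩ | h2
        · exact Or.inl ⟨hx, hz, n.rel_trans h1 h2⟩
        · exact absurd ⟨hy, hC.2⟩ h2.1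
      · exact absurd ⟨hC.1, hy⟩ h1.1
    · exact Or.inr ⟨hC, hxz⟩

/-! By Burnside's lemma `ρ_C` times the order of `P^C` is the number of commuting pairs `(g, X)`
with `g ∈ P^C` and `X ∈ N^C`, so it suffices to count such pairs.

Put `W = K^D` and `U = K^{C'}`. Minimality of `D` makes the matrices in `M^C` block triangular: an
arbitrary block on `D`, an arbitrary block from `D` to `C'`, and a block in `M^{C∖D}`. Fix a
commuting pair on `C∖D`, with induced pair `(h, Z)` on `U`, and a commuting pair `(a, A)` on `W`.
The admissible off-diagonal blocks form the kernel of a linear map, and trace duality shows that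
there are `|Hom(W, U)|` times as many of them as maps `T : U → W` intertwining `(h, Z)` with `(a,
A)` (`card_ker_offDiagonalMap`).

The triples `(a, A, T)` are sorted by `M = ker T`, an invariant subspace of `U`. Pairs on `W` that
extend the one on `U/M` are again block triangular, so duality applies a second time and leads to
triples on a space of dimension `dim W - codim M` (`kerCount_mul_cardGL`). For `M = U` only
commuting pairs on `W` remain, and by the Jordan form there are `|GL(W)| p(dim W)` of them
(`card_commPairs`). Iteration yields `|GL(W)|` times a sum over multichains of proper invariant
subspaces (`homCount_eq_cardGL_mul_chainTotal`). Such a multichain is a flag with set of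
codimensions `S` together with a partition whose set of parts is `S`. The zero subspace is always
invariant, hence the terms `r(j, S) + r(j, S ∪ {m})`.

It remains to sum the number of invariant flags over the pairs on `C∖D`, that is, to sum over flags
the number of pairs preserving them (`sum_card_invFlag`). The orbits of `P^{C∖D}` on flags are
represented by the coordinate flags of the tuples `n`: two chains of subspaces have a common adapted
basis. The matrices in `M^{C∖D}` that preserve such a flag form `M^{O(S,n)}`, so Burnside's lemma
for `O(S,n)` and the orbit-stabilizer theorem give `|P^{C∖D}| ∑ ρ_{O(S,n)}`. Division by `|P^C|`
gives the formula. -/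

set_option linter.unusedSectionVars false
open Module

/-! ### Trace duality between off-diagonal blocks and intertwining maps -/

section Duality

variable {K W U : Type*} [Field K] [AddCommGroup W] [Module K W] [AddCommGroup U] [Module K U]

/-- The linear maps `T : U → W` that intertwine `h` with `a` and `Z` with `A`. -/
def intertwiners (h Z : End K U) (a A : End K W) : Submodule K (U →ₗ[K] W) where
  carrier := {T | T ∘ₗ h = a ∘ₗ T ∧ T ∘ₗ Z = A ∘ₗ T}
  add_mem' := by
    rintro S T ⟨h1, h2⟩ ⟨h3, h4⟩
    simp only [Set.mem_ofPred_eq, LinearMap.add_comp, LinearMap.comp_add, h1, h2, h3, h4, and_self]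
  zero_mem' := by simp
  smul_mem' := by
    rintro c T ⟨h1, h2⟩
    simp only [Set.mem_ofPred_eq, LinearMap.smul_comp, LinearMap.comp_smul, h1, h2, and_self]

theorem mem_intertwiners {h Z : End K U} {a A : End K W} {T : U →ₗ[K] W} :
    T ∈ intertwiners h Z a A ↔ T ∘ₗ h = a ∘ₗ T ∧ T ∘ₗ Z = A ∘ₗ T := Iff.rfl

/-- The map `(b, B) ↦ B a + Z b - (b A + h B)`, whose kernel describes the commuting pairs of
block triangular endomorphisms of `W × U` with given diagonal blocks. -/
def offDiagonalMap (h Z : End K U) (a A : End K W) :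
    (W →ₗ[K] U) × (W →ₗ[K] U) →ₗ[K] (W →ₗ[K] U) where
  toFun x := x.2 ∘ₗ a + Z ∘ₗ x.1 - (x.1 ∘ₗ A + h ∘ₗ x.2)
  map_add' x y := by
    simp only [Prod.fst_add, Prod.snd_add, LinearMap.add_comp, LinearMap.comp_add]
    abel
  map_smul' c x := by
    simp only [Prod.smul_fst, Prod.smul_snd, LinearMap.smul_comp, LinearMap.comp_smul,
      RingHom.id_apply, smul_sub, smul_add]

theorem mem_ker_offDiagonalMap {h Z : End K U} {a A : End K W}
    {x : (W →ₗ[K] U) × (W →ₗ[K] U)} :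
    x ∈ (offDiagonalMap h Z a A).ker ↔ x.2 ∘ₗ a + Z ∘ₗ x.1 = x.1 ∘ₗ A + h ∘ₗ x.2 := by
  rw [LinearMap.mem_ker, ← sub_eq_zero (b := _ + _)]
  rfl

variable [FiniteDimensional K W] [FiniteDimensional K U]

/-- The trace pairing between `Hom(U, W)` and `Hom(W, U)`. -/
noncomputable def tracePairing (K W U : Type*) [Field K] [AddCommGroup W] [Module K W]
    [AddCommGroup U] [Module K U] : (U →ₗ[K] W) →ₗ[K] Dual K (W →ₗ[K] U) :=
  LinearMap.mk₂ K (fun T B => LinearMap.trace K W (T ∘ₗ B))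
    (by simp [LinearMap.add_comp]) (by simp [LinearMap.smul_comp])
    (by simp [LinearMap.comp_add]) (by simp [LinearMap.comp_smul])

theorem tracePairing_apply (T : U →ₗ[K] W) (B : W →ₗ[K] U) :
    tracePairing K W U T B = LinearMap.trace K W (T ∘ₗ B) := rfl

/-- Rank one maps suffice as test elements: against `w ↦ f(w) u` the pairing has the value `f(T u)`.
-/
theorem tracePairing_injective : Function.Injective (tracePairing K W U) := by
  rw [injective_iff_map_eq_zero]
  intro T hT
  ext u
  refine (Module.forall_dual_apply_eq_zero_iff (R := K) (v := T u)).mp fun f => ?_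
  have h0 : LinearMap.trace K W (T ∘ₗ f.smulRight u) = 0 := LinearMap.congr_fun hT (f.smulRight u)
  rw [← LinearMap.trace_smulRight f (T u), ← h0]
  congr 1
  ext w
  simp

/-- The trace pairing as a linear equivalence. -/
noncomputable def tracePairingEquiv (K W U : Type*) [Field K] [AddCommGroup W] [Module K W]
    [AddCommGroup U] [Module K U] [FiniteDimensional K W] [FiniteDimensional K U] :
    (U →ₗ[K] W) ≃ₗ[K] Dual K (W →ₗ[K] U) :=
  LinearEquiv.ofInjectiveOfFinrankEq (tracePairing K W U) tracePairing_injective (by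
    rw [Subspace.dual_finrank_eq, finrank_linearMap, finrank_linearMap, mul_comm])

/-- Cyclicity of the trace rewrites the pairing of `T` with `B a + Z b - b A - h B` as `tr((aT -
Th)B) + tr((TZ - AT)b)`. Since `b` and `B` are independent, this vanishes identically exactly when
`T` intertwines. -/
theorem intertwiners_eq_comap (h Z : End K U) (a A : End K W) :
    intertwiners h Z a A =
      (offDiagonalMap h Z a A).range.dualAnnihilator.comap
        (tracePairingEquiv K W U : (U →ₗ[K] W) →ₗ[K] _) := by
  have key : ∀ (T : U →ₗ[K] W) (b B : W →ₗ[K] U),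
      tracePairing K W U T (offDiagonalMap h Z a A (b, B)) =
        tracePairing K W U (a ∘ₗ T - T ∘ₗ h) B + tracePairing K W U (T ∘ₗ Z - A ∘ₗ T) b := by
    intro T b B
    have e1 : LinearMap.trace K W ((T ∘ₗ B) ∘ₗ a) = LinearMap.trace K W (a ∘ₗ (T ∘ₗ B)) :=
      LinearMap.trace_comp_comm' _ _
    have e2 : LinearMap.trace K W ((T ∘ₗ b) ∘ₗ A) = LinearMap.trace K W (A ∘ₗ (T ∘ₗ b)) :=
      LinearMap.trace_comp_comm' _ _
    simp only [map_sub, LinearMap.sub_apply]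
    simp only [tracePairing_apply, offDiagonalMap, LinearMap.coe_mk, AddHom.coe_mk,
      map_sub, map_add,
      LinearMap.comp_assoc] at e1 e2 ⊢
    rw [e1, e2]
    ring
  ext T
  rw [Submodule.mem_comap, Submodule.mem_dualAnnihilator, mem_intertwiners]
  change _ ↔ ∀ w ∈ (offDiagonalMap h Z a A).range, tracePairing K W U T w = 0
  constructor
  · rintro ⟨h1, h2⟩ _ ⟨⟨b, B⟩, rfl⟩
    rw [key, h1, h2, sub_self, sub_self, map_zero, LinearMap.zero_apply, LinearMap.zero_apply,
      add_zero]
  · intro H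
    have H' := fun b B => (key T b B).symm.trans (H _ ⟨(b, B), rfl⟩)
    constructor
    · refine (sub_eq_zero.mp (tracePairing_injective ?_)).symm
      ext B
      simpa using H' 0 B
    · refine sub_eq_zero.mp (tracePairing_injective ?_)
      ext b
      simpa using H' b 0

/-- Rank-nullity: the source has twice the dimension of `Hom(W, U)`, and the codimension of the
range in `Hom(W, U)` is the dimension of its annihilator, the space of intertwiners. -/
theorem finrank_ker_offDiagonalMap (h Z : End K U) (a A : End K W) :
    finrank K (offDiagonalMap h Z a A).ker =
      finrank K (W →ₗ[K] U) + finrank K (intertwiners h Z a A) := by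
  have h1 := LinearMap.finrank_range_add_finrank_ker (offDiagonalMap h Z a A)
  have h2 := Subspace.finrank_add_finrank_dualAnnihilator_eq (offDiagonalMap h Z a A).range
  have h3 : finrank K (intertwiners h Z a A) =
      finrank K (offDiagonalMap h Z a A).range.dualAnnihilator := by
    rw [intertwiners_eq_comap]
    rw [Submodule.comap_equiv_eq_map_symm]
    exact LinearEquiv.finrank_map_eq _ _
  rw [finrank_prod] at h1
  omega

theorem card_ker_offDiagonalMap [Finite K] (h Z : End K U) (a A : End K W) :
    Nat.card (offDiagonalMap h Z a A).ker =
      Nat.card (W →ₗ[K] U) * Nat.card (intertwiners h Z a A) := by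
  rw [Module.natCard_eq_pow_finrank (K := K), finrank_ker_offDiagonalMap, pow_add,
    ← Module.natCard_eq_pow_finrank (K := K), ← Module.natCard_eq_pow_finrank (K := K)]

end Duality

/-! ### Counting injective maps and general linear groups -/

section Injections

variable {K U W : Type*} [Field K] [Finite K] [AddCommGroup W] [Module K W] [AddCommGroup U]
  [Module K U] [FiniteDimensional K W] [FiniteDimensional K U]

theorem card_injective_linearMap (h : finrank K U ≤ finrank K W) :
    Nat.card {T : U →ₗ[K] W // Function.Injective T} =
      ∏ i ∈ Finset.range (finrank K U), (Nat.card K ^ finrank K W - Nat.card K ^ i) := by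
  have := Fintype.ofFinite K
  have : Finite W := Module.finite_of_finite K
  let b := finBasis K U
  have e : {T : U →ₗ[K] W // Function.Injective T} ≃
      {s : Fin (finrank K U) → W // LinearIndependent K s} :=
    ((b.constr ℕ (M' := W)).symm.toEquiv).subtypeEquiv (fun T => by
      change _ ↔ LinearIndependent K ((b.constr ℕ (M' := W)).symm T)
      have hT : ((b.constr ℕ (M' := W)).symm T) = T ∘ b := by
        ext i; simp [Basis.constr]
      rw [hT]
      refine ⟨fun hi => b.linearIndependent.map' T (LinearMap.ker_eq_bot.mpr hi), fun hl => ?_⟩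
      have : T = b.constr ℕ (T ∘ b) := by
        rw [← hT, LinearEquiv.apply_symm_apply]
      rw [← LinearMap.ker_eq_bot, LinearMap.ker_eq_bot']
      intro m hm
      rw [this, Basis.constr_apply_fintype] at hm
      have h0 := Fintype.linearIndependent_iff.mp hl _ hm
      exact b.ext_elem (fun i => by simpa using h0 i))
  rw [Nat.card_congr e, card_linearIndependent h, Nat.card_eq_fintype_card,
    Finset.prod_range]

omit [Finite K] in
theorem isUnit_end_iff_injective (a : End K W) : IsUnit a ↔ Function.Injective a := by
  rw [Module.End.isUnit_iff]
  exact ⟨fun h => h.1, fun h => ⟨h, LinearMap.injective_iff_surjective.mp h⟩⟩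

variable (K W) in
/-- The order of the general linear group of `W`. -/
noncomputable def cardGL : ℕ := Nat.card {a : End K W // IsUnit a}

theorem cardGL_eq_prod :
    cardGL K W = ∏ i ∈ Finset.range (finrank K W), (Nat.card K ^ finrank K W - Nat.card K ^ i) := by
  rw [← card_injective_linearMap le_rfl, cardGL]
  exact Nat.card_congr (Equiv.subtypeEquivRight isUnit_end_iff_injective)

theorem cardGL_pos : 0 < cardGL K W := by
  have : Finite W := Module.finite_of_finite K
  have : Finite (End K W) := Module.finite_of_finite K
  rw [cardGL, Nat.card_pos_iff]
  exact ⟨⟨1, isUnit_one⟩, inferInstance⟩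

/-- The first `dim U` factors of the product for `|GL(W)|` count the injections; each further factor
is `q^(dim U)` times a factor of `|GL(V)|`. -/
theorem card_injective_mul {V : Type*} [AddCommGroup V] [Module K V] [FiniteDimensional K V]
    (h : finrank K W = finrank K V + finrank K U) :
    Nat.card {T : U →ₗ[K] W // Function.Injective T} * (Nat.card (V →ₗ[K] U) * cardGL K V) =
      cardGL K W := by
  rw [card_injective_linearMap (by omega), cardGL_eq_prod, cardGL_eq_prod,
    Module.natCard_eq_pow_finrank (K := K) (V := V →ₗ[K] U), finrank_linearMap, h,
    add_comm (finrank K V), Finset.prod_range_add, mul_comm (finrank K V), pow_mul]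
  congr 1
  calc _ = ∏ i ∈ Finset.range (finrank K V),
        (Nat.card K ^ finrank K U * (Nat.card K ^ finrank K V - Nat.card K ^ i)) := by
        rw [Finset.prod_mul_distrib, Finset.prod_const, Finset.card_range]
    _ = _ := Finset.prod_congr rfl fun i _ => by rw [Nat.mul_sub, ← pow_add, ← pow_add]

end Injections

/-! ### Block triangular endomorphisms and extensions of commuting pairs -/

section BlockEnd

variable {K V U : Type*} [Field K] [AddCommGroup V] [Module K V] [AddCommGroup U] [Module K U]

/-- The block triangular endomorphism `(v, u) ↦ (a v, b v + h u)` of `V × U`. -/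
def blockEnd (a : End K V) (b : V →ₗ[K] U) (h : End K U) : End K (V × U) :=
  (a ∘ₗ LinearMap.fst K V U).prod (b ∘ₗ LinearMap.fst K V U + h ∘ₗ LinearMap.snd K V U)

@[simp]
theorem blockEnd_apply (a : End K V) (b : V →ₗ[K] U) (h : End K U) (x : V × U) :
    blockEnd a b h x = (a x.1, b x.1 + h x.2) := rfl

theorem blockEnd_injective {a A : End K V} {b B : V →ₗ[K] U} {h Z : End K U}
    (H : blockEnd a b h = blockEnd A B Z) : a = A ∧ b = B ∧ h = Z := by
  refine ⟨?_, ?_, ?_⟩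
  · ext v; simpa using congrArg Prod.fst (LinearMap.congr_fun H (v, 0))
  · ext v; simpa using congrArg Prod.snd (LinearMap.congr_fun H (v, 0))
  · ext u; simpa using congrArg Prod.snd (LinearMap.congr_fun H (0, u))

theorem blockEnd_mul (a A : End K V) (b B : V →ₗ[K] U) (h Z : End K U) :
    blockEnd a b h * blockEnd A B Z = blockEnd (a * A) (b ∘ₗ A + h ∘ₗ B) (h * Z) := by
  ext x <;> simp

theorem blockEnd_zero : blockEnd (0 : End K V) 0 (0 : End K U) = 0 := by
  ext x <;> simp

theorem exists_blockEnd_pow (a : End K V) (b : V →ₗ[K] U) (h : End K U) (n : ℕ) :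
    ∃ c, blockEnd a b h ^ n = blockEnd (a ^ n) c (h ^ n) := by
  induction n with
  | zero => exact ⟨0, by ext x <;> simp⟩
  | succ n ih =>
    obtain ⟨c, hc⟩ := ih
    exact ⟨_, by rw [pow_succ, hc, blockEnd_mul, ← pow_succ, ← pow_succ]⟩

theorem isNilpotent_blockEnd {a : End K V} {b : V →ₗ[K] U} {h : End K U} :
    IsNilpotent (blockEnd a b h) ↔ IsNilpotent a ∧ IsNilpotent h := by
  constructor
  · rintro ⟨n, hn⟩
    obtain ⟨c, hc⟩ := exists_blockEnd_pow a b h n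
    rw [hn, ← blockEnd_zero] at hc
    obtain ⟨h1, -, h2⟩ := blockEnd_injective hc
    exact ⟨⟨n, h1.symm⟩, ⟨n, h2.symm⟩⟩
  · rintro ⟨⟨n, hn⟩, ⟨m, hm⟩⟩
    obtain ⟨c, hc⟩ := exists_blockEnd_pow a b h (n + m)
    rw [pow_eq_zero_of_le (Nat.le_add_right n m) hn,
      pow_eq_zero_of_le (Nat.le_add_left m n) hm] at hc
    -- The power `n + m` kills both diagonal blocks; what is left is strictly triangular and has
    -- square zero.
    refine ⟨(n + m) * 2, ?_⟩
    rw [pow_mul, hc, pow_two, blockEnd_mul, ← blockEnd_zero]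
    simp

theorem isUnit_blockEnd [FiniteDimensional K V] [FiniteDimensional K U]
    {a : End K V} {b : V →ₗ[K] U} {h : End K U} (hh : IsUnit h) :
    IsUnit (blockEnd a b h) ↔ IsUnit a := by
  rw [isUnit_end_iff_injective] at hh
  constructor
  · intro H
    obtain ⟨-, hs⟩ := (Module.End.isUnit_iff _).mp H
    rw [isUnit_end_iff_injective]
    refine LinearMap.injective_iff_surjective.mpr fun v => ?_
    obtain ⟨x, hx⟩ := hs (v, 0)
    exact ⟨x.1, congrArg Prod.fst hx⟩
  · rw [isUnit_end_iff_injective, isUnit_end_iff_injective]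
    intro ha
    rw [injective_iff_map_eq_zero]
    rintro ⟨v, u⟩ hx
    rw [blockEnd_apply, Prod.mk_eq_zero] at hx
    obtain rfl : v = 0 := ha (by simpa using hx.1)
    obtain rfl : u = 0 := hh (by simpa using hx.2)
    rfl

theorem commute_blockEnd {a A : End K V} {b B : V →ₗ[K] U} {h Z : End K U} (hc : Commute h Z) :
    Commute (blockEnd a b h) (blockEnd A B Z) ↔
      Commute a A ∧ (b, B) ∈ (offDiagonalMap h Z a A).ker := by
  rw [mem_ker_offDiagonalMap, Commute, SemiconjBy, blockEnd_mul, blockEnd_mul]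
  constructor
  · intro H
    obtain ⟨h1, h2, -⟩ := blockEnd_injective H
    exact ⟨h1, h2.symm⟩
  · rintro ⟨h1, h2⟩
    rw [h1.eq, hc.eq, h2]

/-- Block triangular shape is thereby expressed as an intertwining condition on the inclusion of
`U`, a condition that makes sense for any injection `U → W`. -/
theorem inr_comp_eq_iff {a : End K (V × U)} {h : End K U} :
    LinearMap.inr K V U ∘ₗ h = a ∘ₗ LinearMap.inr K V U ↔
      a = blockEnd (LinearMap.fst K V U ∘ₗ a ∘ₗ LinearMap.inl K V U)
        (LinearMap.snd K V U ∘ₗ a ∘ₗ LinearMap.inl K V U) h := by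
  constructor
  · intro H
    have H' : ∀ u, a (0, u) = (0, h u) := fun u => (LinearMap.congr_fun H u).symm
    refine LinearMap.ext fun x => ?_
    have : x = (x.1, 0) + (0, x.2) := by simp
    conv_lhs => rw [this, map_add, H']
    ext <;> simp
  · generalize LinearMap.fst K V U ∘ₗ a ∘ₗ LinearMap.inl K V U = a'
    generalize LinearMap.snd K V U ∘ₗ a ∘ₗ LinearMap.inl K V U = b'
    rintro rfl
    ext u <;> simp

/-- The pairs consisting of an invertible and a nilpotent endomorphism of `V` that commute. -/
def commPairs (K V : Type*) [Field K] [AddCommGroup V] [Module K V] :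
    Set (End K V × End K V) :=
  {x | IsUnit x.1 ∧ IsNilpotent x.2 ∧ Commute x.1 x.2}

/-- The number of triples `(a, A, T)` of a commuting pair `(a, A)` of an invertible and a nilpotent
endomorphism of `W` and a linear map `T` that intertwines `h` with `a` and `Z` with `A` and
vanishes on `L`. -/
noncomputable def homCount (W : Type*) [AddCommGroup W] [Module K W] (h Z : End K U)
    (L : Submodule K U) : ℕ :=
  Nat.card {x : (End K W × End K W) × (U →ₗ[K] W) //
    x.1 ∈ commPairs K W ∧ x.2 ∈ intertwiners h Z x.1.1 x.1.2 ∧ L ≤ x.2.ker}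

/-- As `homCount`, but counting only the linear maps with kernel equal to `L`. -/
noncomputable def kerCount (W : Type*) [AddCommGroup W] [Module K W] (h Z : End K U)
    (L : Submodule K U) : ℕ :=
  Nat.card {x : (End K W × End K W) × (U →ₗ[K] W) //
    x.1 ∈ commPairs K W ∧ x.2 ∈ intertwiners h Z x.1.1 x.1.2 ∧ x.2.ker = L}

/-- Commuting pairs of block triangular endomorphisms with given second diagonal block. -/
noncomputable def extensionPairsEquiv [FiniteDimensional K V] [FiniteDimensional K U]
    {h Z : End K U} (hh : IsUnit h) (hZ : IsNilpotent Z) (hc : Commute h Z) :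
    (Σ y : commPairs K V, (offDiagonalMap h Z y.1.1 y.1.2).ker) ≃
    {x : End K (V × U) × End K (V × U) //
      x ∈ commPairs K (V × U) ∧ LinearMap.inr K V U ∈ intertwiners h Z x.1 x.2} :=
  Equiv.ofBijective
    (fun y => ⟨(blockEnd y.1.1.1 y.2.1.1 h, blockEnd y.1.1.2 y.2.1.2 Z),
      ⟨(isUnit_blockEnd hh).mpr y.1.2.1, isNilpotent_blockEnd.mpr ⟨y.1.2.2.1, hZ⟩,
        (commute_blockEnd hc).mpr ⟨y.1.2.2.2, y.2.2⟩⟩,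
      by ext u <;> simp, by ext u <;> simp⟩) (by
    constructor
    · rintro ⟨⟨⟨a, A⟩, hy⟩, ⟨⟨b, B⟩, hb⟩⟩ ⟨⟨⟨a', A'⟩, hy'⟩, ⟨⟨b', B'⟩, hb'⟩⟩ H
      have H' := congrArg Subtype.val H
      obtain ⟨rfl, rfl, -⟩ := blockEnd_injective (congrArg Prod.fst H')
      obtain ⟨rfl, rfl, -⟩ := blockEnd_injective (congrArg Prod.snd H')
      rfl
    · rintro ⟨⟨x, y⟩, ⟨h1, h2, h3⟩, h4, h5⟩
      rw [inr_comp_eq_iff] at h4 h5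
      dsimp only at h1 h2 h3 h4 h5
      have h3' := h3
      rw [h4, h5, commute_blockEnd hc] at h3'
      rw [h4, isUnit_blockEnd hh] at h1
      rw [h5, isNilpotent_blockEnd] at h2
      exact ⟨⟨⟨(_, _), h1, h2.1, h3'.1⟩, ⟨(_, _), h3'.2⟩⟩, Subtype.ext (Prod.ext h4.symm h5.symm)⟩)

theorem homCount_bot_eq_sum [Finite K] [FiniteDimensional K V] [FiniteDimensional K U]
    (h Z : End K U) [Fintype (commPairs K V)] :
    homCount V h Z ⊥ =
      ∑ y : commPairs K V, Nat.card (intertwiners h Z y.1.1 y.1.2) := by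
  have : Finite V := Module.finite_of_finite K
  have : Finite (End K V) := Module.finite_of_finite K
  have : Finite (U →ₗ[K] V) := Module.finite_of_finite K
  rw [← Nat.card_sigma, homCount]
  refine Nat.card_congr
    { toFun := fun x => ⟨⟨x.1.1, x.2.1⟩, ⟨x.1.2, x.2.2.1⟩⟩
      invFun := fun y => ⟨(y.1.1, y.2.1), y.1.2, y.2.2, bot_le⟩
      left_inv := fun x => rfl
      right_inv := fun y => rfl }

/-- Over each commuting pair on `V` the off-diagonal blocks form a kernel whose size is known by
trace duality. -/
theorem card_extensionPairs_prod [Finite K] [FiniteDimensional K V] [FiniteDimensional K U]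
    {h Z : End K U} (hh : IsUnit h) (hZ : IsNilpotent Z) (hc : Commute h Z) :
    Nat.card {x : End K (V × U) × End K (V × U) //
      x ∈ commPairs K (V × U) ∧ LinearMap.inr K V U ∈ intertwiners h Z x.1 x.2} =
    Nat.card (V →ₗ[K] U) * homCount V h Z ⊥ := by
  have : Finite V := Module.finite_of_finite K
  have : Finite U := Module.finite_of_finite K
  have : Finite (End K V) := Module.finite_of_finite K
  have : Finite (V →ₗ[K] U) := Module.finite_of_finite K
  have := Fintype.ofFinite (commPairs K V)
  rw [← Nat.card_congr (extensionPairsEquiv hh hZ hc), Nat.card_sigma, homCount_bot_eq_sum,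
    Finset.mul_sum]
  exact Finset.sum_congr rfl fun y _ => card_ker_offDiagonalMap _ _ _ _

theorem LinearEquiv.mem_commPairs_conj {W W' : Type*} [AddCommGroup W] [Module K W]
    [AddCommGroup W'] [Module K W'] (e : W ≃ₗ[K] W') (x : End K W × End K W) :
    (e.conj x.1, e.conj x.2) ∈ commPairs K W' ↔ x ∈ commPairs K W := by
  change IsUnit (e.conjAlgEquiv K x.1) ∧ IsNilpotent (e.conjAlgEquiv K x.2) ∧
    Commute (e.conjAlgEquiv K x.1) (e.conjAlgEquiv K x.2) ↔ _
  rw [isUnit_map_iff, IsNilpotent.map_iff (e.conjAlgEquiv K).injective,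
    commute_map_iff (e.conjAlgEquiv K).injective]
  rfl

theorem exists_equiv_prod_of_injective {W : Type*} [AddCommGroup W] [Module K W]
    [FiniteDimensional K W] [FiniteDimensional K V] [FiniteDimensional K U]
    (hr : finrank K W = finrank K V + finrank K U) {T : U →ₗ[K] W} (hT : Function.Injective T) :
    ∃ e : (V × U) ≃ₗ[K] W, ∀ u, e (0, u) = T u := by
  obtain ⟨Q, hQ⟩ := T.range.exists_isCompl
  have h1 := LinearMap.finrank_range_of_inj hT
  have h2 := Submodule.finrank_add_eq_of_isCompl hQ
  let e1 : V ≃ₗ[K] Q := LinearEquiv.ofFinrankEq V Q (by omega)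
  let e2 : U ≃ₗ[K] T.range := LinearEquiv.ofInjective T hT
  refine ⟨(e1.prodCongr e2).trans (Submodule.prodEquivOfIsCompl Q T.range hQ.symm), fun u => ?_⟩
  simp [e2]

/-- A complement of the range of `T` identifies `(W, T)` with `V × U` and the inclusion of `U`, so
the count does not depend on `T`. -/
theorem card_extensionPairs [Finite K] [FiniteDimensional K V] [FiniteDimensional K U]
    {W : Type*} [AddCommGroup W] [Module K W] [FiniteDimensional K W]
    (hr : finrank K W = finrank K V + finrank K U)
    {h Z : End K U} (hh : IsUnit h) (hZ : IsNilpotent Z) (hc : Commute h Z)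
    {T : U →ₗ[K] W} (hT : Function.Injective T) :
    Nat.card {x : End K W × End K W // x ∈ commPairs K W ∧ T ∈ intertwiners h Z x.1 x.2} =
    Nat.card (V →ₗ[K] U) * homCount V h Z ⊥ := by
  obtain ⟨e, he⟩ := exists_equiv_prod_of_injective hr hT
  rw [← card_extensionPairs_prod hh hZ hc]
  symm
  refine Nat.card_congr
    (((e.conj.toEquiv).prodCongr (e.conj.toEquiv)).subtypeEquiv fun x => ?_)
  refine and_congr (e.mem_commPairs_conj x).symm ?_
  have key : ∀ (g : End K U) (a : End K (V × U)),
      LinearMap.inr K V U ∘ₗ g = a ∘ₗ LinearMap.inr K V U ↔ T ∘ₗ g = e.conj a ∘ₗ T := by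
    intro g a
    simp only [LinearMap.ext_iff, LinearMap.comp_apply, LinearEquiv.conj_apply_apply, ← he,
      LinearEquiv.symm_apply_apply, LinearMap.inr_apply, e.injective.eq_iff]
  exact and_congr (key h x.1) (key Z x.2)

/-- Injective intertwining maps are counted by all intertwining maps into a smaller space. -/
theorem kerCount_bot_mul_cardGL [Finite K] [FiniteDimensional K V] [FiniteDimensional K U]
    {W : Type*} [AddCommGroup W] [Module K W] [FiniteDimensional K W]
    (hr : finrank K W = finrank K V + finrank K U)
    {h Z : End K U} (hh : IsUnit h) (hZ : IsNilpotent Z) (hc : Commute h Z) :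
    kerCount W h Z ⊥ * cardGL K V = cardGL K W * homCount V h Z ⊥ := by
  have : Finite W := Module.finite_of_finite K
  have : Finite U := Module.finite_of_finite K
  have : Finite (End K W) := Module.finite_of_finite K
  have : Finite (U →ₗ[K] W) := Module.finite_of_finite K
  have := Fintype.ofFinite {T : U →ₗ[K] W // Function.Injective T}
  have e : {x : (End K W × End K W) × (U →ₗ[K] W) //
      x.1 ∈ commPairs K W ∧ x.2 ∈ intertwiners h Z x.1.1 x.1.2 ∧ x.2.ker = ⊥} ≃
      Σ T : {T : U →ₗ[K] W // Function.Injective T},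
        {x : End K W × End K W // x ∈ commPairs K W ∧ T.1 ∈ intertwiners h Z x.1 x.2} :=
    { toFun := fun x => ⟨⟨x.1.2, LinearMap.ker_eq_bot.mp x.2.2.2⟩, ⟨x.1.1, x.2.1, x.2.2.1⟩⟩
      invFun := fun y => ⟨(y.2.1, y.1.1), y.2.2.1, y.2.2.2, LinearMap.ker_eq_bot.mpr y.1.2⟩
      left_inv := fun x => rfl
      right_inv := fun y => rfl }
  -- Every injection `T` contributes the same number of pairs, so the sum over `T` is a product with
  -- the number of injections.
  rw [kerCount, Nat.card_congr e, Nat.card_sigma,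
    Finset.sum_congr rfl fun T _ => card_extensionPairs hr hh hZ hc T.2, Finset.sum_const,
    Finset.card_univ, ← Nat.card_eq_fintype_card, ← card_injective_mul (U := U) hr, smul_eq_mul]
  ring

end BlockEnd

/-! ### Intertwining maps sorted by their kernel -/

section Recursion

variable {K U : Type*} [Field K] [AddCommGroup U] [Module K U]

/-- `L` is invariant under `h` and `Z`. -/
def InvariantUnder (h Z : End K U) (L : Submodule K U) : Prop :=
  L ≤ L.comap h ∧ L ≤ L.comap Z

theorem invariantUnder_top (h Z : End K U) : InvariantUnder h Z ⊤ := by simp [InvariantUnder]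

theorem invariantUnder_bot (h Z : End K U) : InvariantUnder h Z ⊥ := by simp [InvariantUnder]

theorem invariantUnder_ker {W : Type*} [AddCommGroup W] [Module K W] {h Z : End K U}
    {a A : End K W} {T : U →ₗ[K] W} (hT : T ∈ intertwiners h Z a A) :
    InvariantUnder h Z T.ker := by
  constructor
  · intro u hu
    have := LinearMap.congr_fun hT.1 u
    simp only [LinearMap.comp_apply, LinearMap.mem_ker, Submodule.mem_comap] at this hu ⊢
    rw [this, hu, map_zero]
  · intro u hu
    have := LinearMap.congr_fun hT.2 u
    simp only [LinearMap.comp_apply, LinearMap.mem_ker, Submodule.mem_comap] at this hu ⊢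
    rw [this, hu, map_zero]

/-- The codimension of a subspace. -/
noncomputable def codim (L : Submodule K U) : ℕ := finrank K (U ⧸ L)

section Quotient

variable {W : Type*} [AddCommGroup W] [Module K W] {h Z : End K U} {L : Submodule K U}

theorem comp_mkQ_mem_intertwiners (hL : InvariantUnder h Z L) {a A : End K W}
    {T : (U ⧸ L) →ₗ[K] W} :
    T ∘ₗ L.mkQ ∈ intertwiners h Z a A ↔
      T ∈ intertwiners (L.mapQ L h hL.1) (L.mapQ L Z hL.2) a A := by
  simp only [mem_intertwiners, LinearMap.ext_iff, LinearMap.comp_apply,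
    (Submodule.mkQ_surjective L).forall, Submodule.mkQ_apply, Submodule.mapQ_apply]

theorem homCount_eq_quotient (hL : InvariantUnder h Z L) :
    homCount W h Z L = homCount W (L.mapQ L h hL.1) (L.mapQ L Z hL.2) ⊥ := by
  symm
  refine Nat.card_congr
    { toFun := fun x => ⟨(x.1.1, x.1.2 ∘ₗ L.mkQ), x.2.1,
        (comp_mkQ_mem_intertwiners hL).mpr x.2.2.1, fun u hu => by
          simp [(Submodule.Quotient.mk_eq_zero L).mpr hu]⟩
      invFun := fun x => ⟨(x.1.1, L.liftQ x.1.2 x.2.2.2), x.2.1,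
        (comp_mkQ_mem_intertwiners hL).mp (by rw [Submodule.liftQ_mkQ]; exact x.2.2.1), bot_le⟩
      left_inv := fun x => Subtype.ext (Prod.ext rfl (by
        ext u; simp))
      right_inv := fun x => Subtype.ext (Prod.ext rfl (by
        ext u; simp)) }

theorem kerCount_eq_quotient (hL : InvariantUnder h Z L) :
    kerCount W h Z L = kerCount W (L.mapQ L h hL.1) (L.mapQ L Z hL.2) ⊥ := by
  refine Nat.card_congr
    { toFun := fun x => ⟨(x.1.1, L.liftQ x.1.2 x.2.2.2.ge), x.2.1,
        (comp_mkQ_mem_intertwiners hL).mp (by rw [Submodule.liftQ_mkQ]; exact x.2.2.1),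
        Submodule.ker_liftQ_eq_bot _ _ _ x.2.2.2.le⟩
      invFun := fun x => ⟨(x.1.1, x.1.2 ∘ₗ L.mkQ), x.2.1,
        (comp_mkQ_mem_intertwiners hL).mpr x.2.2.1, by
          rw [LinearMap.ker_comp, x.2.2.2, Submodule.comap_bot, Submodule.ker_mkQ]⟩
      left_inv := fun x => Subtype.ext (Prod.ext rfl (by
        ext u; simp))
      right_inv := fun x => Subtype.ext (Prod.ext rfl (by
        ext u; simp)) }

theorem mapQ_pow_eq_zero {g : End K U} (hg : L ≤ L.comap g) {n : ℕ} (hn : g ^ n = 0) :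
    (L.mapQ L g hg) ^ n = 0 := by
  have := Submodule.mapQ_pow (p := L) (f := g) hg n
  ext u; simp [← this, hn]

end Quotient

variable [Finite K] [FiniteDimensional K U]

/-- Maps with kernel `L` are injections of `U ⧸ L`, where the induced endomorphisms are still
invertible, nilpotent and commuting; the injective case applies there. Normalised by the order of
the general linear group, fixing the kernel lowers the dimension of the target by `codim L`. -/
theorem kerCount_mul_cardGL {V W : Type*} [AddCommGroup V] [Module K V] [FiniteDimensional K V]
    [AddCommGroup W] [Module K W] [FiniteDimensional K W] {h Z : End K U} {L : Submodule K U}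
    (hL : InvariantUnder h Z L) (hh : IsUnit h) (hZ : IsNilpotent Z) (hc : Commute h Z)
    (hr : finrank K W = finrank K V + codim L) :
    kerCount W h Z L * cardGL K V = cardGL K W * homCount V h Z L := by
  rw [homCount_eq_quotient hL, kerCount_eq_quotient hL]
  refine kerCount_bot_mul_cardGL hr ?_ ?_ ?_
  · have hs := ((Module.End.isUnit_iff _).mp hh).2
    rw [isUnit_end_iff_injective, LinearMap.injective_iff_surjective]
    intro x
    obtain ⟨u, rfl⟩ := Submodule.mkQ_surjective L x
    obtain ⟨u, rfl⟩ := hs u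
    exact ⟨L.mkQ u, by simp⟩
  · obtain ⟨n, hn⟩ := hZ
    exact ⟨n, mapQ_pow_eq_zero hL.2 hn⟩
  · ext u
    simpa using congrArg L.mkQ (LinearMap.congr_fun hc.eq u)

theorem kerCount_eq_zero_of_not_invariantUnder {W : Type*} [AddCommGroup W] [Module K W]
    {h Z : End K U} {L : Submodule K U} (hL : ¬ InvariantUnder h Z L) :
    kerCount W h Z L = 0 := by
  have : IsEmpty {x : (End K W × End K W) × (U →ₗ[K] W) //
    x.1 ∈ commPairs K W ∧ x.2 ∈ intertwiners h Z x.1.1 x.1.2 ∧ x.2.ker = L} :=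
    ⟨fun x => hL (x.2.2.2 ▸ invariantUnder_ker x.2.2.1)⟩
  exact Nat.card_of_isEmpty

theorem kerCount_eq_zero_of_finrank_lt {W : Type*} [AddCommGroup W] [Module K W]
    [FiniteDimensional K W] {h Z : End K U} {L : Submodule K U} (hL : finrank K W < codim L) :
    kerCount W h Z L = 0 := by
  have : IsEmpty {x : (End K W × End K W) × (U →ₗ[K] W) //
      x.1 ∈ commPairs K W ∧ x.2 ∈ intertwiners h Z x.1.1 x.1.2 ∧ x.2.ker = L} := by
    refine ⟨fun x => hL.not_ge ?_⟩
    rw [codim, ← x.2.2.2, x.1.2.quotKerEquivRange.finrank_eq]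
    exact Submodule.finrank_le _
  exact Nat.card_of_isEmpty

theorem homCount_top {W : Type*} [AddCommGroup W] [Module K W] {h Z : End K U} :
    homCount W h Z ⊤ = Nat.card (commPairs K W) := by
  refine Nat.card_congr
    { toFun := fun x => ⟨x.1.1, x.2.1⟩
      invFun := fun x => ⟨(x.1, 0), x.2, Submodule.zero_mem _, LinearMap.ker_zero.ge⟩
      left_inv := fun x => Subtype.ext
        (Prod.ext rfl (LinearMap.ker_eq_top.mp (top_le_iff.mp x.2.2.2)).symm)
      right_inv := fun x => rfl }

open Classical in
theorem homCount_eq_sum_kerCount {W : Type*} [AddCommGroup W] [Module K W]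
    [FiniteDimensional K W] [Fintype (Submodule K U)] {h Z : End K U} {L : Submodule K U} :
    homCount W h Z L = ∑ M : Submodule K U with L ≤ M, kerCount W h Z M := by
  have : Finite W := Module.finite_of_finite K
  have : Finite U := Module.finite_of_finite K
  have : Finite (End K W) := Module.finite_of_finite K
  have : Finite (U →ₗ[K] W) := Module.finite_of_finite K
  rw [Finset.sum_subtype (p := fun M => L ≤ M) _ (by simp)]
  simp only [kerCount]
  rw [← Nat.card_sigma]
  refine Nat.card_congr
    { toFun := fun x => ⟨⟨x.1.2.ker, x.2.2.2⟩, ⟨x.1, x.2.1, x.2.2.1, rfl⟩⟩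
      invFun := fun y => ⟨y.2.1, y.2.2.1, y.2.2.2.1, y.1.2.trans y.2.2.2.2.ge⟩
      left_inv := fun x => rfl
      right_inv := ?_ }
  rintro ⟨⟨M, hM⟩, ⟨x, h1, h2, h3⟩⟩
  dsimp only at h3
  subst h3
  rfl

end Recursion

/-! ### Multichains of invariant subspaces and the solution of the recursion -/

section Multichains

variable {K U : Type*} [Field K] [AddCommGroup U] [Module K U]

/-- Multisets of proper invariant subspaces containing `L` that are totally ordered by inclusion,
with sum of codimensions equal to `j`. -/
def multichains (h Z : End K U) (L : Submodule K U) (j : ℕ) : Set (Multiset (Submodule K U)) :=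
  {s | (∀ M ∈ s, InvariantUnder h Z M ∧ M ≠ ⊤ ∧ L ≤ M) ∧
    (∀ M ∈ s, ∀ N ∈ s, M ≤ N ∨ N ≤ M) ∧ (s.map codim).sum = j}

variable [FiniteDimensional K U]

theorem codim_pos {L : Submodule K U} (hL : L ≠ ⊤) : 0 < codim L := by
  have : Nontrivial (U ⧸ L) := Submodule.Quotient.nontrivial_iff.mpr hL
  exact finrank_pos

theorem codim_anti {L M : Submodule K U} (hLM : L ≤ M) : codim M ≤ codim L := by
  have h1 := L.finrank_quotient_add_finrank
  have h2 := M.finrank_quotient_add_finrank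
  have h3 := Submodule.finrank_mono hLM
  unfold codim
  omega

theorem eq_of_le_of_codim_eq {L M : Submodule K U} (hLM : L ≤ M) (hc : codim L = codim M) :
    L = M := by
  have h1 := L.finrank_quotient_add_finrank
  have h2 := M.finrank_quotient_add_finrank
  unfold codim at hc
  exact Submodule.eq_of_le_of_finrank_eq hLM (by omega)

theorem codim_top : codim (⊤ : Submodule K U) = 0 := by
  have h2 := (⊤ : Submodule K U).finrank_quotient_add_finrank
  rw [finrank_top] at h2
  unfold codim
  omega

theorem codim_bot : codim (⊥ : Submodule K U) = finrank K U := by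
  have h2 := (⊥ : Submodule K U).finrank_quotient_add_finrank
  rw [finrank_bot] at h2
  unfold codim
  omega

/-- The members are proper, so each has codimension at least `1` and there are at most `j` of them.
Hence no multiplicity exceeds `j`. -/
theorem multichains_finite [Finite K] (h Z : End K U) (L : Submodule K U) (j : ℕ) :
    (multichains h Z L j).Finite := by
  classical
  have : Finite U := Module.finite_of_finite K
  have := Fintype.ofFinite (Submodule K U)
  refine (Multiset.powerset (j • (Finset.univ : Finset (Submodule K U)).val)).toFinset.finite_toSet.subset ?_
  rintro s ⟨h1, -, h3⟩
  simp only [Finset.mem_coe, Multiset.mem_toFinset, Multiset.mem_powerset]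
  refine Multiset.le_iff_count.mpr fun M => ?_
  rw [Multiset.count_nsmul, Multiset.count_univ, mul_one, ← h3]
  refine (Multiset.count_le_card M s).trans ?_
  rw [← Multiset.card_map codim s]
  refine (Multiset.card_nsmul_le_sum (a := 1) ?_).trans' (by simp)
  intro x hx
  obtain ⟨N, hN, rfl⟩ := Multiset.mem_map.mp hx
  exact codim_pos (h1 N hN).2.1

theorem exists_least_of_mem_multichains {h Z : End K U} {L : Submodule K U} {j : ℕ}
    {s : Multiset (Submodule K U)} (hs : s ∈ multichains h Z L j) (h0 : s ≠ 0) :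
    ∃ M ∈ s, ∀ N ∈ s, M ≤ N := by
  obtain ⟨M, hM, hmin⟩ := WellFounded.has_min (wellFounded_lt (α := Submodule K U))
    {M | M ∈ s} (Multiset.exists_mem_of_ne_zero h0)
  refine ⟨M, hM, fun N hN => ?_⟩
  rcases hs.2.1 M hM N hN with h1 | h1
  · exact h1
  · rcases h1.eq_or_lt with h2 | h2
    · exact h2.ge
    · exact absurd h2 (hmin N hN)

theorem cons_mem_multichains {h Z : End K U} {L M : Submodule K U} {j : ℕ} (hLM : L ≤ M)
    (hM : InvariantUnder h Z M) (hM' : M ≠ ⊤) {s : Multiset (Submodule K U)}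
    (hs : s ∈ multichains h Z M j) : M ::ₘ s ∈ multichains h Z L (codim M + j) := by
  obtain ⟨h1, h2, h3⟩ := hs
  refine ⟨?_, ?_, by rw [Multiset.map_cons, Multiset.sum_cons, h3]⟩
  · intro N hN
    rcases Multiset.mem_cons.mp hN with rfl | hN
    · exact ⟨hM, hM', hLM⟩
    · exact ⟨(h1 N hN).1, (h1 N hN).2.1, hLM.trans (h1 N hN).2.2⟩
  · intro N hN N' hN'
    rcases Multiset.mem_cons.mp hN with hN | hN <;> rcases Multiset.mem_cons.mp hN' with hN' | hN'
    · exact Or.inl (hN.trans hN'.symm).le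
    · exact Or.inl (hN.le.trans (h1 _ hN').2.2)
    · exact Or.inr (hN'.le.trans (h1 _ hN).2.2)
    · exact h2 _ hN _ hN'

-- A nonempty multichain is determined by its least member `M` and the multichain that remains after
-- one copy of `M` is removed. The latter may contain `M` again, which is why the lower bound in
-- `multichains` is not strict.
open Classical in
theorem card_multichains [Finite K] [Fintype (Submodule K U)] (h Z : End K U)
    (L : Submodule K U) (j : ℕ) :
    Nat.card (multichains h Z L j) = (if j = 0 then 1 else 0) +
      ∑ M : Submodule K U with (L ≤ M ∧ InvariantUnder h Z M ∧ M ≠ ⊤ ∧ codim M ≤ j),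
        Nat.card (multichains h Z M (j - codim M)) := by
  have hfin := fun L j => (multichains_finite h Z L j).to_subtype
  rw [Finset.sum_subtype (p := fun M => L ≤ M ∧ InvariantUnder h Z M ∧ M ≠ ⊤ ∧ codim M ≤ j) _
    (by simp), ← Nat.card_sigma]
  have e1 : multichains h Z L j =
      {s | s ∈ multichains h Z L j ∧ s = 0} ∪ {s | s ∈ multichains h Z L j ∧ s ≠ 0} := by
    ext s
    by_cases hs : s = 0 <;> simp [hs]
  have hd : Disjoint {s | s ∈ multichains h Z L j ∧ s = 0}
      {s | s ∈ multichains h Z L j ∧ s ≠ 0} :=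
    Set.disjoint_left.mpr fun s hs hs' => hs'.2 hs.2
  rw [Nat.card_coe_set_eq, e1, Set.ncard_union_eq hd
    ((multichains_finite h Z L j).subset fun s hs => hs.1)
    ((multichains_finite h Z L j).subset fun s hs => hs.1)]
  congr 1
  · split_ifs with hj
    · subst hj
      rw [Set.ncard_eq_one]
      refine ⟨0, Set.eq_singleton_iff_unique_mem.mpr ⟨⟨?_, rfl⟩, fun s hs => hs.2⟩⟩
      simp [multichains]
    · rw [Set.ncard_eq_zero ((multichains_finite h Z L j).subset fun s hs => hs.1)]
      refine Set.eq_empty_of_forall_notMem ?_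
      rintro s ⟨⟨-, -, hs⟩, rfl⟩
      exact hj (by simpa using hs.symm)
  · rw [← Nat.card_coe_set_eq]
    symm
    refine Nat.card_congr (Equiv.ofBijective (fun x => ⟨x.1.1 ::ₘ x.2.1, ?_, ?_⟩) ⟨?_, ?_⟩)
    · have := cons_mem_multichains x.1.2.1 x.1.2.2.1 x.1.2.2.2.1 x.2.2
      rwa [Nat.add_sub_cancel' x.1.2.2.2.2] at this
    · exact Multiset.cons_ne_zero
    · rintro ⟨⟨M, hM⟩, ⟨s, hs⟩⟩ ⟨⟨N, hN⟩, ⟨t, ht⟩⟩ H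
      have H' : M ::ₘ s = N ::ₘ t := congrArg Subtype.val H
      have hMN : M = N := by
        apply le_antisymm
        · have : N ∈ M ::ₘ s := H' ▸ Multiset.mem_cons_self N t
          rcases Multiset.mem_cons.mp this with h1 | h1
          · exact h1.ge
          · exact (hs.1 _ h1).2.2
        · have : M ∈ N ::ₘ t := H' ▸ Multiset.mem_cons_self M s
          rcases Multiset.mem_cons.mp this with h1 | h1
          · exact h1.ge
          · exact (ht.1 _ h1).2.2
      subst hMN
      obtain rfl := (Multiset.cons_inj_right M).mp H'
      rfl
    · rintro ⟨s, hs, h0⟩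
      obtain ⟨M, hM, hmin⟩ := exists_least_of_mem_multichains hs h0
      obtain ⟨t, rfl⟩ := Multiset.exists_cons_of_mem hM
      obtain ⟨h1, h2, h3⟩ := hs
      rw [Multiset.map_cons, Multiset.sum_cons] at h3
      have hM1 := h1 M hM
      refine ⟨⟨⟨M, hM1.2.2, hM1.1, hM1.2.1, by omega⟩, ⟨t, ?_, ?_, by dsimp only; omega⟩⟩, rfl⟩
      · intro N hN
        have hN1 := h1 N (Multiset.mem_cons_of_mem hN)
        exact ⟨hN1.1, hN1.2.1, hmin N (Multiset.mem_cons_of_mem hN)⟩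
      · exact fun N hN N' hN' => h2 N (Multiset.mem_cons_of_mem hN) N' (Multiset.mem_cons_of_mem hN')

/-- The multichains of total codimension at most `k`, weighted by partition numbers. -/
noncomputable def chainTotal (h Z : End K U) (L : Submodule K U) (k : ℕ) : ℕ :=
  ∑ j ∈ Finset.range (k + 1), partitionCount (k - j) * Nat.card (multichains h Z L j)

-- Removal of the least member, summed over `j`. The empty multichain contributes only for `j = 0`,
-- with weight `p(k)`.
open Classical in
theorem chainTotal_eq [Finite K] [Fintype (Submodule K U)] (h Z : End K U) (L : Submodule K U)
    (k : ℕ) :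
    chainTotal h Z L k = partitionCount k +
      ∑ M : Submodule K U with (L ≤ M ∧ InvariantUnder h Z M ∧ M ≠ ⊤ ∧ codim M ≤ k),
        chainTotal h Z M (k - codim M) := by
  unfold chainTotal
  simp_rw [card_multichains h Z L, mul_add, Finset.sum_add_distrib]
  congr 1
  · rw [Finset.sum_eq_single 0]
    · simp
    · intro j _ hj; simp [hj]
    · simp
  · simp_rw [Finset.mul_sum, Finset.sum_filter]
    rw [Finset.sum_comm]
    refine Finset.sum_congr rfl fun M _ => ?_
    by_cases hM : L ≤ M ∧ InvariantUnder h Z M ∧ M ≠ ⊤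
    · simp only [hM, ne_eq, not_false_eq_true, true_and]
      split_ifs with hk
      · rw [← Finset.sum_filter]
        -- The shift of `j` by `codim M` keeps the weights, because `k - j = (k - codim M) - (j -
        -- codim M)`.
        refine Finset.sum_bij' (fun j _ => j - codim M) (fun j _ => j + codim M) ?_ ?_ ?_ ?_ ?_
        · intro j hj
          simp only [Finset.mem_filter, Finset.mem_range] at hj ⊢
          omega
        · intro j hj
          simp only [Finset.mem_filter, Finset.mem_range] at hj ⊢
          omega
        · intro j hj
          simp only [Finset.mem_filter, Finset.mem_range] at hj ⊢
          omega
        · intro j hj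
          omega
        · intro j hj
          simp only [Finset.mem_filter, Finset.mem_range] at hj
          congr 2
          omega
      · refine Finset.sum_eq_zero fun j hj => if_neg ?_
        rw [Finset.mem_range] at hj
        omega
    · have hM' : ∀ j, ¬ (L ≤ M ∧ InvariantUnder h Z M ∧ M ≠ ⊤ ∧ codim M ≤ j) :=
        fun j hj => hM ⟨hj.1, hj.2.1, hj.2.2.1⟩
      simp [hM']

/-- Induction step on `dim W`: both sides satisfy the same recursion over `M ≥ L`. The kernel `M =
⊤` gives the term with `p(dim W)`. A proper invariant `M` has positive codimension and leads to a
strictly smaller space. Other subspaces are not kernels of intertwiners into `W`: they fail to be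
invariant, or their codimension, which would be the rank, exceeds `dim W`. -/
theorem homCount_eq_of_forall_lt {K U : Type*} [Field K] [Finite K]
    [AddCommGroup U] [Module K U] [FiniteDimensional K U]
    (hbase : ∀ n, Nat.card (commPairs K (Fin n → K)) =
      cardGL K (Fin n → K) * partitionCount n)
    {h Z : End K U} (hh : IsUnit h) (hZ : IsNilpotent Z) (hc : Commute h Z)
    (W : Type*) [AddCommGroup W] [Module K W] [FiniteDimensional K W]
    (ih : ∀ n < finrank K W, ∀ L : Submodule K U,
      homCount (Fin n → K) h Z L = cardGL K (Fin n → K) * chainTotal h Z L n)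
    (L : Submodule K U) :
    homCount W h Z L = cardGL K W * chainTotal h Z L (finrank K W) := by
  classical
  have : Finite U := Module.finite_of_finite K
  have := Fintype.ofFinite (Submodule K U)
  have h1 : kerCount W h Z ⊤ = cardGL K W * partitionCount (finrank K W) := by
    have := kerCount_mul_cardGL (V := Fin (finrank K W) → K) (W := W) (invariantUnder_top h Z)
      hh hZ hc (by rw [codim_top, finrank_fin_fun, add_zero])
    rw [homCount_top, hbase, mul_left_comm, mul_comm] at this
    exact Nat.eq_of_mul_eq_mul_left cardGL_pos this
  have h2 : ∀ M : Submodule K U, InvariantUnder h Z M ∧ M ≠ ⊤ ∧ codim M ≤ finrank K W →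
      kerCount W h Z M = cardGL K W * chainTotal h Z M (finrank K W - codim M) := by
    rintro M ⟨hM, hM', hM''⟩
    have := kerCount_mul_cardGL (V := Fin (finrank K W - codim M) → K) (W := W) hM
      hh hZ hc (by rw [finrank_fin_fun, Nat.sub_add_cancel hM''])
    rw [ih _ (Nat.sub_lt ((codim_pos hM').trans_le hM'') (codim_pos hM')), mul_left_comm,
      mul_comm] at this
    exact Nat.eq_of_mul_eq_mul_left cardGL_pos this
  rw [homCount_eq_sum_kerCount, chainTotal_eq, mul_add, Finset.mul_sum, ← h1,
    ← Finset.add_sum_erase _ _ (show (⊤ : Submodule K U) ∈ Finset.univ.filter (L ≤ ·) by simp)]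
  congr 1
  rw [Finset.sum_congr rfl fun M hM => (h2 M (Finset.mem_filter.mp hM).2.2).symm]
  symm
  refine Finset.sum_subset ?_ ?_
  · intro M hM
    simp only [Finset.mem_filter, Finset.mem_univ, true_and, Finset.mem_erase] at hM ⊢
    exact ⟨hM.2.2.1, hM.1⟩
  · intro M hM hM'
    simp only [Finset.mem_filter, Finset.mem_univ, true_and, Finset.mem_erase] at hM hM'
    by_cases hi : InvariantUnder h Z M
    · refine kerCount_eq_zero_of_finrank_lt (not_le.mp fun hle => hM' ⟨hM.2, hi, hM.1, hle⟩)
    · exact kerCount_eq_zero_of_not_invariantUnder hi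

/-- The number of intertwining maps into commuting pairs on `W`, in terms of multichains of
invariant subspaces. -/
theorem homCount_eq_cardGL_mul_chainTotal {K U : Type*} [Field K] [Finite K]
    [AddCommGroup U] [Module K U] [FiniteDimensional K U]
    (hbase : ∀ n, Nat.card (commPairs K (Fin n → K)) =
      cardGL K (Fin n → K) * partitionCount n)
    {h Z : End K U} (hh : IsUnit h) (hZ : IsNilpotent Z) (hc : Commute h Z)
    (W : Type*) [AddCommGroup W] [Module K W] [FiniteDimensional K W] (L : Submodule K U) :
    homCount W h Z L = cardGL K W * chainTotal h Z L (finrank K W) := by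
  -- The induction runs over the model spaces `Fin n → K`; one more application of the step reaches
  -- `W`.
  refine homCount_eq_of_forall_lt hbase hh hZ hc W (fun n _ => ?_) L
  induction n using Nat.strong_induction_on with
  | _ n ih =>
    intro L
    have := homCount_eq_of_forall_lt hbase hh hZ hc (Fin n → K) (fun m hm => ?_) L
    · rwa [finrank_fin_fun] at this
    · rw [finrank_fin_fun] at hm
      exact ih m hm (by omega)

end Multichains

/-! ### Coordinate subspaces -/

section CoordinateSubspaces

/-- The coordinate subspace of the functions that vanish outside `T`. -/
def coordSubspace (K : Type*) [Field K] {I : Type*} (T : Set I) : Submodule K (I → K) where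
  carrier := {f | ∀ y, y ∉ T → f y = 0}
  add_mem' hf hg y hy := by simp [hf y hy, hg y hy]
  zero_mem' _ _ := rfl
  smul_mem' c f hf y hy := by simp [hf y hy]

variable {K : Type*} [Field K] {I : Type*}

theorem mem_coordSubspace {T : Set I} {f : I → K} :
    f ∈ coordSubspace K T ↔ ∀ y, y ∉ T → f y = 0 := Iff.rfl

open Classical in
/-- A coordinate subspace is isomorphic to a function space. -/
noncomputable def coordSubspaceEquiv (T : Set I) : coordSubspace K T ≃ₗ[K] (T → K) where
  toFun f t := f.1 t
  map_add' _ _ := rfl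
  map_smul' _ _ := rfl
  invFun g := ⟨fun i => if h : i ∈ T then g ⟨i, h⟩ else 0, fun y hy => by simp [hy]⟩
  left_inv f := by
    ext i
    by_cases h : i ∈ T
    · simp [h]
    · simp [h, f.2 i h]
  right_inv g := by
    ext t; simp

theorem finrank_coordSubspace [Finite I] (T : Set I) : finrank K (coordSubspace K T) = T.ncard := by
  have := Fintype.ofFinite T
  rw [(coordSubspaceEquiv T).finrank_eq, finrank_fintype_fun_eq_card, ← Nat.card_eq_fintype_card,
    Nat.card_coe_set_eq]

end CoordinateSubspaces

/-! ### Jordan form of nilpotent endomorphisms -/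

section Jordan

open Polynomial

theorem exists_equiv_of_map_eq {ι ι' α : Type*} [Fintype ι] [Fintype ι'] {f : ι → α} {g : ι' → α}
    (h : Finset.univ.val.map f = Finset.univ.val.map g) : ∃ σ : ι ≃ ι', ∀ i, g (σ i) = f i := by
  classical
  have key : ∀ a, Nonempty ({i // f i = a} ≃ {i // g i = a}) := by
    intro a
    have := congrArg (Multiset.count a) h
    rw [Multiset.count_map, Multiset.count_map] at this
    rw [← Fintype.card_eq, Fintype.card_subtype, Fintype.card_subtype, Finset.card_def,
      Finset.card_def, Finset.filter_val, Finset.filter_val]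
    simpa only [eq_comm] using this
  refine ⟨(Equiv.sigmaFiberEquiv f).symm.trans ((Equiv.sigmaCongrRight fun a =>
    (key a).some).trans (Equiv.sigmaFiberEquiv g)), fun i => ?_⟩
  exact ((key (f i)).some ⟨i, rfl⟩).2

variable {K : Type*} [Field K]

/-- The cyclic module `K[X] / (X ^ k)`. -/
abbrev NilCyclic (K : Type*) [Field K] (k : ℕ) : Type _ :=
  K[X] ⧸ Submodule.span K[X] {(X : K[X]) ^ k}

open Classical in
/-- Trivial factors may be dropped from a product of cyclic modules. -/
noncomputable def dropTrivial {ι : Type*} (k : ι → ℕ) :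
    ((i : ι) → NilCyclic K (k i)) ≃ₗ[K[X]] ((i : {i // k i ≠ 0}) → NilCyclic K (k i)) where
  toFun f i := f i
  map_add' _ _ := rfl
  map_smul' _ _ := rfl
  invFun g i := if h : k i ≠ 0 then g ⟨i, h⟩ else 0
  left_inv f := by
    ext i
    by_cases h : k i = 0
    · have : Subsingleton (NilCyclic K (k i)) := by
        rw [Submodule.Quotient.subsingleton_iff, h, pow_zero]
        exact Ideal.span_singleton_one
      exact Subsingleton.elim _ _
    · simp [h]
  right_inv g := by
    ext i
    simp [i.2]

/-- Reindexing of a product of cyclic modules. -/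
noncomputable def reindexNilCyclic {ι ι' : Type*} (σ : ι ≃ ι') (f : ι → ℕ) (g : ι' → ℕ)
    (h : ∀ i, g (σ i) = f i) :
    ((i : ι) → NilCyclic K (f i)) ≃ₗ[K[X]] ((i : ι') → NilCyclic K (g i)) := by
  obtain rfl : f = fun i => g (σ i) := funext fun i => (h i).symm
  exact LinearEquiv.piCongrLeft K[X] (fun i => NilCyclic K (g i)) σ

theorem finrank_pi_nilCyclic {ι : Type*} [Fintype ι] (k : ι → ℕ) :
    finrank K ((i : ι) → NilCyclic K (k i)) = ∑ i, k i := by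
  have hk : ∀ k : ℕ, finrank K (NilCyclic K k) = k := fun k =>
    (finrank_quotient_span_eq_natDegree (f := (X : K[X]) ^ k)).trans (natDegree_X_pow k)
  have hfin : ∀ k : ℕ, Module.Finite K (NilCyclic K k) := fun k =>
    Polynomial.Monic.finite_quotient (monic_X_pow k)
  rw [finrank_pi_fintype]
  exact Finset.sum_congr rfl fun i _ => hk _

variable {W : Type*} [AddCommGroup W] [Module K W] [FiniteDimensional K W]

/-- With `X` acting as `A`, the space `W` is a finitely generated `K[X]`-module killed by a power of
`X`. The structure theorem splits it into modules `K[X]/(X^k)`, whose dimensions add up to `dim W`.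
-/
theorem exists_jordan_partition {A : End K W} (hA : IsNilpotent A) :
    ∃ μ : Nat.Partition (finrank K W), Nonempty
      (AEval' A ≃ₗ[K[X]] ((i : Fin μ.parts.toList.length) → NilCyclic K (μ.parts.toList.get i))) := by
  classical
  obtain ⟨N, hN⟩ := hA
  have ht : Module.IsTorsion' (AEval' A) (Submonoid.powers (X : K[X])) := by
    intro x
    refine ⟨⟨X ^ N, N, rfl⟩, ?_⟩
    obtain ⟨w, rfl⟩ := (AEval'.of A).surjective x
    change (X ^ N : K[X]) • AEval'.of A w = 0
    rw [AEval'.X_pow_smul_of, hN, zero_smul, map_zero]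
  obtain ⟨d, k, ⟨e⟩⟩ := Module.torsion_by_prime_power_decomposition irreducible_X ht
  -- The structure theorem allows exponents `0`, which are not parts of a partition; their factors
  -- are trivial and are dropped.
  let e1 : AEval' A ≃ₗ[K[X]] ((i : {i // k i ≠ 0}) → NilCyclic K (k i)) :=
    e.trans ((DirectSum.linearEquivFunOnFintype K[X] (Fin d) _).trans (dropTrivial k))
  have hs : (Finset.univ.val.map fun i : {i // k i ≠ 0} => k i).sum = finrank K W := by
    have h1 := (e1.restrictScalars K).finrank_eq
    rw [finrank_pi_nilCyclic (fun i : {i // k i ≠ 0} => k i)] at h1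
    exact h1.symm.trans (AEval'.of A).finrank_eq.symm
  let μ : Nat.Partition (finrank K W) :=
    { parts := Finset.univ.val.map fun i : {i // k i ≠ 0} => k i
      parts_pos := by
        intro i hi
        obtain ⟨j, -, rfl⟩ := Multiset.mem_map.mp hi
        exact Nat.pos_of_ne_zero j.2
      parts_sum := hs }
  have hμ : Finset.univ.val.map (fun i : {i // k i ≠ 0} => k i) =
      Finset.univ.val.map μ.parts.toList.get := by
    rw [Fin.univ_val_map, List.ofFn_get, Multiset.coe_toList]
  obtain ⟨σ, hσ⟩ := exists_equiv_of_map_eq hμ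
  exact ⟨μ, ⟨e1.trans (reindexNilCyclic σ _ _ hσ)⟩⟩

/-- Nilpotent endomorphisms. -/
abbrev NilEnd (K W : Type*) [Field K] [AddCommGroup W] [Module K W] : Type _ :=
  {A : End K W // IsNilpotent A}

instance : MulAction (End K W)ˣ (NilEnd K W) where
  smul g A := ⟨g * A.1 * (g⁻¹ : (End K W)ˣ), by
    obtain ⟨n, hn⟩ := A.2
    exact ⟨n, by rw [Units.conj_pow, hn, mul_zero, zero_mul]⟩⟩
  one_smul A := Subtype.ext (by
    show ((1 : (End K W)ˣ) : End K W) * A.1 * ((1⁻¹ : (End K W)ˣ) : End K W) = A.1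
    simp)
  mul_smul g h A := Subtype.ext (by
    show ((g * h : (End K W)ˣ) : End K W) * A.1 * (((g * h)⁻¹ : (End K W)ˣ) : End K W) =
      g * (h * A.1 * (h⁻¹ : (End K W)ˣ)) * (g⁻¹ : (End K W)ˣ)
    rw [mul_inv_rev, Units.val_mul, Units.val_mul]
    simp only [mul_assoc])

theorem NilEnd.smul_eq_iff {g : (End K W)ˣ} {A B : NilEnd K W} :
    g • A = B ↔ (g : End K W) * A.1 = B.1 * g := by
  rw [← Units.mul_inv_eq_iff_eq_mul, Subtype.ext_iff]
  rfl

/-- Burnside's lemma: an invertible endomorphism commutes with a nilpotent one exactly when it fixes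
it under conjugation. -/
theorem card_commPairs_eq [Finite K] :
    Nat.card (commPairs K W) =
      Nat.card (MulAction.orbitRel.Quotient (End K W)ˣ (NilEnd K W)) * cardGL K W := by
  have h1 : cardGL K W = Nat.card (End K W)ˣ := Nat.card_congr
    { toFun := fun a => a.2.unit
      invFun := fun u => ⟨u, u.isUnit⟩
      left_inv := fun a => rfl
      right_inv := fun u => Units.ext rfl }
  rw [h1, ← Nat.card_prod]
  refine (Nat.card_congr (Equiv.trans ?_
    (MulAction.sigmaFixedByEquivOrbitsProdGroup (End K W)ˣ (NilEnd K W))))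
  exact
    { toFun := fun x => ⟨x.2.1.unit, ⟨⟨x.1.2, x.2.2.1⟩, NilEnd.smul_eq_iff.mpr x.2.2.2⟩⟩
      invFun := fun y => ⟨(y.1, y.2.1.1), y.1.isUnit, y.2.1.2, NilEnd.smul_eq_iff.mp y.2.2⟩
      left_inv := fun x => rfl
      right_inv := fun y => by
        exact Sigma.subtype_ext (Units.ext rfl) rfl }

theorem exists_smul_eq_of_equiv {A B : NilEnd K W} (e : AEval' A.1 ≃ₗ[K[X]] AEval' B.1) :
    ∃ g : (End K W)ˣ, g • A = B := by
  let e' : W ≃ₗ[K] W := (AEval'.of A.1).trans ((e.restrictScalars K).trans (AEval'.of B.1).symm)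
  refine ⟨LinearMap.GeneralLinearGroup.ofLinearEquiv e', NilEnd.smul_eq_iff.mpr ?_⟩
  ext w
  change (AEval'.of B.1).symm (e (AEval'.of A.1 (A.1 w))) = B.1 ((AEval'.of B.1).symm (e (AEval'.of A.1 w)))
  rw [← AEval'.X_smul_of, map_smul, AEval'.of_symm_X_smul]

end Jordan

section Shift

open Polynomial

variable {K : Type*} [Field K] {ι : Type*} (k : ι → ℕ)

/-- The endomorphism of the functions on `Σ i, Fin (k i)` that shifts each of the blocks. -/
def blockShift (K : Type*) [Field K] {ι : Type*} (k : ι → ℕ) :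
    End K ((Σ i, Fin (k i)) → K) where
  toFun f x := if h : (x.2 : ℕ) + 1 < k x.1 then f ⟨x.1, ⟨x.2 + 1, h⟩⟩ else 0
  map_add' f g := by
    ext x; by_cases h : (x.2 : ℕ) + 1 < k x.1 <;> simp [h]
  map_smul' c f := by
    ext x; by_cases h : (x.2 : ℕ) + 1 < k x.1 <;> simp [h]

theorem blockShift_pow_apply (n : ℕ) (f : (Σ i, Fin (k i)) → K) (x : Σ i, Fin (k i)) :
    (blockShift K k ^ n) f x =
      if h : (x.2 : ℕ) + n < k x.1 then f ⟨x.1, ⟨x.2 + n, h⟩⟩ else 0 := by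
  induction n generalizing x with
  | zero => simp
  | succ n ih =>
    rw [pow_succ', Module.End.mul_apply]
    change (if h : (x.2 : ℕ) + 1 < k x.1 then (blockShift K k ^ n) f ⟨x.1, ⟨x.2 + 1, h⟩⟩ else 0) = _
    by_cases h : (x.2 : ℕ) + (n + 1) < k x.1
    · have h' : (x.2 : ℕ) + 1 < k x.1 := by omega
      have h'' : (x.2 : ℕ) + 1 + n < k x.1 := by omega
      rw [dif_pos h, dif_pos h', ih, dif_pos h'']
      refine congrArg f (Sigma.ext rfl (heq_of_eq (Fin.ext ?_)))
      dsimp only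
      omega
    · rw [dif_neg h]
      by_cases h' : (x.2 : ℕ) + 1 < k x.1
      · rw [dif_pos h', ih, dif_neg (by dsimp only; omega)]
      · rw [dif_neg h']

theorem ker_blockShift_pow (n : ℕ) :
    (blockShift K k ^ n).ker = coordSubspace K {x : Σ i, Fin (k i) | (x.2 : ℕ) < n} := by
  ext f
  rw [LinearMap.mem_ker, mem_coordSubspace]
  constructor
  · rintro hf ⟨i, t⟩ ht
    have ht' : n ≤ t := not_lt.mp ht
    have := congrFun hf ⟨i, ⟨t - n, by omega⟩⟩
    rw [blockShift_pow_apply, dif_pos (by dsimp only; omega)] at this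
    rw [← Pi.zero_apply (M := fun _ => K), ← this]
    refine congrArg f (Sigma.ext rfl (heq_of_eq (Fin.ext ?_)))
    dsimp only
    omega
  · intro hf
    ext x
    rw [blockShift_pow_apply]
    split_ifs
    · exact hf _ (by simp)
    · rfl

theorem finrank_ker_blockShift_pow [Fintype ι] (n : ℕ) :
    finrank K (blockShift K k ^ n).ker = ∑ i, min (k i) n := by
  rw [ker_blockShift_pow, finrank_coordSubspace, ← Nat.card_coe_set_eq]
  have e : {x : Σ i, Fin (k i) | (x.2 : ℕ) < n} ≃ Σ i, Fin (min (k i) n) :=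
    { toFun := fun x => ⟨x.1.1, ⟨x.1.2, lt_min x.1.2.2 x.2⟩⟩
      invFun := fun y => ⟨⟨y.1, ⟨y.2, y.2.2.trans_le (min_le_left _ _)⟩⟩,
        y.2.2.trans_le (min_le_right _ _)⟩
      left_inv := fun x => rfl
      right_inv := fun y => rfl }
  rw [Nat.card_congr e, Nat.card_sigma]
  simp

theorem isNilpotent_blockShift [Fintype ι] : IsNilpotent (blockShift K k) := by
  refine ⟨∑ i, k i, ?_⟩
  ext f x
  rw [blockShift_pow_apply, dif_neg]
  · rfl
  · have := Finset.single_le_sum (fun i _ => Nat.zero_le (k i)) (Finset.mem_univ x.1)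
    omega

/-- The multiplicity of `a + 1` is minus a second difference of the truncated sums. These sums are
the kernel dimensions of the powers of a shift, so the kernel dimensions determine the partition. -/
theorem two_mul_sum_map_min (s : Multiset ℕ) (a : ℕ) :
    2 * (s.map (min · (a + 1))).sum =
      s.count (a + 1) + (s.map (min · a)).sum + (s.map (min · (a + 2))).sum := by
  induction s using Multiset.induction_on with
  | empty => simp
  | cons x s ih =>
    simp only [Multiset.map_cons, Multiset.sum_cons, Multiset.count_cons]
    split_ifs <;> omega

theorem partition_eq_of_sum_min {n : ℕ} {μ ν : Nat.Partition n}
    (h : ∀ a, (μ.parts.map (min · a)).sum = (ν.parts.map (min · a)).sum) : μ = ν := by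
  refine Nat.Partition.ext (Multiset.ext.mpr fun a => ?_)
  cases a with
  | zero =>
    rw [Multiset.count_eq_zero_of_notMem fun h => (μ.parts_pos h).ne' rfl,
      Multiset.count_eq_zero_of_notMem fun h => (ν.parts_pos h).ne' rfl]
  | succ a =>
    have h1 := two_mul_sum_map_min μ.parts a
    have h2 := two_mul_sum_map_min ν.parts a
    rw [h, h, h] at h1
    omega

end Shift

/-! ### The number of nilpotent orbits -/

section CountOrbits

open Polynomial

variable {K W : Type*} [Field K] [AddCommGroup W] [Module K W] [FiniteDimensional K W]

theorem finrank_ker_conj {V V' : Type*} [AddCommGroup V] [Module K V] [AddCommGroup V']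
    [Module K V'] (e : V ≃ₗ[K] V') (T : End K V) :
    finrank K (e.conj T).ker = finrank K T.ker := by
  have : (e.conj T).ker = T.ker.map (e : V →ₗ[K] V') := by
    ext x
    obtain ⟨x, rfl⟩ := e.surjective x
    simp [LinearEquiv.conj_apply_apply]
  rw [this]
  exact LinearEquiv.finrank_map_eq e _

/-- Two injections give two inequalities. The Jordan type separates orbits; conversely, shifts of
different types are not conjugate, since conjugation preserves the kernel dimensions of powers. -/
theorem card_orbits_nilEnd [Finite K] :
    Nat.card (MulAction.orbitRel.Quotient (End K W)ˣ (NilEnd K W)) =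
      partitionCount (finrank K W) := by
  have : Finite W := Module.finite_of_finite K
  have : Finite (End K W) := Module.finite_of_finite K
  rw [partitionCount, ← Nat.card_eq_fintype_card]
  apply le_antisymm
  · choose F hF using fun A : NilEnd K W => exists_jordan_partition A.2
    refine Nat.card_le_card_of_injective (fun ω => F (Quotient.out ω)) fun ω ω' h => ?_
    rw [← Quotient.out_eq ω, ← Quotient.out_eq ω']
    have h1 := hF (Quotient.out ω)
    have h2 := hF (Quotient.out ω')
    dsimp only at h
    rw [← h] at h2
    obtain ⟨g, hg⟩ := exists_smul_eq_of_equiv (h1.some.trans h2.some.symm)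
    exact (Quotient.sound (show MulAction.orbitRel _ _ _ _ from ⟨g, hg⟩)).symm
  · have hsum : ∀ μ : Nat.Partition (finrank K W),
        finrank K ((Σ i : Fin μ.parts.toList.length, Fin (μ.parts.toList.get i)) → K) =
          finrank K W := by
      intro μ
      rw [finrank_fintype_fun_eq_card, Fintype.card_sigma]
      simp only [Fintype.card_fin]
      conv_rhs => rw [← μ.parts_sum, ← Multiset.coe_toList μ.parts, Multiset.sum_coe]
      rw [← List.sum_ofFn, List.ofFn_get]
    let e := fun μ => LinearEquiv.ofFinrankEq _ W (hsum μ)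
    let A : Nat.Partition (finrank K W) → NilEnd K W := fun μ =>
      ⟨(e μ).conjAlgEquiv K (blockShift K μ.parts.toList.get),
        (isNilpotent_blockShift _).map ((e μ).conjAlgEquiv K)⟩
    have hA : ∀ μ a, finrank K ((A μ).1 ^ a).ker = (μ.parts.map (min · a)).sum := by
      intro μ a
      have : (A μ).1 ^ a = (e μ).conj (blockShift K μ.parts.toList.get ^ a) :=
        (map_pow ((e μ).conjAlgEquiv K) _ a).symm
      rw [this, finrank_ker_conj, finrank_ker_blockShift_pow]
      conv_rhs => rw [← Multiset.coe_toList μ.parts, Multiset.map_coe, Multiset.sum_coe]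
      rw [← List.sum_ofFn]
      congr 1
      conv_rhs => rw [← List.ofFn_get μ.parts.toList, List.map_ofFn]
      rfl
    refine Nat.card_le_card_of_injective (fun μ => (Quotient.mk _ (A μ) :
      MulAction.orbitRel.Quotient (End K W)ˣ (NilEnd K W))) fun μ ν h => ?_
    obtain ⟨g, hg⟩ := Quotient.exact h
    refine partition_eq_of_sum_min fun a => ?_
    rw [← hA, ← hA, ← hg]
    have : (g • A ν).1 ^ a =
        (LinearMap.GeneralLinearGroup.toLinearEquiv g).conj ((A ν).1 ^ a) := Units.conj_pow g _ a
    rw [this, finrank_ker_conj]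

/-- The number of commuting pairs of an invertible and a nilpotent endomorphism. -/
theorem card_commPairs [Finite K] :
    Nat.card (commPairs K W) = cardGL K W * partitionCount (finrank K W) := by
  rw [card_commPairs_eq, card_orbits_nilEnd, mul_comm]

end CountOrbits

/-! ### Multichains as flags with a partition -/

section Flags

/-- Flags of subspaces of `U` whose set of codimensions is `S`, indexed by codimension. -/
abbrev SubspaceFlag (K U : Type*) [Field K] [AddCommGroup U] [Module K U] (S : Finset ℕ) : Type _ :=
  {f : S → Submodule K U // (∀ t, codim (f t) = t) ∧ Antitone f}

variable {K U : Type*} [Field K] [AddCommGroup U] [Module K U]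

/-- The flags all of whose members are invariant under `h` and `Z`. -/
abbrev InvFlag (h Z : End K U) (S : Finset ℕ) : Type _ :=
  {f : SubspaceFlag K U S // ∀ t, InvariantUnder h Z (f.1 t)}

open Classical in
/-- A flag as a function on all natural numbers. -/
noncomputable def SubspaceFlag.extend {S : Finset ℕ} (f : SubspaceFlag K U S) (t : ℕ) :
    Submodule K U :=
  if h : t ∈ S then f.1 ⟨t, h⟩ else ⊤

theorem SubspaceFlag.extend_of_mem {S : Finset ℕ} (f : SubspaceFlag K U S) {t : ℕ} (h : t ∈ S) :
    f.extend t = f.1 ⟨t, h⟩ := dif_pos h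

theorem SubspaceFlag.map_codim_map_extend {S : Finset ℕ} (f : SubspaceFlag K U S)
    {s : Multiset ℕ} (hs : s.toFinset = S) : (s.map f.extend).map codim = s := by
  rw [Multiset.map_map]
  conv_rhs => rw [← Multiset.map_id s]
  refine Multiset.map_congr rfl fun t ht => ?_
  rw [Function.comp_apply, f.extend_of_mem (hs ▸ Multiset.mem_toFinset.mpr ht), f.2.1]
  rfl

variable [FiniteDimensional K U]

theorem eq_of_comparable_of_codim_eq {L M : Submodule K U} (h : L ≤ M ∨ M ≤ L)
    (hc : codim L = codim M) : L = M := by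
  rcases h with h | h
  · exact eq_of_le_of_codim_eq h hc
  · exact (eq_of_le_of_codim_eq h hc.symm).symm

theorem codim_le_finrank (L : Submodule K U) : codim L ≤ finrank K U :=
  codim_bot (K := K) (U := U) ▸ codim_anti bot_le

theorem map_extend_mem_multichains {h Z : End K U} {j : ℕ} {S : Finset ℕ}
    {μ : Nat.Partition j} (hμ : μ.parts.toFinset = S) (f : InvFlag h Z S) :
    μ.parts.map f.1.extend ∈ multichains h Z ⊥ j := by
  have hS : ∀ t ∈ μ.parts, t ∈ S := fun t ht => hμ ▸ Multiset.mem_toFinset.mpr ht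
  refine ⟨?_, ?_, by rw [f.1.map_codim_map_extend hμ, μ.parts_sum]⟩
  · intro M hM
    obtain ⟨t, ht, rfl⟩ := Multiset.mem_map.mp hM
    rw [f.1.extend_of_mem (hS t ht)]
    refine ⟨f.2 _, fun htop => ?_, bot_le⟩
    have := f.1.2.1 ⟨t, hS t ht⟩
    rw [htop, codim_top] at this
    exact (μ.parts_pos ht).ne this
  · intro M hM N hN
    obtain ⟨t, ht, rfl⟩ := Multiset.mem_map.mp hM
    obtain ⟨t', ht', rfl⟩ := Multiset.mem_map.mp hN
    rw [f.1.extend_of_mem (hS t ht), f.1.extend_of_mem (hS t' ht')]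
    rcases le_total t t' with h1 | h1
    · exact Or.inr (f.1.2.2 (show (⟨t, _⟩ : S) ≤ ⟨t', _⟩ from h1))
    · exact Or.inl (f.1.2.2 (show (⟨t', _⟩ : S) ≤ ⟨t, _⟩ from h1))

/-- Multichains of invariant subspaces amount to flags with a partition. -/
theorem card_multichains_eq_sum_powerset [Finite K] (h Z : End K U) (j : ℕ) :
    Nat.card (multichains h Z ⊥ j) =
      ∑ S ∈ (Finset.Icc 1 (finrank K U)).powerset,
        exactPartitionCount j S * Nat.card (InvFlag h Z S) := by
  have : Finite U := Module.finite_of_finite K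
  rw [Finset.sum_subtype (p := fun S => S ∈ (Finset.Icc 1 (finrank K U)).powerset) _
    fun _ => Iff.rfl]
  simp only [exactPartitionCount, ← Nat.card_eq_fintype_card, ← Nat.card_prod]
  rw [← Nat.card_sigma]
  symm
  refine Nat.card_congr (Equiv.ofBijective
    (fun x => ⟨x.2.1.1.parts.map x.2.2.1.extend, map_extend_mem_multichains x.2.1.2 x.2.2⟩) ⟨?_, ?_⟩)
  · rintro ⟨⟨S, hS⟩, ⟨μ, hμ⟩, f⟩ ⟨⟨S', hS'⟩, ⟨ν, hν⟩, g⟩ H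
    have H' : μ.parts.map f.1.extend = ν.parts.map g.1.extend := congrArg Subtype.val H
    -- The codimensions of the members recover the partition, and then each member of the flag is
    -- the one of its codimension.
    have h1 := congrArg (Multiset.map codim) H'
    dsimp only at hμ hν
    rw [f.1.map_codim_map_extend hμ, g.1.map_codim_map_extend hν] at h1
    obtain rfl : μ = ν := Nat.Partition.ext h1
    subst hμ
    subst hν
    have hfg : f = g := by
      refine Subtype.ext (Subtype.ext (funext fun t => ?_))
      have ht : f.1.1 t ∈ μ.parts.map g.1.extend := by
        rw [← H', ← f.1.extend_of_mem t.2]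
        exact Multiset.mem_map_of_mem _ (Multiset.mem_toFinset.mp t.2)
      obtain ⟨t', ht', h2⟩ := Multiset.mem_map.mp ht
      rw [g.1.extend_of_mem (Multiset.mem_toFinset.mpr ht')] at h2
      have h3 := congrArg codim h2
      rw [g.1.2.1, f.1.2.1] at h3
      rw [← h2]
      exact congrArg g.1.1 (Subtype.ext h3)
    rw [hfg]
  · rintro ⟨s, h1, h2, h3⟩
    -- The partition is the multiset of codimensions. The flag is well defined because comparable
    -- subspaces of the same codimension coincide.
    let μ : Nat.Partition j :=
      { parts := s.map codim
        parts_pos := by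
          intro t ht
          obtain ⟨M, hM, rfl⟩ := Multiset.mem_map.mp ht
          exact codim_pos (h1 M hM).2.1
        parts_sum := h3 }
    have hex : ∀ t : μ.parts.toFinset, ∃ M ∈ s, codim M = t := fun t =>
      Multiset.mem_map.mp (Multiset.mem_toFinset.mp t.2)
    choose F hF hFc using hex
    let f : InvFlag h Z μ.parts.toFinset := ⟨⟨F, hFc, by
      intro t t' htt
      rcases h2 _ (hF t) _ (hF t') with h4 | h4
      · have h5 := codim_anti h4
        rw [hFc, hFc] at h5
        rw [le_antisymm htt h5]
      · exact h4⟩, fun t => (h1 _ (hF t)).1⟩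
    refine ⟨⟨⟨μ.parts.toFinset, ?_⟩, ⟨μ, rfl⟩, f⟩, Subtype.ext ?_⟩
    · rw [Finset.mem_powerset]
      intro t ht
      obtain ⟨M, hM, rfl⟩ := Multiset.mem_map.mp (Multiset.mem_toFinset.mp ht)
      exact Finset.mem_Icc.mpr ⟨codim_pos (h1 M hM).2.1, codim_le_finrank M⟩
    · change (s.map codim).map f.1.extend = s
      rw [Multiset.map_map]
      conv_rhs => rw [← Multiset.map_id s]
      refine Multiset.map_congr rfl fun M hM => ?_
      have hM' : codim M ∈ μ.parts.toFinset :=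
        Multiset.mem_toFinset.mpr (Multiset.mem_map_of_mem _ hM)
      rw [Function.comp_apply, f.1.extend_of_mem hM']
      exact eq_of_comparable_of_codim_eq (h2 _ (hF _) _ hM) (hFc _)

/-- The only subspace of codimension `dim U` is `⊥`, which is invariant and lies below every other
member, so adding it to a flag is no choice. -/
theorem card_invFlag_insert_finrank (h Z : End K U) {S : Finset ℕ}
    (hS : S ⊆ Finset.Icc 1 (finrank K U - 1)) (hU : 0 < finrank K U) :
    Nat.card (InvFlag h Z (insert (finrank K U) S)) = Nat.card (InvFlag h Z S) := by
  have hlt : ∀ t ∈ S, t < finrank K U := fun t ht => by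
    have := Finset.mem_Icc.mp (hS ht)
    omega
  have hbot : ∀ {L : Submodule K U}, codim L = finrank K U → L = ⊥ := fun {L} hL =>
    (eq_of_le_of_codim_eq bot_le (by rw [hL, codim_bot])).symm
  refine Nat.card_congr (Equiv.ofBijective
    (fun f => ⟨⟨fun t => f.1.1 ⟨t, Finset.mem_insert_of_mem t.2⟩, fun t => f.1.2.1 _,
      fun t t' htt => f.1.2.2 htt⟩, fun t => f.2 _⟩) ⟨?_, ?_⟩)
  · intro f g H
    refine Subtype.ext (Subtype.ext (funext fun t => ?_))
    obtain ⟨t, ht⟩ := t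
    rcases Finset.mem_insert.mp ht with h1 | h1
    · rw [hbot ((f.1.2.1 ⟨t, ht⟩).trans h1), hbot ((g.1.2.1 ⟨t, ht⟩).trans h1)]
    · exact congrFun (congrArg (fun x => x.1.1) H) ⟨t, h1⟩
  · intro f
    classical
    let F : {t // t ∈ insert (finrank K U) S} → Submodule K U :=
      fun t => if ht : t.1 ∈ S then f.1.1 ⟨t, ht⟩ else ⊥
    have hF : ∀ (t) (ht : t ∈ S), F ⟨t, Finset.mem_insert_of_mem ht⟩ = f.1.1 ⟨t, ht⟩ :=
      fun t ht => dif_pos ht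
    have hF' : ∀ (t) (ht : t.1 ∉ S), F t = ⊥ := fun t ht => dif_neg ht
    refine ⟨⟨⟨F, ?_, ?_⟩, ?_⟩, ?_⟩
    · rintro ⟨t, ht⟩
      by_cases h1 : t ∈ S
      · rw [hF t h1, f.1.2.1]
      · rw [hF' _ h1, codim_bot]
        exact ((Finset.mem_insert.mp ht).resolve_right h1).symm
    · rintro ⟨t, ht⟩ ⟨t', ht'⟩ htt
      by_cases h1 : t' ∈ S
      · have h2 : t ∈ S := by
          refine (Finset.mem_insert.mp ht).resolve_left fun h3 => ?_
          have := hlt t' h1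
          have : t ≤ t' := htt
          omega
        rw [hF t h2, hF t' h1]
        exact f.1.2.2 (show (⟨t, h2⟩ : S) ≤ ⟨t', h1⟩ from htt)
      · rw [hF' _ h1]
        exact bot_le
    · rintro ⟨t, ht⟩
      by_cases h1 : t ∈ S
      · change InvariantUnder h Z (F _)
        rw [hF t h1]
        exact f.2 _
      · change InvariantUnder h Z (F _)
        rw [hF' _ h1]
        exact invariantUnder_bot h Z
    · refine Subtype.ext (Subtype.ext (funext fun t => ?_))
      exact hF t.1 t.2

theorem exactPartitionCount_eq_zero_of_zero_mem {j : ℕ} {S : Finset ℕ} (hS : 0 ∈ S) :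
    exactPartitionCount j S = 0 := by
  refine Fintype.card_eq_zero_iff.mpr ⟨fun μ => ?_⟩
  have := μ.2.symm ▸ hS
  exact (μ.1.parts_pos (Multiset.mem_toFinset.mp this)).ne' rfl

/-- Multichains of invariant subspaces in terms of flags of proper nonzero subspaces. -/
theorem card_multichains_eq_sum [Finite K] (h Z : End K U) (j : ℕ) :
    Nat.card (multichains h Z ⊥ j) =
      ∑ S ∈ (Finset.Icc 1 (finrank K U - 1)).powerset,
        (exactPartitionCount j S + exactPartitionCount j (S ∪ {finrank K U})) *
          Nat.card (InvFlag h Z S) := by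
  rw [card_multichains_eq_sum_powerset]
  rcases Nat.eq_zero_or_pos (finrank K U) with h0 | h0
  -- For `U = 0` the added part would be `0`, which no partition contains.
  · rw [h0]
    refine Finset.sum_congr rfl fun S _ => ?_
    rw [exactPartitionCount_eq_zero_of_zero_mem (S := S ∪ {0}) (by simp), add_zero]
  · have h1 : Finset.Icc 1 (finrank K U) =
        insert (finrank K U) (Finset.Icc 1 (finrank K U - 1)) := by
      ext t
      simp only [Finset.mem_Icc, Finset.mem_insert]
      omega
    -- Each `S` without `dim U` is paired with `S ∪ {dim U}`, and both have the same number of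
    -- invariant flags.
    rw [h1, Finset.sum_powerset_insert (by simp; omega), ← Finset.sum_add_distrib]
    refine Finset.sum_congr rfl fun S hS => ?_
    rw [card_invFlag_insert_finrank h Z (Finset.mem_powerset.mp hS) h0, add_mul,
      Finset.union_comm, ← Finset.insert_eq]

end Flags

instance {s : ℕ} (l : Fin s → ℕ) : Fintype (BlockChain l) :=
  inferInstanceAs (Fintype (Σ i : Fin s, Fin (l i)))

instance {s : ℕ} (l : Fin s → ℕ) : DecidableEq (BlockChain l) :=
  inferInstanceAs (DecidableEq (Σ i : Fin s, Fin (l i)))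

/-! ### Burnside's lemma for preordered sets -/

section Burnside

variable (K : Type*) [Field K] {C : Type*} [Fintype C] [DecidableEq C] (P : Preorder C)

/-- The commuting pairs of an invertible and a nilpotent matrix in `M^C`. -/
def matCommPairs : Set (Matrix C C K × Matrix C C K) :=
  {x | x.1 ∈ preorderMatrix K P ∧ x.2 ∈ preorderMatrix K P ∧
    IsUnit x.1 ∧ IsNilpotent x.2 ∧ Commute x.1 x.2}

theorem mem_preorderMatrix {K : Type*} [Field K] {P : Preorder C} {X : Matrix C C K} :
    X ∈ preorderMatrix K P ↔ ∀ i j, ¬ P.le i j → X i j = 0 := Iff.rfl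

variable [Finite K]

/-- The invertible matrices in `M^C`, as plain matrices. -/
noncomputable def preorderGroupEquiv :
    preorderGroup K P ≃ {X : Matrix C C K // X ∈ preorderMatrix K P ∧ IsUnit X} where
  toFun g := ⟨g.1, g.2, g.1.isUnit⟩
  invFun X := ⟨X.2.2.unit, X.2.1⟩
  left_inv _ := Subtype.ext (Units.ext rfl)
  right_inv _ := rfl

theorem PreorderNilpotent.smul_eq_iff (g : preorderGroup K P) (X Y : PreorderNilpotent K P) :
    g • X = Y ↔ ((g : (Matrix C C K)ˣ) : Matrix C C K) * X.1 = Y.1 * (g : (Matrix C C K)ˣ) := by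
  rw [← Units.mul_inv_eq_iff_eq_mul]
  exact Subtype.ext_iff

/-- A commuting pair is a group element together with a point that it fixes. -/
theorem card_matCommPairs_eq_rho_mul :
    Nat.card (matCommPairs K P) = rho K P * Nat.card (preorderGroup K P) := by
  rw [rho, ← Nat.card_prod]
  refine (Nat.card_congr (Equiv.trans ?_
    (MulAction.sigmaFixedByEquivOrbitsProdGroup (preorderGroup K P) (PreorderNilpotent K P))))
  exact
    { toFun := fun x => ⟨⟨x.2.2.2.1.unit, x.2.1⟩, ⟨⟨x.1.2, x.2.2.1, x.2.2.2.2.1⟩,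
        (PreorderNilpotent.smul_eq_iff K P _ _ _).mpr x.2.2.2.2.2⟩⟩
      invFun := fun y => ⟨(y.1.1, y.2.1.1), y.1.2, y.2.1.2.1, y.1.1.isUnit, y.2.1.2.2,
        (PreorderNilpotent.smul_eq_iff K P _ _ _).mp y.2.2⟩
      left_inv := fun x => rfl
      right_inv := fun y => Sigma.subtype_ext (Subtype.ext (Units.ext rfl)) rfl }

end Burnside

/-! ### Matrices acting on row vectors, with products in reversed order -/

section RowMaps

variable {K : Type*} [Field K] {m n : Type*} [Fintype m] [DecidableEq m] [Fintype n] [DecidableEq n]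

/-- The action of a matrix on row vectors. -/
abbrev rowMap (X : Matrix m n K) : (m → K) →ₗ[K] (n → K) := Matrix.toLinearMapRight' X

theorem rowMap_mul {k : Type*} [Fintype k] [DecidableEq k] (X : Matrix k m K) (Y : Matrix m n K) :
    rowMap (X * Y) = rowMap Y ∘ₗ rowMap X := Matrix.toLinearMapRight'_mul X Y

theorem rowMap_one : rowMap (1 : Matrix n n K) = LinearMap.id := Matrix.toLinearMapRight'_one

theorem rowMap_toMatrixRight' (T : (m → K) →ₗ[K] (n → K)) :
    rowMap (LinearMap.toMatrixRight' T) = T :=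
  LinearEquiv.symm_apply_apply LinearMap.toMatrixRight' T

theorem rowMap_pow (X : Matrix n n K) (k : ℕ) : rowMap (X ^ k) = (rowMap X : End K (n → K)) ^ k := by
  induction k with
  | zero => exact rowMap_one
  | succ k ih => rw [pow_succ, pow_succ', rowMap_mul, ih]; rfl

theorem rowMap_injective : Function.Injective (rowMap : Matrix m n K → _) :=
  Matrix.toLinearMapRight'.injective

theorem isNilpotent_rowMap {X : Matrix n n K} :
    IsNilpotent (rowMap X : End K (n → K)) ↔ IsNilpotent X := by
  refine exists_congr fun k => ?_
  rw [← rowMap_pow]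
  exact map_eq_zero_iff _ Matrix.toLinearMapRight'.injective

theorem commute_rowMap {X Y : Matrix n n K} :
    Commute (rowMap X : End K (n → K)) (rowMap Y) ↔ Commute X Y := by
  change rowMap X ∘ₗ rowMap Y = rowMap Y ∘ₗ rowMap X ↔ X * Y = Y * X
  rw [← rowMap_mul, ← rowMap_mul, rowMap_injective.eq_iff, eq_comm]

theorem isUnit_rowMap {X : Matrix n n K} : IsUnit (rowMap X : End K (n → K)) ↔ IsUnit X := by
  constructor
  · rintro ⟨u, hu⟩
    obtain ⟨Y, hY⟩ : ∃ Y, rowMap Y = ((u⁻¹ : (End K (n → K))ˣ) : End K (n → K)) :=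
      ⟨_, rowMap_toMatrixRight' _⟩
    refine ⟨⟨X, Y, rowMap_injective ?_, rowMap_injective ?_⟩, rfl⟩
    · rw [rowMap_mul, rowMap_one, hY, ← hu]
      exact u.inv_mul
    · rw [rowMap_mul, rowMap_one, hY, ← hu]
      exact u.mul_inv
  · rintro ⟨⟨X, Y, h1, h2⟩, rfl⟩
    refine ⟨⟨rowMap X, rowMap Y, ?_, ?_⟩, rfl⟩
    · exact (rowMap_mul Y X).symm.trans (by rw [h2]; exact rowMap_one)
    · exact (rowMap_mul X Y).symm.trans (by rw [h1]; exact rowMap_one)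

theorem rowMap_mem_ker_offDiagonalMap {h Z : Matrix n n K} {A A' : Matrix m m K}
    {B B' : Matrix m n K} :
    (rowMap B, rowMap B') ∈ (offDiagonalMap (rowMap h) (rowMap Z) (rowMap A) (rowMap A')).ker ↔
      A * B' + B * Z = A' * B + B' * h := by
  rw [mem_ker_offDiagonalMap]
  dsimp only
  rw [← rowMap_mul, ← rowMap_mul, ← rowMap_mul, ← rowMap_mul, rowMap, rowMap, rowMap, rowMap,
    ← map_add, ← map_add, Matrix.toLinearMapRight'.injective.eq_iff]

end RowMaps

/-! ### Block decomposition along a minimal clot -/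

section Decomposition

variable {K : Type*} [Field K] {C : Type*} [Fintype C] [DecidableEq C] [P : Preorder C]
  {D : Finset C} {s : ℕ} {l : Fin s → ℕ}

/-- The induced preorder on `C ∖ D`. -/
abbrev complPreorder (D : Finset C) : Preorder {x : C // x ∉ D} := inferInstance

/-- The embedding of `l` into `C ∖ D` as the set `C'`. -/
def aboveEmb (e : aboveClot D ≃o BlockChain l) (y : BlockChain l) : {x : C // x ∉ D} :=
  ⟨(e.symm y).1, (e.symm y).2.1⟩

theorem aboveEmb_le_iff (e : aboveClot D ≃o BlockChain l) {y z : BlockChain l} :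
    aboveEmb e y ≤ aboveEmb e z ↔ y ≤ z := by
  change (e.symm y) ≤ (e.symm z) ↔ _
  exact e.symm.le_iff_le

theorem aboveEmb_injective (e : aboveClot D ≃o BlockChain l) : Function.Injective (aboveEmb e) := by
  intro y z h
  exact e.symm.injective (Subtype.ext (congrArg (fun x => x.1) h))

theorem aboveEmb_mem (e : aboveClot D ≃o BlockChain l) (y : BlockChain l) :
    (aboveEmb e y).1 ∈ aboveClot D := (e.symm y).2

theorem aboveEmb_apply (e : aboveClot D ≃o BlockChain l) {x : {x : C // x ∉ D}}
    (hx : x.1 ∈ aboveClot D) : aboveEmb e (e ⟨x.1, hx⟩) = x :=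
  Subtype.ext (congrArg (fun z : aboveClot D => z.1) (e.symm_apply_apply ⟨x.1, hx⟩))

theorem apply_aboveEmb (e : aboveClot D ≃o BlockChain l) (y : BlockChain l) :
    e ⟨(aboveEmb e y).1, aboveEmb_mem e y⟩ = y := e.apply_symm_apply y

theorem mem_aboveClot_of_le {x y : C} (hx : x ∈ aboveClot D) (hxy : x ≤ y) (hy : y ∉ D) :
    y ∈ aboveClot D := ⟨hy, fun d hd => (hx.2 d hd).trans hxy⟩

/-- The block of a matrix on `C ∖ D` with rows and columns in `C'`. -/
def aboveBlock (e : aboveClot D ≃o BlockChain l) (X : Matrix {x : C // x ∉ D} {x : C // x ∉ D} K) :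
    Matrix (BlockChain l) (BlockChain l) K := X.submatrix (aboveEmb e) (aboveEmb e)

open Classical in
/-- Extension by zero of a matrix with columns in `C'`. -/
noncomputable def extendCols (e : aboveClot D ≃o BlockChain l)
    (B : Matrix {x : C // x ∈ D} (BlockChain l) K) :
    Matrix {x : C // x ∈ D} {x : C // x ∉ D} K :=
  fun d x => if h : x.1 ∈ aboveClot D then B d (e ⟨x.1, h⟩) else 0

theorem extendCols_aboveEmb (e : aboveClot D ≃o BlockChain l)
    (B : Matrix {x : C // x ∈ D} (BlockChain l) K) (d : {x : C // x ∈ D}) (y : BlockChain l) :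
    extendCols e B d (aboveEmb e y) = B d y := by
  rw [extendCols, dif_pos (aboveEmb_mem e y), apply_aboveEmb]

theorem extendCols_of_notMem (e : aboveClot D ≃o BlockChain l)
    (B : Matrix {x : C // x ∈ D} (BlockChain l) K) (d : {x : C // x ∈ D}) {x : {x : C // x ∉ D}}
    (hx : x.1 ∉ aboveClot D) : extendCols e B d x = 0 := dif_neg hx

theorem extendCols_add (e : aboveClot D ≃o BlockChain l)
    (B B' : Matrix {x : C // x ∈ D} (BlockChain l) K) :
    extendCols e (B + B') = extendCols e B + extendCols e B' := by
  ext d x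
  by_cases hx : x.1 ∈ aboveClot D <;> simp [extendCols, hx]

theorem extendCols_injective (e : aboveClot D ≃o BlockChain l) :
    Function.Injective (extendCols (K := K) e) := by
  intro B B' h
  ext d y
  rw [← extendCols_aboveEmb e B, h, extendCols_aboveEmb]

theorem mul_extendCols (e : aboveClot D ≃o BlockChain l)
    (A : Matrix {x : C // x ∈ D} {x : C // x ∈ D} K)
    (B : Matrix {x : C // x ∈ D} (BlockChain l) K) :
    A * extendCols e B = extendCols e (A * B) := by
  ext d x
  by_cases hx : x.1 ∈ aboveClot D <;> simp [extendCols, hx, Matrix.mul_apply]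

/-- The set `C'` is closed upwards in `C ∖ D`, so the rows of `Z` with index in `C'` vanish outside
`C'`. Hence only the block of `Z` on `C'` matters. -/
theorem extendCols_mul (e : aboveClot D ≃o BlockChain l)
    (B : Matrix {x : C // x ∈ D} (BlockChain l) K) {Z : Matrix {x : C // x ∉ D} {x : C // x ∉ D} K}
    (hZ : Z ∈ preorderMatrix K (complPreorder D)) :
    extendCols e B * Z = extendCols e (B * aboveBlock e Z) := by
  ext d x
  rw [Matrix.mul_apply]
  have h1 : ∑ y, extendCols e B d y * Z y x = ∑ y, B d y * Z (aboveEmb e y) x := by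
    symm
    refine Finset.sum_of_injOn (aboveEmb e) (aboveEmb_injective e).injOn (by simp) ?_ ?_
    · intro y _ hy
      rw [extendCols_of_notMem, zero_mul]
      exact fun hy' => hy ⟨e ⟨y.1, hy'⟩, by simp, aboveEmb_apply e hy'⟩
    · intro y _
      rw [extendCols_aboveEmb]
  rw [h1]
  by_cases hx : x.1 ∈ aboveClot D
  · obtain ⟨z, rfl⟩ : ∃ z, x = aboveEmb e z := ⟨_, (aboveEmb_apply e hx).symm⟩
    rw [extendCols_aboveEmb]
    rfl
  · rw [extendCols_of_notMem e _ d hx]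
    refine Finset.sum_eq_zero fun y _ => ?_
    rw [hZ (aboveEmb e y) x fun hle => hx (mem_aboveClot_of_le (aboveEmb_mem e y) hle x.2), mul_zero]

/-- The matrix on `C` with diagonal blocks `A` on `D` and `Z` on `C ∖ D` and off-diagonal block
`B`. -/
noncomputable def triMatrix (e : aboveClot D ≃o BlockChain l)
    (A : Matrix {x : C // x ∈ D} {x : C // x ∈ D} K) (B : Matrix {x : C // x ∈ D} (BlockChain l) K)
    (Z : Matrix {x : C // x ∉ D} {x : C // x ∉ D} K) : Matrix C C K :=
  Matrix.reindexAlgEquiv K K (Equiv.sumCompl (· ∈ D)) (Matrix.fromBlocks A (extendCols e B) 0 Z)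

variable (e : aboveClot D ≃o BlockChain l)

theorem triMatrix_injective {A A' : Matrix {x : C // x ∈ D} {x : C // x ∈ D} K}
    {B B' : Matrix {x : C // x ∈ D} (BlockChain l) K}
    {Z Z' : Matrix {x : C // x ∉ D} {x : C // x ∉ D} K}
    (h : triMatrix e A B Z = triMatrix e A' B' Z') : A = A' ∧ B = B' ∧ Z = Z' := by
  have := (Matrix.reindexAlgEquiv K K (Equiv.sumCompl (· ∈ D))).injective h
  rw [Matrix.fromBlocks_inj] at this
  exact ⟨this.1, extendCols_injective e this.2.1, this.2.2.2⟩

theorem triMatrix_mul (A A' : Matrix {x : C // x ∈ D} {x : C // x ∈ D} K)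
    (B B' : Matrix {x : C // x ∈ D} (BlockChain l) K)
    (Z : Matrix {x : C // x ∉ D} {x : C // x ∉ D} K) {Z' : Matrix {x : C // x ∉ D} {x : C // x ∉ D} K}
    (hZ' : Z' ∈ preorderMatrix K (complPreorder D)) :
    triMatrix e A B Z * triMatrix e A' B' Z' =
      triMatrix e (A * A') (A * B' + B * aboveBlock e Z') (Z * Z') := by
  rw [triMatrix, triMatrix, triMatrix, ← map_mul, Matrix.fromBlocks_multiply, mul_extendCols,
    extendCols_mul e B hZ', extendCols_add]
  simp

theorem isUnit_triMatrix {A : Matrix {x : C // x ∈ D} {x : C // x ∈ D} K}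
    {B : Matrix {x : C // x ∈ D} (BlockChain l) K}
    {Z : Matrix {x : C // x ∉ D} {x : C // x ∉ D} K} :
    IsUnit (triMatrix e A B Z) ↔ IsUnit A ∧ IsUnit Z := by
  rw [triMatrix, isUnit_map_iff, Matrix.isUnit_fromBlocks_zero₂₁]

theorem exists_triMatrix_pow (A : Matrix {x : C // x ∈ D} {x : C // x ∈ D} K)
    (B : Matrix {x : C // x ∈ D} (BlockChain l) K)
    {Z : Matrix {x : C // x ∉ D} {x : C // x ∉ D} K}
    (hZ : Z ∈ preorderMatrix K (complPreorder D)) (n : ℕ) :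
    ∃ B', triMatrix e A B Z ^ n = triMatrix e (A ^ n) B' (Z ^ n) := by
  induction n with
  | zero =>
    refine ⟨0, ?_⟩
    have : extendCols e (0 : Matrix {x : C // x ∈ D} (BlockChain l) K) = 0 := by
      ext d x; simp [extendCols]
    rw [pow_zero, pow_zero, pow_zero, triMatrix, this, Matrix.fromBlocks_one, map_one]
  | succ n ih =>
    obtain ⟨B', hB'⟩ := ih
    exact ⟨_, by rw [pow_succ, hB', triMatrix_mul e _ _ _ _ _ hZ, ← pow_succ, ← pow_succ]⟩

theorem triMatrix_zero : triMatrix e (0 : Matrix {x : C // x ∈ D} {x : C // x ∈ D} K) 0 0 = 0 := by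
  have : extendCols e (0 : Matrix {x : C // x ∈ D} (BlockChain l) K) = 0 := by
    ext d x; simp [extendCols]
  rw [triMatrix, this, Matrix.fromBlocks_zero, map_zero]

theorem isNilpotent_triMatrix {A : Matrix {x : C // x ∈ D} {x : C // x ∈ D} K}
    {B : Matrix {x : C // x ∈ D} (BlockChain l) K}
    {Z : Matrix {x : C // x ∉ D} {x : C // x ∉ D} K}
    (hZ : Z ∈ preorderMatrix K (complPreorder D)) :
    IsNilpotent (triMatrix e A B Z) ↔ IsNilpotent A ∧ IsNilpotent Z := by
  constructor
  · rintro ⟨n, hn⟩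
    obtain ⟨c, hc⟩ := exists_triMatrix_pow e A B hZ n
    rw [hn, ← triMatrix_zero e] at hc
    obtain ⟨h1, -, h2⟩ := triMatrix_injective e hc
    exact ⟨⟨n, h1.symm⟩, ⟨n, h2.symm⟩⟩
  · rintro ⟨⟨n, hn⟩, ⟨m, hm⟩⟩
    obtain ⟨c, hc⟩ := exists_triMatrix_pow e A B hZ (n + m)
    rw [pow_eq_zero_of_le (Nat.le_add_right n m) hn,
      pow_eq_zero_of_le (Nat.le_add_left m n) hm] at hc
    refine ⟨(n + m) * 2, ?_⟩
    have h0 : aboveBlock e (0 : Matrix {x : C // x ∉ D} {x : C // x ∉ D} K) = 0 := rfl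
    rw [pow_mul, hc, pow_two, triMatrix_mul e _ _ _ _ _ (Subalgebra.zero_mem _), h0]
    simp only [zero_mul, Matrix.zero_mul, Matrix.mul_zero, add_zero, triMatrix_zero]

theorem commute_triMatrix {A A' : Matrix {x : C // x ∈ D} {x : C // x ∈ D} K}
    {B B' : Matrix {x : C // x ∈ D} (BlockChain l) K}
    {Z Z' : Matrix {x : C // x ∉ D} {x : C // x ∉ D} K}
    (hZ : Z ∈ preorderMatrix K (complPreorder D)) (hZ' : Z' ∈ preorderMatrix K (complPreorder D)) :
    Commute (triMatrix e A B Z) (triMatrix e A' B' Z') ↔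
      Commute Z Z' ∧ Commute A A' ∧
        A * B' + B * aboveBlock e Z' = A' * B + B' * aboveBlock e Z := by
  rw [Commute, SemiconjBy, triMatrix_mul e _ _ _ _ _ hZ', triMatrix_mul e _ _ _ _ _ hZ]
  constructor
  · intro h
    obtain ⟨h1, h2, h3⟩ := triMatrix_injective e h
    exact ⟨h3, h1, h2⟩
  · rintro ⟨h1, h2, h3⟩
    rw [h1.eq, h2.eq, h3]

theorem IsMinimalClot.le_of_mem (hD : IsMinimalClot D) {x y : C} (hx : x ∈ D) (hy : y ∈ D) :
    x ≤ y := by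
  obtain ⟨z, hz⟩ := hD.isClot
  exact ((hz x).mp hx).2.trans ((hz y).mp hy).1

theorem IsMinimalClot.mem_aboveClot_of_le (hD : IsMinimalClot D) {d x : C} (hd : d ∈ D)
    (hx : x ∉ D) (h : d ≤ x) : x ∈ aboveClot D :=
  ⟨hx, fun _ hd' => (hD.le_of_mem hd' hd).trans h⟩

/-- The blocks `A` and `B` are unrestricted: any two elements of the clot `D` are comparable both
ways, and every element of `C'` lies above all of `D`. -/
theorem triMatrix_mem_iff (hD : IsMinimalClot D) {A : Matrix {x : C // x ∈ D} {x : C // x ∈ D} K}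
    {B : Matrix {x : C // x ∈ D} (BlockChain l) K}
    {Z : Matrix {x : C // x ∉ D} {x : C // x ∉ D} K} :
    triMatrix e A B Z ∈ preorderMatrix K P ↔ Z ∈ preorderMatrix K (complPreorder D) := by
  have key : ∀ i j, triMatrix e A B Z (Equiv.sumCompl (· ∈ D) i) (Equiv.sumCompl (· ∈ D) j) =
      Matrix.fromBlocks A (extendCols e B) 0 Z i j := by
    intro i j
    simp [triMatrix]
  rw [mem_preorderMatrix, mem_preorderMatrix, (Equiv.sumCompl (· ∈ D)).surjective.forall]
  constructor
  · intro h x y hxy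
    rw [← Matrix.fromBlocks_apply₂₂ A (extendCols e B) 0 Z x y, ← key]
    exact h _ _ hxy
  · intro h i
    rw [(Equiv.sumCompl (· ∈ D)).surjective.forall]
    intro j hij
    rw [key]
    rcases i with x | x <;> rcases j with y | y
    · exact absurd (hD.le_of_mem x.2 y.2) hij
    · exact extendCols_of_notMem e B x fun hy => hij (hy.2 x x.2)
    · rfl
    · exact h x y hij

/-- Minimality of `D` kills the block from `C ∖ D` to `D`. An element outside `D` above one element
of the clot is above all of them, so the block from `D` to `C ∖ D` is supported on `C'`. -/
theorem exists_triMatrix_eq (hD : IsMinimalClot D) {X : Matrix C C K}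
    (hX : X ∈ preorderMatrix K P) :
    ∃ A B Z, Z ∈ preorderMatrix K (complPreorder D) ∧ triMatrix e A B Z = X := by
  let A : Matrix {x : C // x ∈ D} {x : C // x ∈ D} K := X.submatrix (fun x => x.1) (fun x => x.1)
  let B : Matrix {x : C // x ∈ D} (BlockChain l) K :=
    X.submatrix (fun x => x.1) (fun y => (aboveEmb e y).1)
  let Z : Matrix {x : C // x ∉ D} {x : C // x ∉ D} K := X.submatrix (fun x => x.1) (fun x => x.1)
  have h : triMatrix e A B Z = X := by
    apply (Matrix.reindexAlgEquiv K K (Equiv.sumCompl (· ∈ D))).symm.injective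
    rw [triMatrix, AlgEquiv.symm_apply_apply]
    ext (x | x) (y | y)
    · rfl
    · change extendCols e B x y = X x y
      by_cases hy : y.1 ∈ aboveClot D
      · obtain ⟨z, rfl⟩ : ∃ z, y = aboveEmb e z := ⟨_, (aboveEmb_apply e hy).symm⟩
        rw [extendCols_aboveEmb]
        rfl
      · rw [extendCols_of_notMem e B x hy]
        exact (hX _ _ fun hle => hy (hD.mem_aboveClot_of_le x.2 y.2 hle)).symm
    · exact (hX _ _ (hD.minimal x.1 x.2 y.1 y.2)).symm
    · rfl
  exact ⟨A, B, Z, (triMatrix_mem_iff e hD).mp (h ▸ hX), h⟩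

theorem card_preorderGroup [Finite K] (e : aboveClot D ≃o BlockChain l) (hD : IsMinimalClot D) :
    Nat.card (preorderGroup K P) =
      cardGL K ({x : C // x ∈ D} → K) *
        Nat.card (({x : C // x ∈ D} → K) →ₗ[K] (BlockChain l → K)) *
          Nat.card (preorderGroup K (complPreorder D)) := by
  rw [cardGL, Nat.card_congr (preorderGroupEquiv K P),
    Nat.card_congr (preorderGroupEquiv K (complPreorder D)), ← Nat.card_prod, ← Nat.card_prod]
  symm
  refine Nat.card_congr (Equiv.ofBijective (fun x => ⟨triMatrix e
    (LinearMap.toMatrixRight' x.1.1.1) (LinearMap.toMatrixRight' x.1.2) x.2.1,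
      (triMatrix_mem_iff e hD).mpr x.2.2.1, (isUnit_triMatrix e).mpr
        ⟨isUnit_rowMap.mp (by rw [rowMap_toMatrixRight']; exact x.1.1.2), x.2.2.2⟩⟩) ⟨?_, ?_⟩)
  · rintro ⟨⟨⟨a, ha⟩, b⟩, ⟨Z, hZ⟩⟩ ⟨⟨⟨a', ha'⟩, b'⟩, ⟨Z', hZ'⟩⟩ H
    obtain ⟨h1, h2, rfl⟩ := triMatrix_injective e (congrArg Subtype.val H)
    obtain rfl := LinearMap.toMatrixRight'.injective h1
    obtain rfl := LinearMap.toMatrixRight'.injective h2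
    rfl
  · rintro ⟨X, hX, hX'⟩
    obtain ⟨A, B, Z, hZ, rfl⟩ := exists_triMatrix_eq e hD hX
    rw [isUnit_triMatrix] at hX'
    refine ⟨⟨⟨⟨rowMap A, isUnit_rowMap.mpr hX'.1⟩, rowMap B⟩, ⟨Z, hZ, hX'.2⟩⟩, Subtype.ext ?_⟩
    simp

/-- The commuting pairs on `D`, with off-diagonal blocks, that extend a given commuting pair on
`C ∖ D`. -/
abbrev BlockPairs (K : Type*) [Field K] {C : Type*} [Fintype C] [DecidableEq C] [P : Preorder C]
    {D : Finset C} {s : ℕ} {l : Fin s → ℕ} (e : aboveClot D ≃o BlockChain l) : Type _ :=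
  Σ x : matCommPairs K (complPreorder D), Σ y : commPairs K ({x : C // x ∈ D} → K),
    (offDiagonalMap (rowMap (aboveBlock e x.1.1)) (rowMap (aboveBlock e x.1.2)) y.1.1 y.1.2).ker

/-- Assembly of a commuting pair of matrices on `C` from its blocks. -/
noncomputable def triPair (hD : IsMinimalClot D) (x : BlockPairs K e) : matCommPairs K P :=
  ⟨(triMatrix e (LinearMap.toMatrixRight' x.2.1.1.1) (LinearMap.toMatrixRight' x.2.2.1.1) x.1.1.1,
      triMatrix e (LinearMap.toMatrixRight' x.2.1.1.2) (LinearMap.toMatrixRight' x.2.2.1.2) x.1.1.2),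
    (triMatrix_mem_iff e hD).mpr x.1.2.1, (triMatrix_mem_iff e hD).mpr x.1.2.2.1,
    (isUnit_triMatrix e).mpr ⟨isUnit_rowMap.mp (by
      rw [rowMap_toMatrixRight']; exact x.2.1.2.1), x.1.2.2.2.1⟩,
    (isNilpotent_triMatrix e x.1.2.2.1).mpr ⟨isNilpotent_rowMap.mp (by
      rw [rowMap_toMatrixRight']; exact x.2.1.2.2.1), x.1.2.2.2.2.1⟩,
    (commute_triMatrix e x.1.2.1 x.1.2.2.1).mpr ⟨x.1.2.2.2.2.2, commute_rowMap.mp (by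
      rw [rowMap_toMatrixRight', rowMap_toMatrixRight']; exact x.2.1.2.2.2),
      rowMap_mem_ker_offDiagonalMap.mp (by
        simp only [rowMap_toMatrixRight']; exact x.2.2.2)⟩⟩

theorem triPair_injective (hD : IsMinimalClot D) :
    Function.Injective (triPair (K := K) e hD) := by
  rintro ⟨⟨⟨h, Z⟩, hx⟩, ⟨⟨a, A⟩, hy⟩, ⟨⟨b, B⟩, hz⟩⟩
    ⟨⟨⟨h', Z'⟩, hx'⟩, ⟨⟨a', A'⟩, hy'⟩, ⟨⟨b', B'⟩, hz'⟩⟩ H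
  obtain ⟨h1, h2, rfl⟩ := triMatrix_injective e (congrArg (fun x => x.1.1) H)
  obtain ⟨h3, h4, rfl⟩ := triMatrix_injective e (congrArg (fun x => x.1.2) H)
  obtain rfl := LinearMap.toMatrixRight'.injective h1
  obtain rfl := LinearMap.toMatrixRight'.injective h2
  obtain rfl := LinearMap.toMatrixRight'.injective h3
  obtain rfl := LinearMap.toMatrixRight'.injective h4
  rfl

theorem triPair_surjective (hD : IsMinimalClot D) :
    Function.Surjective (triPair (K := K) e hD) := by
  rintro ⟨⟨X, Y⟩, hX, hY, h1, h2, h3⟩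
  obtain ⟨A, B, h, hh, rfl⟩ := exists_triMatrix_eq (X := X) e hD hX
  obtain ⟨A', B', Z, hZ, rfl⟩ := exists_triMatrix_eq (X := Y) e hD hY
  have h1' := (isUnit_triMatrix e).mp h1
  have h2' := (isNilpotent_triMatrix e hZ).mp h2
  have h3' := (commute_triMatrix e hh hZ).mp h3
  refine ⟨⟨⟨(h, Z), hh, hZ, h1'.2, h2'.2, h3'.1⟩,
    ⟨(rowMap A, rowMap A'), isUnit_rowMap.mpr h1'.1, isNilpotent_rowMap.mpr h2'.1,
      commute_rowMap.mpr h3'.2.1⟩,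
    ⟨(rowMap B, rowMap B'), rowMap_mem_ker_offDiagonalMap.mpr h3'.2.2⟩⟩, Subtype.ext ?_⟩
  simp [triPair]

/-- For a fixed pair on `C ∖ D`, trace duality replaces the off-diagonal blocks by intertwiners from
`K^{C'}` to `K^D`; the factor `|Hom(K^D, K^{C'})|` is the same for all pairs. -/
theorem card_matCommPairs [Finite K] (hD : IsMinimalClot D)
    [Fintype (matCommPairs K (complPreorder D))] :
    Nat.card (matCommPairs K P) =
      Nat.card (({x : C // x ∈ D} → K) →ₗ[K] (BlockChain l → K)) *
        ∑ x : matCommPairs K (complPreorder D), homCount ({x : C // x ∈ D} → K)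
          (rowMap (aboveBlock e x.1.1)) (rowMap (aboveBlock e x.1.2)) ⊥ := by
  have : Finite (End K ({x : C // x ∈ D} → K)) := Module.finite_of_finite K
  have : Finite (({x : C // x ∈ D} → K) →ₗ[K] (BlockChain l → K)) := Module.finite_of_finite K
  have := Fintype.ofFinite (commPairs K ({x : C // x ∈ D} → K))
  have key : ∀ x : matCommPairs K (complPreorder D),
      Nat.card (({x : C // x ∈ D} → K) →ₗ[K] (BlockChain l → K)) *
        homCount ({x : C // x ∈ D} → K) (rowMap (aboveBlock e x.1.1))
          (rowMap (aboveBlock e x.1.2)) ⊥ =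
      Nat.card (Σ y : commPairs K ({x : C // x ∈ D} → K),
        (offDiagonalMap (rowMap (aboveBlock e x.1.1)) (rowMap (aboveBlock e x.1.2))
          y.1.1 y.1.2).ker) := by
    intro x
    rw [Nat.card_sigma, homCount_bot_eq_sum, Finset.mul_sum]
    exact Finset.sum_congr rfl fun y _ => (card_ker_offDiagonalMap _ _ _ _).symm
  rw [Finset.mul_sum, Finset.sum_congr rfl fun x _ => key x, ← Nat.card_sigma]
  symm
  exact Nat.card_congr (Equiv.ofBijective (triPair e hD)
    ⟨triPair_injective e hD, triPair_surjective e hD⟩)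

end Decomposition

/-! ### A common adapted basis for two chains of subspaces -/

section AdaptedBasis

variable {K E : Type*} [Field K] [AddCommGroup E] [Module K E] [FiniteDimensional K E]

/-- Induction on `dim H`: a vector `v` and a hyperplane `H ⊓ ker f` complementary to it are chosen
so that every `L` of both chains splits accordingly. If `v ∈ L`, then `x - f(x) v` stays in `L`; if
`v ∉ L`, then `L ⊓ H` must lie in `ker f`. -/
theorem exists_adapted_family {𝓕 𝓖 : Set (Submodule K E)} (hF : IsChain (· ≤ ·) 𝓕)
    (hG : IsChain (· ≤ ·) 𝓖) (hT : ⊤ ∈ 𝓖) (d : ℕ) (H : Submodule K E) (hd : finrank K H = d) :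
    ∃ (n : ℕ) (v : Fin n → E), LinearIndependent K v ∧ Submodule.span K (Set.range v) = H ∧
      ∀ L ∈ 𝓕 ∪ 𝓖, L ⊓ H ≤ Submodule.span K (v '' {i | v i ∈ L}) := by
  induction d using Nat.strong_induction_on generalizing H with
  | _ d ih =>
    subst hd
    by_cases hH : H = ⊥
    · subst hH
      exact ⟨0, Fin.elim0, linearIndependent_empty_type, by simp, fun L _ => by simp⟩
    -- Taking `v` in the smallest nonzero `G ⊓ H` ensures that every `G` of the second chain
    -- contains `v` or meets `H` trivially.
    · obtain ⟨M, ⟨⟨G₀, hG₀, rfl⟩, hM⟩, hmin⟩ := WellFounded.has_min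
        (wellFounded_lt (α := Submodule K E)) {M | (∃ G ∈ 𝓖, M = G ⊓ H) ∧ M ≠ ⊥}
        ⟨H, ⟨⊤, hT, by simp⟩, hH⟩
      obtain ⟨v, hv, hv0⟩ := Submodule.exists_mem_ne_zero_of_ne_bot hM
      have hGv : ∀ G ∈ 𝓖, v ∈ G ∨ G ⊓ H = ⊥ := by
        intro G hG'
        by_contra! hcon
        rcases hG.total hG' hG₀ with h1 | h1
        · refine hmin (G ⊓ H) ⟨⟨G, hG', rfl⟩, hcon.2⟩ (lt_of_le_of_ne (inf_le_inf_right H h1) ?_)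
          intro h2
          exact hcon.1 (h2.ge hv).1
        · exact hcon.1 (h1 hv.1)
      -- `F₁` is the largest member of the first chain without `v`, or `⊥` if there is none. A
      -- functional vanishing on `F₁` vanishes on all members without `v`.
      obtain ⟨F₁, hF₁, hFv⟩ : ∃ F₁ : Submodule K E, v ∉ F₁ ∧ ∀ F ∈ 𝓕, v ∉ F → F ≤ F₁ := by
        by_cases hne : {F | F ∈ 𝓕 ∧ v ∉ F}.Nonempty
        · obtain ⟨F₁, hF₁, hmax⟩ := WellFounded.has_min
            (wellFounded_gt (α := Submodule K E)) _ hne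
          refine ⟨F₁, hF₁.2, fun F hF' hv' => ?_⟩
          rcases hF.total hF' hF₁.1 with h1 | h1
          · exact h1
          · rcases h1.eq_or_lt with h2 | h2
            · exact h2.ge
            · exact absurd h2 (hmax F ⟨hF', hv'⟩)
        · refine ⟨⊥, by simpa using hv0, fun F hF' hv' => absurd ⟨F, hF', hv'⟩ hne⟩
      obtain ⟨f, hf⟩ : ∃ f : E →ₗ[K] K, f v = 1 ∧ F₁ ≤ f.ker := by
        obtain ⟨f, hf, hf'⟩ := Submodule.exists_le_ker_of_notMem hF₁
        refine ⟨(f v)⁻¹ • f, by simp [hf], fun x hx => ?_⟩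
        have : f x = 0 := hf' hx
        simp [this]
      obtain ⟨hf1, hf2⟩ := hf
      have hlt : H ⊓ f.ker < H := by
        refine lt_of_le_of_ne inf_le_left fun h => ?_
        have : v ∈ f.ker := (h.ge hv.2).2
        rw [LinearMap.mem_ker, hf1] at this
        exact one_ne_zero this
      obtain ⟨n, w, hw1, hw2, hw3⟩ := ih _ (Submodule.finrank_lt_finrank_of_lt hlt) _ rfl
      have hsub : ∀ x ∈ H, x - f x • v ∈ H ⊓ f.ker := fun x hx =>
        ⟨H.sub_mem hx (H.smul_mem _ hv.2), by simp [hf1]⟩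
      refine ⟨n + 1, Fin.cons v w, ?_, ?_, ?_⟩
      · rw [linearIndependent_finCons, hw2]
        refine ⟨hw1, fun h => ?_⟩
        have : f v = 0 := h.2
        rw [hf1] at this
        exact one_ne_zero this
      · rw [Fin.range_cons, Submodule.span_insert, hw2]
        apply le_antisymm
        · rw [sup_le_iff, Submodule.span_singleton_le_iff_mem]
          exact ⟨hv.2, inf_le_left⟩
        · intro x hx
          rw [← add_sub_cancel (f x • v) x]
          exact Submodule.add_mem_sup (Submodule.smul_mem _ _ (Submodule.mem_span_singleton_self v))
            (hsub x hx)
      · rintro L hL x ⟨hxL, hxH⟩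
        have hle : Submodule.span K (w '' {i | w i ∈ L}) ≤
            Submodule.span K ((Fin.cons v w : Fin (n + 1) → E) ''
              {i | (Fin.cons v w : Fin (n + 1) → E) i ∈ L}) := by
          refine Submodule.span_mono ?_
          rintro _ ⟨i, hi, rfl⟩
          exact ⟨i.succ, by simpa using hi, by simp⟩
        by_cases hvL : v ∈ L
        · rw [← add_sub_cancel (f x • v) x]
          refine Submodule.add_mem _ (Submodule.smul_mem _ _ (Submodule.subset_span ⟨0, ?_, ?_⟩)) ?_
          · simpa using hvL
          · simp
          · exact hle (hw3 L hL ⟨L.sub_mem hxL (L.smul_mem _ hvL), hsub x hxH⟩)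
        · refine hle (hw3 L hL ⟨hxL, hxH, ?_⟩)
          rcases hL with hL | hL
          · exact hf2 (hFv L hL hvL hxL)
          · have := (hGv L hL).resolve_left hvL
            have hx0 : x ∈ L ⊓ H := ⟨hxL, hxH⟩
            rw [this, Submodule.mem_bot] at hx0
            simp [hx0]

/-- Two chains of subspaces have a common adapted basis. -/
theorem exists_adapted_basis {𝓕 𝓖 : Set (Submodule K E)} (hF : IsChain (· ≤ ·) 𝓕)
    (hG : IsChain (· ≤ ·) 𝓖) (hT : ⊤ ∈ 𝓖) :
    ∃ (n : ℕ) (b : Basis (Fin n) K E), ∀ L ∈ 𝓕 ∪ 𝓖, ∀ x, x ∈ L ↔ ∀ i, b i ∉ L → b.repr x i = 0 := by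
  obtain ⟨n, v, h1, h2, h3⟩ := exists_adapted_family hF hG hT _ ⊤ rfl
  let b : Basis (Fin n) K E := Basis.mk h1 h2.ge
  have hb : ∀ i, b i = v i := fun i => Basis.mk_apply h1 h2.ge i
  refine ⟨n, b, fun L hL x => ⟨fun hx i hi => ?_, fun hx => ?_⟩⟩
  · have h4 := h3 L hL ⟨hx, trivial⟩
    have h5 : v = b := funext fun i => (hb i).symm
    rw [h5, Basis.mem_span_image] at h4
    by_contra hne
    exact hi (h4 (Finsupp.mem_support_iff.mpr hne))
  · rw [← b.sum_repr x]
    refine L.sum_mem fun i _ => ?_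
    by_cases hi : b i ∈ L
    · exact L.smul_mem _ hi
    · rw [hx i hi, zero_smul]
      exact L.zero_mem

theorem finrank_eq_card_of_adapted {n : ℕ} (b : Basis (Fin n) K E) {L : Submodule K E}
    (hL : ∀ x, x ∈ L ↔ ∀ i, b i ∉ L → b.repr x i = 0) :
    finrank K L = {i | b i ∈ L}.ncard := by
  have : L.map (b.equivFun : E →ₗ[K] (Fin n → K)) = coordSubspace K {i | b i ∈ L} := by
    ext f
    obtain ⟨x, rfl⟩ := b.equivFun.surjective f
    have h1 : b.equivFun x ∈ L.map (b.equivFun : E →ₗ[K] (Fin n → K)) ↔ x ∈ L := by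
      simp
    rw [h1, hL, mem_coordSubspace]
    rfl
  rw [← LinearEquiv.finrank_map_eq b.equivFun L, this, finrank_coordSubspace]

end AdaptedBasis

/-! ### Standard flags and bases compatible with the blocks -/

section StandardFlags

theorem codim_coordSubspace {K : Type*} [Field K] {I : Type*} [Fintype I] (T : Set I) :
    codim (coordSubspace K T) = Tᶜ.ncard := by
  have h1 := (coordSubspace K T).finrank_quotient_add_finrank
  rw [finrank_coordSubspace, finrank_fintype_fun_eq_card, ← Nat.card_eq_fintype_card,
    ← Set.ncard_add_ncard_compl T] at h1
  unfold codim
  omega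

theorem coordSubspace_inf {K : Type*} [Field K] {I : Type*} (T T' : Set I) :
    coordSubspace K T ⊓ coordSubspace K T' = coordSubspace K (T ∩ T') := by
  ext f
  simp only [Submodule.mem_inf, mem_coordSubspace, Set.mem_inter_iff, not_and_or]
  exact ⟨fun h y hy => hy.elim (h.1 y) (h.2 y), fun h => ⟨fun y hy => h y (Or.inl hy),
    fun y hy => h y (Or.inr hy)⟩⟩

theorem coordSubspace_mono {K : Type*} [Field K] {I : Type*} {T T' : Set I} (h : T ⊆ T') :
    coordSubspace K T ≤ coordSubspace K T' := fun _ hf y hy => hf y fun h' => hy (h h')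

theorem coordSubspace_le_comap_rowMap {K : Type*} [Field K] {I : Type*} [Fintype I] [DecidableEq I]
    {T : Set I} {X : Matrix I I K} :
    coordSubspace K T ≤ (coordSubspace K T).comap (rowMap X) ↔
      ∀ y z, y ∈ T → z ∉ T → X y z = 0 := by
  constructor
  · intro h y z hy hz
    have h1 : Pi.single y (1 : K) ∈ coordSubspace K T := fun x hx => by
      rw [Pi.single_eq_of_ne]
      rintro rfl
      exact hx hy
    have h2 := h h1 z hz
    simpa using h2
  · intro h f hf z hz
    change (Matrix.vecMul f X) z = 0
    rw [Matrix.vecMul, dotProduct]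
    refine Finset.sum_eq_zero fun y _ => ?_
    by_cases hy : y ∈ T
    · rw [h y z hy hz, mul_zero]
    · rw [hf y hy, zero_mul]

variable {s : ℕ} {l : Fin s → ℕ}

theorem ncard_blockChain_lt {c : Fin s → ℕ} (hc : ∀ i, c i ≤ l i) :
    {y : BlockChain l | (y.2 : ℕ) < c y.1}.ncard = ∑ i, c i := by
  rw [← Nat.card_coe_set_eq]
  have e : {y : BlockChain l | (y.2 : ℕ) < c y.1} ≃ Σ i, Fin (c i) :=
    { toFun := fun x => ⟨x.1.1, ⟨x.1.2, x.2⟩⟩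
      invFun := fun y => ⟨⟨y.1, ⟨y.2, y.2.2.trans_le (hc _)⟩⟩, y.2.2⟩
      left_inv := fun x => rfl
      right_inv := fun y => rfl }
  rw [Nat.card_congr e, Nat.card_sigma]
  simp

variable {S : Finset ℕ}

/-- The position of `t` in the decreasing enumeration of `S`. -/
noncomputable def flagIndex (S : Finset ℕ) (t : S) : Fin S.card :=
  Fin.rev ((S.orderIsoOfFin rfl).symm t)

/-- The elements of `S` in decreasing order. -/
noncomputable def flagElem (S : Finset ℕ) (j : Fin S.card) : S := S.orderIsoOfFin rfl (Fin.rev j)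

theorem flagElem_flagIndex (t : S) : flagElem S (flagIndex S t) = t := by
  simp [flagElem, flagIndex]

theorem flagIndex_flagElem (j : Fin S.card) : flagIndex S (flagElem S j) = j := by
  simp [flagElem, flagIndex]

theorem flagIndex_anti : Antitone (flagIndex S) := fun _ _ h =>
  Fin.rev_le_rev.mpr ((S.orderIsoOfFin rfl).symm.monotone h)

theorem flagElem_anti : Antitone (flagElem S) := fun _ _ h =>
  (S.orderIsoOfFin rfl).monotone (Fin.rev_le_rev.mpr h)

theorem coe_flagElem (j : Fin S.card) :
    (flagElem S j : ℕ) = S.orderEmbOfFin rfl (Fin.rev j) := rfl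

/-- The index set of the coordinate subspace of codimension `t` in the standard flag. -/
def FlagTuple.upper (n : FlagTuple l S) (j : Fin S.card) : Set (BlockChain l) :=
  {y | (n.1 y.1 j : ℕ) ≤ y.2}

/-- The standard flag attached to a tuple. -/
noncomputable def FlagTuple.stdFlag (K : Type*) [Field K] (n : FlagTuple l S) :
    SubspaceFlag K (BlockChain l → K) S :=
  ⟨fun t => coordSubspace K (n.upper (flagIndex S t)), by
    refine ⟨fun t => ?_, fun _ _ h => coordSubspace_mono fun y hy => ?_⟩
    · rw [codim_coordSubspace]
      have h1 : (n.upper (flagIndex S t))ᶜ =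
          {y : BlockChain l | (y.2 : ℕ) < n.1 y.1 (flagIndex S t)} := by
        ext y; simp [FlagTuple.upper]
      rw [h1, ncard_blockChain_lt (c := fun i => (n.1 i (flagIndex S t) : ℕ))
        fun i => Nat.lt_succ_iff.mp (n.1 i _).2, n.2.2, ← coe_flagElem, flagElem_flagIndex]
    · exact (Fin.le_def.mp (n.2.1 y.1 (flagIndex_anti h))).trans hy⟩

/-- The index `c` is the level of `y`: since the entries decrease, `y` lies in `n.upper j` exactly
for `j ≥ c`. In this form `≼'` is visibly the condition for a matrix to preserve the standard flag.
-/
theorem FlagTuple.rel_iff (n : FlagTuple l S) {y z : BlockChain l} :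
    n.rel y z ↔ y.1 ≤ z.1 ∧ ∀ j, y ∈ n.upper j → z ∈ n.upper j := by
  have hent : ∀ (i : Fin s) (j : Fin S.card), n.entry i (j + 1) = n.1 i j := fun i j =>
    dif_pos j.2
  constructor
  · rintro ⟨h1, c, hc, hcy, hcz⟩
    refine ⟨h1, fun j hj => ?_⟩
    have hcj : c ≤ j := by
      by_contra hcon
      have h2 := n.entry_antitone y.1 (show (j : ℕ) + 1 ≤ c by omega)
      rw [hent] at h2
      have : (n.1 y.1 j : ℕ) ≤ y.2 := hj
      omega
    have h3 := n.entry_antitone z.1 (show c + 1 ≤ (j : ℕ) + 1 by omega)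
    rw [hent] at h3
    exact h3.trans hcz
  · rintro ⟨h1, h2⟩
    obtain ⟨-, c, hc, hcy, hcy'⟩ := n.rel_refl y
    refine ⟨h1, c, hc, hcy, ?_⟩
    rcases hc.eq_or_lt with rfl | hlt
    · exact (dif_neg (lt_irrefl _)).le.trans (Nat.zero_le _)
    · rw [hent _ ⟨c, hlt⟩] at hcy' ⊢
      exact h2 ⟨c, hlt⟩ hcy'

/-- The coordinate subspace spanned by the blocks with index at least `i`. -/
noncomputable def tailSubspace (K : Type*) [Field K] {s : ℕ} (l : Fin s → ℕ) (i : ℕ) :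
    Submodule K (BlockChain l → K) :=
  coordSubspace K {y : BlockChain l | i ≤ (y.1 : ℕ)}

theorem mem_lowerSet_iff_lt_card {L : ℕ} {A : Finset (Fin L)} (hA : ∀ p q, q ≤ p → p ∈ A → q ∈ A)
    (p : Fin L) : p ∈ A ↔ (p : ℕ) < A.card := by
  constructor
  · intro hp
    have : Finset.Iic p ⊆ A := fun q hq => hA p q (Finset.mem_Iic.mp hq) hp
    have := Finset.card_le_card this
    rw [Fin.card_Iic] at this
    omega
  · intro hp
    by_contra hcon
    have : A ⊆ Finset.Iio p := fun q hq => by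
      rw [Finset.mem_Iio]
      by_contra hq'
      exact hcon (hA q p (not_lt.mp hq') hq)
    have := Finset.card_le_card this
    rw [Fin.card_Iio] at this
    omega

/-- A basis vector belongs to the first block in which it has a nonzero coordinate. By adaptedness
the number of basis vectors in each tail subspace is its dimension, and differences of consecutive
tails give `l i`. -/
theorem exists_equiv_fiber_of_adapted {K : Type*} [Field K] {n : ℕ}
    (b : Basis (Fin n) K (BlockChain l → K))
    (hb : ∀ i x, x ∈ tailSubspace K l i ↔ ∀ k, b k ∉ tailSubspace K l i → b.repr x k = 0) :
    ∃ a : Fin n → Fin s, (∀ k (i : ℕ), b k ∈ tailSubspace K l i ↔ i ≤ (a k : ℕ)) ∧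
      ∀ i, Nat.card {k // a k = i} = l i := by
  classical
  have hex : ∀ k, ∃ a : Fin s, ∀ i : ℕ, b k ∈ tailSubspace K l i ↔ i ≤ (a : ℕ) := by
    intro k
    have hne : (Finset.univ.filter fun y => b k y ≠ 0).Nonempty := by
      by_contra hcon
      rw [Finset.not_nonempty_iff_eq_empty, Finset.filter_eq_empty_iff] at hcon
      refine b.ne_zero k (funext fun y => ?_)
      simpa using hcon (Finset.mem_univ y)
    obtain ⟨y, hy, hmin⟩ := Finset.exists_min_image _ (fun y : BlockChain l => y.1) hne
    refine ⟨y.1, fun i => ⟨fun h => ?_, fun h z hz => ?_⟩⟩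
    · by_contra hcon
      exact (Finset.mem_filter.mp hy).2 (h y hcon)
    · by_contra hcon
      have := hmin z (by simpa using hcon)
      exact hz (h.trans this)
  choose a ha using hex
  refine ⟨a, ha, fun i => ?_⟩
  have hcount : ∀ i : ℕ, {k | i ≤ (a k : ℕ)}.ncard = {y : BlockChain l | i ≤ (y.1 : ℕ)}.ncard := by
    intro i
    have h1 := finrank_eq_card_of_adapted b (hb i)
    simp only [ha] at h1
    rw [← h1, tailSubspace, finrank_coordSubspace]
  have h2 : {k | (i : ℕ) ≤ a k} = {k | (i : ℕ) + 1 ≤ a k} ∪ {k | a k = i} := by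
    ext k
    simp only [Set.mem_union, Set.mem_ofPred_eq, Fin.ext_iff]
    omega
  have h3 : {y : BlockChain l | (i : ℕ) ≤ y.1} =
      {y : BlockChain l | (i : ℕ) + 1 ≤ y.1} ∪ {y : BlockChain l | y.1 = i} := by
    ext y
    simp only [Set.mem_union, Set.mem_ofPred_eq, Fin.ext_iff]
    omega
  have h4 := hcount i
  rw [h2, h3, Set.ncard_union_eq (Set.disjoint_left.mpr fun k hk hk' => by
      simp only [Set.mem_ofPred_eq, Fin.ext_iff] at hk hk'; omega),
    Set.ncard_union_eq (Set.disjoint_left.mpr fun k hk hk' => by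
      simp only [Set.mem_ofPred_eq, Fin.ext_iff] at hk hk'; omega), hcount, Nat.add_left_cancel_iff] at h4
  have e : {y : BlockChain l | y.1 = i} ≃ Fin (l i) :=
    { toFun := fun y => Fin.cast (by rw [y.2]) y.1.2
      invFun := fun p => ⟨⟨i, p⟩, rfl⟩
      left_inv := by rintro ⟨⟨i', p⟩, rfl⟩; rfl
      right_inv := fun p => rfl }
  rw [← Nat.card_coe_set_eq, ← Nat.card_coe_set_eq, Nat.card_congr e, Nat.card_fin] at h4
  exact h4

theorem exists_sorted_equiv {α : Type*} [Finite α] {L : ℕ} (h : Nat.card α = L) (d : α → ℕ) :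
    ∃ σ : Fin L ≃ α, Antitone (d ∘ σ) := by
  subst h
  let σ₀ : Fin (Nat.card α) ≃ α := (Finite.equivFin α).symm
  let f : Fin (Nat.card α) → ℕᵒᵈ := fun p => OrderDual.toDual (d (σ₀ p))
  exact ⟨(Tuple.sort f).trans σ₀, fun p q hpq => Tuple.monotone_sort f hpq⟩

/-- Every flag has a basis adapted to it and to the tail subspaces, enumerated compatibly with a
standard flag. -/
theorem exists_flagTuple_basis {K : Type*} [Field K] (F : SubspaceFlag K (BlockChain l → K) S) :
    ∃ (n : FlagTuple l S) (b : Basis (BlockChain l) K (BlockChain l → K)),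
      (∀ y, b y ∈ tailSubspace K l y.1) ∧
      ∀ t x, x ∈ F.1 t ↔ ∀ y, y ∉ n.upper (flagIndex S t) → b.repr x y = 0 := by
  classical
  obtain ⟨N, b, hb⟩ := exists_adapted_basis (K := K) (E := BlockChain l → K)
    (𝓕 := Set.range F.1) (𝓖 := Set.range (tailSubspace K l))
    (by
      rintro _ ⟨t, rfl⟩ _ ⟨t', rfl⟩ -
      rcases le_total t t' with h | h
      · exact Or.inr (F.2.2 h)
      · exact Or.inl (F.2.2 h))
    (by
      rintro _ ⟨i, rfl⟩ _ ⟨i', rfl⟩ -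
      rcases le_total i i' with h | h
      · exact Or.inr (coordSubspace_mono fun y hy => h.trans hy)
      · exact Or.inl (coordSubspace_mono fun y hy => h.trans hy))
    ⟨0, by
      refine top_le_iff.mp fun x _ y hy => absurd (Nat.zero_le _) hy⟩
  obtain ⟨a, ha, hcard⟩ := exists_equiv_fiber_of_adapted b
    fun i => hb _ (Or.inr ⟨i, rfl⟩)
  -- Within a block, the vectors outside the most members of the flag come first. As the flag is
  -- nested, the vectors outside any given member then form an initial segment.
  choose σ hσ using fun i => exists_sorted_equiv (hcard i)
    (fun k => (Finset.univ.filter fun t : S => b k.1 ∉ F.1 t).card)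
  let τ : BlockChain l ≃ Fin N :=
    (Equiv.sigmaCongrRight σ).trans (Equiv.sigmaFiberEquiv a)
  have hτ : ∀ i p, τ ⟨i, p⟩ = (σ i p).1 := fun i p => rfl
  have haτ : ∀ y, a (τ y) = y.1 := fun y => (σ y.1 y.2).2
  let A : (i : Fin s) → S → Finset (Fin (l i)) := fun i t =>
    Finset.univ.filter fun p => b (τ ⟨i, p⟩) ∉ F.1 t
  have hA : ∀ i t p, p ∈ A i t ↔ (p : ℕ) < (A i t).card := by
    intro i t
    refine mem_lowerSet_iff_lt_card fun p q hqp hp => ?_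
    by_contra hq
    simp only [A, Finset.mem_filter, Finset.mem_univ, true_and, not_not] at hp hq
    have h1 := hσ i hqp
    refine (Finset.card_lt_card ?_).not_ge h1
    refine Finset.ssubset_iff_of_subset ?_ |>.mpr ⟨t,
      Finset.mem_filter.mpr ⟨Finset.mem_univ _, hp⟩, fun h => (Finset.mem_filter.mp h).2 hq⟩
    intro t' ht'
    simp only [Finset.mem_filter, Finset.mem_univ, true_and] at ht' ⊢
    have htt : t ≤ t' := by
      by_contra hcon
      exact ht' (F.2.2 (not_le.mp hcon).le hq)
    exact fun h => hp (F.2.2 htt h)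
  have hAanti : ∀ i t t', t ≤ t' → A i t ⊆ A i t' := by
    intro i t t' h p hp
    simp only [A, Finset.mem_filter, Finset.mem_univ, true_and] at hp ⊢
    exact fun h' => hp (F.2.2 h h')
  have hAl : ∀ i t, (A i t).card ≤ l i := fun i t =>
    (Finset.card_le_univ _).trans (Fintype.card_fin _).le
  -- The entry counts the basis vectors of block `i` outside the flag member; over all blocks these
  -- add up to its codimension.
  let n : FlagTuple l S := ⟨fun i j => ⟨(A i (flagElem S j)).card, Nat.lt_succ_of_le (hAl _ _)⟩, by
    refine ⟨fun i j j' h => Finset.card_le_card (hAanti i _ _ (flagElem_anti h)), fun j => ?_⟩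
    rw [← coe_flagElem, ← F.2.1 (flagElem S j)]
    dsimp only
    rw [← ncard_blockChain_lt (l := l) (c := fun i => (A i (flagElem S j)).card) fun i => hAl i _]
    have h1 := (F.1 (flagElem S j)).finrank_quotient_add_finrank
    rw [finrank_eq_card_of_adapted b (hb _ (Or.inl ⟨_, rfl⟩)), finrank_eq_card_basis b,
      ← Nat.card_eq_fintype_card, ← Set.ncard_add_ncard_compl {k | b k ∈ F.1 (flagElem S j)}] at h1
    have h2 : {y : BlockChain l | (y.2 : ℕ) < (A y.1 (flagElem S j)).card}.ncard =
        {k | b k ∈ F.1 (flagElem S j)}ᶜ.ncard := by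
      rw [← Set.ncard_image_of_injective _ τ.injective]
      congr 1
      ext k
      obtain ⟨y, rfl⟩ := τ.surjective k
      rw [Set.mem_image_equiv, Equiv.symm_apply_apply]
      simp only [Set.mem_ofPred_eq, Set.mem_compl_iff, ← hA]
      simp only [A, Finset.mem_filter, Finset.mem_univ, true_and]
      exact Iff.rfl
    rw [h2]
    unfold codim
    omega⟩
  have hn : ∀ t y, y ∈ n.upper (flagIndex S t) ↔ b (τ y) ∈ F.1 t := by
    intro t y
    change (A y.1 (flagElem S (flagIndex S t))).card ≤ y.2 ↔ _
    rw [flagElem_flagIndex, ← not_lt, ← hA]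
    simp only [A, Finset.mem_filter, Finset.mem_univ, true_and, not_not]
    exact Iff.rfl
  refine ⟨n, b.reindex τ.symm, fun y => ?_, fun t x => ?_⟩
  · rw [Basis.reindex_apply, Equiv.symm_symm, ha, haτ]
  · rw [hb _ (Or.inl ⟨t, rfl⟩), ← τ.forall_congr_right]
    simp only [hn, Basis.repr_reindex_apply, Equiv.symm_symm]

end StandardFlags

/-! ### The action of `P^{C∖D}` on flags -/

section FlagAction

variable {K : Type*} [Field K] {C : Type*} [Fintype C] [DecidableEq C] [P : Preorder C]
  {D : Finset C} {s : ℕ} {l : Fin s → ℕ} (e : aboveClot D ≃o BlockChain l)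

theorem aboveBlock_mul {X Y : Matrix {x : C // x ∉ D} {x : C // x ∉ D} K}
    (hX : X ∈ preorderMatrix K (complPreorder D)) :
    aboveBlock e (X * Y) = aboveBlock e X * aboveBlock e Y := by
  ext y z
  change (X * Y) (aboveEmb e y) (aboveEmb e z) = _
  rw [Matrix.mul_apply, Matrix.mul_apply]
  symm
  refine Finset.sum_of_injOn (aboveEmb e) (aboveEmb_injective e).injOn (by simp) ?_ ?_
  · intro x _ hx
    have hx' : x.1 ∉ aboveClot D := fun hx' => hx ⟨e ⟨x.1, hx'⟩, by simp, aboveEmb_apply e hx'⟩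
    rw [hX _ _ fun hle => hx' (mem_aboveClot_of_le (aboveEmb_mem e y) hle x.2), zero_mul]
  · intro x _
    rfl

theorem aboveBlock_one :
    aboveBlock e (1 : Matrix {x : C // x ∉ D} {x : C // x ∉ D} K) = 1 :=
  Matrix.submatrix_one _ (aboveEmb_injective e)

/-- The action on row vectors of the block of a matrix with rows and columns in `C'`. -/
noncomputable abbrev aboveMap (X : Matrix {x : C // x ∉ D} {x : C // x ∉ D} K) :
    End K (BlockChain l → K) := rowMap (aboveBlock e X)

theorem aboveMap_mul {X Y : Matrix {x : C // x ∉ D} {x : C // x ∉ D} K}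
    (hX : X ∈ preorderMatrix K (complPreorder D)) :
    aboveMap e (X * Y) = aboveMap e Y ∘ₗ aboveMap e X := by
  rw [aboveMap, aboveBlock_mul e hX, rowMap_mul]

theorem aboveMap_one : aboveMap e (1 : Matrix {x : C // x ∉ D} {x : C // x ∉ D} K) = LinearMap.id := by
  rw [aboveMap, aboveBlock_one, rowMap_one]

/-- A coordinate subspace is invariant when the entries leading out of its index set vanish. By
`FlagTuple.rel_iff` these are the entries that `≼'` forbids in addition to `≼`. -/
theorem mem_preorderMatrix_flagPreorder {S : Finset ℕ} (n : FlagTuple l S)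
    {X : Matrix {x : C // x ∉ D} {x : C // x ∉ D} K} :
    X ∈ preorderMatrix K (flagPreorder D e n) ↔ X ∈ preorderMatrix K (complPreorder D) ∧
      ∀ t, (n.stdFlag K).1 t ≤ ((n.stdFlag K).1 t).comap (aboveMap e X) := by
  have hrel : ∀ y z : BlockChain l, flagRel D e n (aboveEmb e y) (aboveEmb e z) ↔ n.rel y z := by
    intro y z
    constructor
    · rintro (⟨hy, hz, h⟩ | ⟨h, -⟩)
      · rwa [apply_aboveEmb, apply_aboveEmb] at h
      · exact absurd ⟨aboveEmb_mem e y, aboveEmb_mem e z⟩ h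
    · intro h
      refine Or.inl ⟨aboveEmb_mem e y, aboveEmb_mem e z, ?_⟩
      rwa [apply_aboveEmb, apply_aboveEmb]
  constructor
  · intro hX
    refine ⟨fun x y hxy => hX x y ?_, fun t => coordSubspace_le_comap_rowMap.mpr fun y z hy hz =>
      hX _ _ ?_⟩
    · rintro (⟨hx, hy, h⟩ | h)
      · exact hxy (e.le_iff_le.mp (n.le_of_rel h))
      · exact hxy h.2
    · intro h
      exact hz (((n.rel_iff).mp ((hrel y z).mp h)).2 _ hy)
  · rintro ⟨hX, hX'⟩ x y hxy
    by_cases hab : x.1 ∈ aboveClot D ∧ y.1 ∈ aboveClot D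
    · obtain ⟨x', rfl⟩ : ∃ z, x = aboveEmb e z := ⟨_, (aboveEmb_apply e hab.1).symm⟩
      obtain ⟨y', rfl⟩ : ∃ z, y = aboveEmb e z := ⟨_, (aboveEmb_apply e hab.2).symm⟩
      have h1 : ¬ n.rel x' y' := fun h => hxy ((hrel _ _).mpr h)
      rw [n.rel_iff] at h1
      by_cases hle : x'.1 ≤ y'.1
      · push Not at h1
        obtain ⟨j, hj, hj'⟩ := h1 hle
        have := hX' (flagElem S j)
        rw [FlagTuple.stdFlag, coordSubspace_le_comap_rowMap, flagIndex_flagElem] at this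
        exact this _ _ hj hj'
      · exact hX _ _ fun h => hle ((aboveEmb_le_iff e).mp h)
    · exact hX x y fun h => hxy (Or.inr ⟨hab, h⟩)

variable [Finite K]

theorem aboveMap_bijective (g : preorderGroup K (complPreorder D)) :
    Function.Bijective (aboveMap e g.1.1) := by
  have h1 : aboveMap e (((g⁻¹ : preorderGroup K (complPreorder D)) :
      (Matrix {x : C // x ∉ D} {x : C // x ∉ D} K)ˣ) : Matrix _ _ K) ∘ₗ aboveMap e g.1.1 =
      LinearMap.id := by
    rw [← aboveMap_mul e g.2, Subgroup.coe_inv, Units.mul_inv, aboveMap_one]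
  have h2 : aboveMap e g.1.1 ∘ₗ aboveMap e (((g⁻¹ : preorderGroup K (complPreorder D)) :
      (Matrix {x : C // x ∉ D} {x : C // x ∉ D} K)ˣ) : Matrix _ _ K) =
      LinearMap.id := by
    rw [← aboveMap_mul e (g⁻¹).2, Subgroup.coe_inv, Units.inv_mul, aboveMap_one]
  exact Function.bijective_iff_has_inverse.mpr ⟨aboveMap e ((g⁻¹).1.1),
    fun x => LinearMap.congr_fun h1 x, fun x => LinearMap.congr_fun h2 x⟩

theorem codim_comap_of_bijective {E : Type*} [AddCommGroup E] [Module K E] [FiniteDimensional K E]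
    {f : End K E} (hf : Function.Bijective f) (L : Submodule K E) : codim (L.comap f) = codim L := by
  have h1 := (L.comap f).finrank_quotient_add_finrank
  have h2 := L.finrank_quotient_add_finrank
  have h3 : finrank K (L.comap f) = finrank K L := by
    change finrank K (L.comap ((LinearEquiv.ofBijective f hf : E ≃ₗ[K] E) : E →ₗ[K] E)) = _
    rw [Submodule.comap_equiv_eq_map_symm]
    exact LinearEquiv.finrank_map_eq _ _
  unfold codim
  omega

/-- The group `P^{C ∖ D}` acts on the flags of subspaces of the row space on `C'`. -/
@[reducible] noncomputable def flagAction (S : Finset ℕ) :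
    MulAction (preorderGroup K (complPreorder D)) (SubspaceFlag K (BlockChain l → K) S) where
  -- Row vectors carry a right action; preimages turn it into a left action on subspaces.
  smul g F := ⟨fun t => (F.1 t).comap (aboveMap e g.1.1), fun t => by
    rw [codim_comap_of_bijective (aboveMap_bijective e g), F.2.1],
    fun _ _ h => Submodule.comap_mono (F.2.2 h)⟩
  one_smul F := Subtype.ext (funext fun t => by
    change (F.1 t).comap (aboveMap e 1) = F.1 t
    rw [aboveMap_one, Submodule.comap_id])
  mul_smul g h F := Subtype.ext (funext fun t => by
    change (F.1 t).comap (aboveMap e (g.1.1 * h.1.1)) =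
      ((F.1 t).comap (aboveMap e h.1.1)).comap (aboveMap e g.1.1)
    rw [aboveMap_mul e g.2, Submodule.comap_comp])

theorem flagAction_smul_apply {S : Finset ℕ} (g : preorderGroup K (complPreorder D))
    (F : SubspaceFlag K (BlockChain l → K) S) (t : S) :
    ((flagAction e S).smul g F).1 t = (F.1 t).comap (aboveMap e g.1.1) := rfl

/-- The commuting pairs under which all members of a flag are invariant. -/
abbrev FlagPairs {S : Finset ℕ} (F : SubspaceFlag K (BlockChain l → K) S) : Type _ :=
  {x : matCommPairs K (complPreorder D) //
    ∀ t, InvariantUnder (aboveMap e x.1.1) (aboveMap e x.1.2) (F.1 t)}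

/-- On row vectors, `g X g⁻¹` followed by `g` is `g` followed by `X`. -/
theorem le_comap_conj {g : preorderGroup K (complPreorder D)}
    {X : Matrix {x : C // x ∉ D} {x : C // x ∉ D} K} (hX : X ∈ preorderMatrix K (complPreorder D))
    {L : Submodule K (BlockChain l → K)} (h : L ≤ L.comap (aboveMap e X)) :
    L.comap (aboveMap e g.1.1) ≤ (L.comap (aboveMap e g.1.1)).comap
      (aboveMap e (g.1.1 * X * (g⁻¹).1.1)) := by
  have h1 : g.1.1 * X * (g⁻¹).1.1 * g.1.1 = g.1.1 * X := by
    rw [mul_assoc, Subgroup.coe_inv, Units.inv_mul, mul_one]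
  rw [← Submodule.comap_comp, ← aboveMap_mul e (mul_mem (mul_mem g.2 hX) (g⁻¹).2), h1,
    aboveMap_mul e g.2, Submodule.comap_comp]
  exact Submodule.comap_mono h

theorem card_flagPairs_le {S : Finset ℕ} (g : preorderGroup K (complPreorder D))
    (F : SubspaceFlag K (BlockChain l → K) S) :
    Nat.card (FlagPairs e F) ≤ Nat.card (FlagPairs e ((flagAction e S).smul g F)) := by
  refine Nat.card_le_card_of_injective (fun x => ⟨⟨(g.1.1 * x.1.1.1 * (g⁻¹).1.1,
    g.1.1 * x.1.1.2 * (g⁻¹).1.1), mul_mem (mul_mem g.2 x.1.2.1) (g⁻¹).2,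
    mul_mem (mul_mem g.2 x.1.2.2.1) (g⁻¹).2,
    (g.1.isUnit.mul x.1.2.2.2.1).mul (g⁻¹).1.isUnit, ?_, ?_⟩, fun t =>
      ⟨le_comap_conj e x.1.2.1 (x.2 t).1, le_comap_conj e x.1.2.2.1 (x.2 t).2⟩⟩) ?_
  · obtain ⟨n, hn⟩ := x.1.2.2.2.2.1
    exact ⟨n, by rw [Subgroup.coe_inv, Units.conj_pow, hn, mul_zero, zero_mul]⟩
  · have := x.1.2.2.2.2.2.eq
    rw [Commute, SemiconjBy, Subgroup.coe_inv]
    calc g.1.1 * x.1.1.1 * (g.1⁻¹).1 * (g.1.1 * x.1.1.2 * (g.1⁻¹).1)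
        = g.1.1 * (x.1.1.1 * x.1.1.2) * (g.1⁻¹).1 := by
          simp only [mul_assoc, Units.inv_mul_cancel_left]
      _ = _ := by
          rw [this]
          simp only [mul_assoc, Units.inv_mul_cancel_left]
  · intro x y H
    have h1 : ∀ X Y : Matrix {x : C // x ∉ D} {x : C // x ∉ D} K,
        g.1.1 * X * (g⁻¹).1.1 = g.1.1 * Y * (g⁻¹).1.1 → X = Y := by
      intro X Y h
      rw [Subgroup.coe_inv, Units.mul_left_inj, Units.mul_right_inj] at h
      exact h
    exact Subtype.ext (Subtype.ext (Prod.ext (h1 _ _ (congrArg (fun z => z.1.1.1) H))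
      (h1 _ _ (congrArg (fun z => z.1.1.2) H))))

theorem card_flagPairs_smul {S : Finset ℕ} (g : preorderGroup K (complPreorder D))
    (F : SubspaceFlag K (BlockChain l → K) S) :
    Nat.card (FlagPairs e ((flagAction e S).smul g F)) = Nat.card (FlagPairs e F) := by
  refine le_antisymm ?_ (card_flagPairs_le e g F)
  let := flagAction (K := K) e S
  -- The inverse element gives the opposite inequality.
  have := card_flagPairs_le e g⁻¹ (g • F)
  change _ ≤ Nat.card (FlagPairs e (g⁻¹ • g • F)) at this
  rwa [inv_smul_smul] at this

theorem card_flagPairs_stdFlag {S : Finset ℕ} (n : FlagTuple l S) :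
    Nat.card (FlagPairs e (n.stdFlag K)) = Nat.card (matCommPairs K (flagPreorder D e n)) := by
  refine Nat.card_congr
    { toFun := fun x => ⟨x.1.1,
        (mem_preorderMatrix_flagPreorder e n).mpr ⟨x.1.2.1, fun t => (x.2 t).1⟩,
        (mem_preorderMatrix_flagPreorder e n).mpr ⟨x.1.2.2.1, fun t => (x.2 t).2⟩, x.1.2.2.2⟩
      invFun := fun x => ⟨⟨x.1, ((mem_preorderMatrix_flagPreorder e n).mp x.2.1).1,
        ((mem_preorderMatrix_flagPreorder e n).mp x.2.2.1).1, x.2.2.2⟩, fun t =>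
          ⟨((mem_preorderMatrix_flagPreorder e n).mp x.2.1).2 t,
            ((mem_preorderMatrix_flagPreorder e n).mp x.2.2.1).2 t⟩⟩
      left_inv := fun x => rfl
      right_inv := fun x => rfl }

theorem comap_eq_of_le {g : preorderGroup K (complPreorder D)}
    {L : Submodule K (BlockChain l → K)} (h : L ≤ L.comap (aboveMap e g.1.1)) :
    L.comap (aboveMap e g.1.1) = L :=
  (eq_of_le_of_codim_eq h (codim_comap_of_bijective (aboveMap_bijective e g) L).symm).symm

theorem card_stabilizer_stdFlag {S : Finset ℕ} (n : FlagTuple l S) :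
    letI := flagAction (K := K) e S
    Nat.card (MulAction.stabilizer (preorderGroup K (complPreorder D)) (n.stdFlag K)) =
      Nat.card (preorderGroup K (flagPreorder D e n)) := by
  let := flagAction (K := K) e S
  have key : ∀ g : preorderGroup K (complPreorder D), g • n.stdFlag K = n.stdFlag K ↔
      g.1.1 ∈ preorderMatrix K (flagPreorder D e n) := by
    intro g
    rw [mem_preorderMatrix_flagPreorder]
    constructor
    · intro h
      exact ⟨g.2, fun t => (congrFun (congrArg Subtype.val h) t).ge⟩
    · rintro ⟨-, h⟩
      exact Subtype.ext (funext fun t => comap_eq_of_le e (h t))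
  exact Nat.card_congr
    { toFun := fun g => ⟨g.1.1, (key g.1).mp g.2⟩
      invFun := fun g => ⟨⟨g.1, ((mem_preorderMatrix_flagPreorder e n).mp g.2).1⟩,
        (key ⟨g.1, ((mem_preorderMatrix_flagPreorder e n).mp g.2).1⟩).mpr g.2⟩
      left_inv := fun x => rfl
      right_inv := fun x => rfl }

/-- An invertible block on `C'` extends to `C ∖ D`. -/
theorem exists_aboveBlock_eq {M : Matrix (BlockChain l) (BlockChain l) K} (hM : IsUnit M)
    (hM' : ∀ y z, ¬ y ≤ z → M y z = 0) :
    ∃ g : preorderGroup K (complPreorder D), aboveBlock e g.1.1 = M := by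
  classical
  let R := {x : {x : C // x ∉ D} // x ∉ Set.range (aboveEmb e)}
  let τ : BlockChain l ⊕ R ≃ {x : C // x ∉ D} :=
    ((Equiv.ofInjective _ (aboveEmb_injective e)).sumCongr (Equiv.refl _)).trans
      (Equiv.Set.sumCompl (Set.range (aboveEmb e)))
  let X := Matrix.reindexAlgEquiv K K τ (Matrix.fromBlocks M 0 0 (1 : Matrix R R K))
  have hX : ∀ i j, X (τ i) (τ j) = Matrix.fromBlocks M 0 0 (1 : Matrix R R K) i j := by
    intro i j
    simp [X]
  have hu : IsUnit X := by
    rw [isUnit_map_iff, Matrix.isUnit_fromBlocks_zero₂₁]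
    exact ⟨hM, isUnit_one⟩
  refine ⟨⟨hu.unit, ?_⟩, ?_⟩
  · change X ∈ preorderMatrix K (complPreorder D)
    rw [mem_preorderMatrix, τ.surjective.forall]
    intro i
    rw [τ.surjective.forall]
    intro j hij
    rw [hX i j]
    rcases i with y | x <;> rcases j with z | x'
    · exact hM' y z fun h => hij ((aboveEmb_le_iff e).mpr h)
    · rfl
    · rfl
    · refine Matrix.one_apply_ne ?_
      rintro rfl
      exact hij le_rfl
  · ext y z
    exact hX (Sum.inl y) (Sum.inl z)

/-- The matrix with the adapted basis as rows sends coordinates to vectors, so the preimage of `F`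
is a coordinate flag. Since the basis vectors lie in the tail subspaces of their blocks, this matrix
respects the preorder of `C'` and extends to an element of `P^{C∖D}`. -/
theorem exists_smul_eq_stdFlag {S : Finset ℕ} (F : SubspaceFlag K (BlockChain l → K) S) :
    ∃ (n : FlagTuple l S) (g : preorderGroup K (complPreorder D)),
      (flagAction e S).smul g F = n.stdFlag K := by
  obtain ⟨n, b, hb, hF⟩ := exists_flagTuple_basis F
  let M : Matrix (BlockChain l) (BlockChain l) K := fun y z => b y z
  have hM : ∀ u, rowMap M u = b.equivFun.symm u := by
    intro u
    rw [Basis.equivFun_symm_apply]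
    ext z
    change ∑ y, u y * M y z = _
    simp [M]
  have hu : IsUnit M := by
    rw [← isUnit_rowMap, isUnit_end_iff_injective]
    intro u u' h
    rw [hM, hM] at h
    exact b.equivFun.symm.injective h
  obtain ⟨g, hg⟩ := exists_aboveBlock_eq e hu fun y z hyz => hb y z fun h => hyz h
  refine ⟨n, g, Subtype.ext (funext fun t => ?_)⟩
  rw [flagAction_smul_apply, aboveMap, hg]
  ext u
  rw [Submodule.mem_comap, hM, hF]
  simp only [← Basis.equivFun_apply, LinearEquiv.apply_symm_apply]
  rfl

/-- The tuple `n` can be read off from the dimensions of the intersections of the flag with the tail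
subspaces. -/
theorem finrank_stdFlag_inf_tailSubspace {S : Finset ℕ} (n : FlagTuple l S) (t : S) (i : Fin s) :
    finrank K ((n.stdFlag K).1 t ⊓ tailSubspace K l i : Submodule K (BlockChain l → K)) =
      (l i - n.1 i (flagIndex S t)) + finrank K
        ((n.stdFlag K).1 t ⊓ tailSubspace K l (i + 1) : Submodule K (BlockChain l → K)) := by
  have hinf : ∀ i' : ℕ, finrank K
      ((n.stdFlag K).1 t ⊓ tailSubspace K l i' : Submodule K (BlockChain l → K)) =
      (n.upper (flagIndex S t) ∩ {y : BlockChain l | i' ≤ (y.1 : ℕ)}).ncard := by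
    intro i'
    have : (n.stdFlag K).1 t ⊓ tailSubspace K l i' = coordSubspace K
        (n.upper (flagIndex S t) ∩ {y : BlockChain l | i' ≤ (y.1 : ℕ)}) := coordSubspace_inf _ _
    rw [this, finrank_coordSubspace]
  rw [hinf, hinf]
  have h1 : n.upper (flagIndex S t) ∩ {y : BlockChain l | (i : ℕ) ≤ y.1} =
      {y | y ∈ n.upper (flagIndex S t) ∧ y.1 = i} ∪
        (n.upper (flagIndex S t) ∩ {y : BlockChain l | (i : ℕ) + 1 ≤ y.1}) := by
    ext y
    simp only [Set.mem_inter_iff, Set.mem_union, Set.mem_ofPred_eq, Fin.ext_iff, ← and_or_left]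
    refine and_congr_right fun _ => ?_
    omega
  rw [h1, Set.ncard_union_eq (Set.disjoint_left.mpr fun y hy hy' => by
    simp only [Set.mem_inter_iff, Set.mem_ofPred_eq, Fin.ext_iff] at hy hy'; omega)]
  congr 1
  have e : {y : BlockChain l | y ∈ n.upper (flagIndex S t) ∧ y.1 = i} ≃
      Fin (l i - n.1 i (flagIndex S t)) :=
    { toFun := fun y => ⟨y.1.2 - n.1 i (flagIndex S t), by
        obtain ⟨⟨i', p⟩, h2, rfl⟩ := y
        have h2 : (n.1 i' (flagIndex S t) : ℕ) ≤ p := h2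
        have := p.2
        change (p : ℕ) - n.1 i' (flagIndex S t) < l i' - n.1 i' (flagIndex S t)
        omega⟩
      invFun := fun p => ⟨⟨i, ⟨n.1 i (flagIndex S t) + p, by omega⟩⟩, Nat.le_add_right _ _, rfl⟩
      left_inv := by
        rintro ⟨⟨i', p⟩, h2, rfl⟩
        have h2 : (n.1 i' (flagIndex S t) : ℕ) ≤ p := h2
        refine Subtype.ext (congrArg (Sigma.mk i') (Fin.ext ?_))
        exact Nat.add_sub_cancel' h2
      right_inv := fun p => Fin.ext (Nat.add_sub_cancel_left _ _) }
  rw [← Nat.card_coe_set_eq, Nat.card_congr e, Nat.card_fin]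

/-- Group elements preserve the tail subspaces, so the intersection dimensions that determine `n`
are constant on orbits. -/
theorem stdFlag_eq_of_smul_eq {S : Finset ℕ} {n n' : FlagTuple l S}
    {g : preorderGroup K (complPreorder D)}
    (h : (flagAction e S).smul g (n.stdFlag K) = n'.stdFlag K) : n = n' := by
  have htail : ∀ i, (tailSubspace K l i).comap (aboveMap e g.1.1) = tailSubspace K l i := by
    intro i
    refine comap_eq_of_le e (coordSubspace_le_comap_rowMap.mpr fun y z hy hz => ?_)
    refine g.2 _ _ fun hle => hz ?_
    have : y.1 ≤ z.1 := (aboveEmb_le_iff e).mp hle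
    exact le_trans hy (Fin.le_def.mp this)
  have hfin : ∀ t i, finrank K
      ((n.stdFlag K).1 t ⊓ tailSubspace K l i : Submodule K (BlockChain l → K)) =
      finrank K ((n'.stdFlag K).1 t ⊓ tailSubspace K l i : Submodule K (BlockChain l → K)) := by
    intro t i
    rw [← h, flagAction_smul_apply, ← htail i, ← Submodule.comap_inf, htail i]
    have h1 := codim_comap_of_bijective (aboveMap_bijective e g)
      ((n.stdFlag K).1 t ⊓ tailSubspace K l i)
    have h2 := ((n.stdFlag K).1 t ⊓ tailSubspace K l i).finrank_quotient_add_finrank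
    have h3 := (((n.stdFlag K).1 t ⊓ tailSubspace K l i).comap
      (aboveMap e g.1.1)).finrank_quotient_add_finrank
    unfold codim at h1
    omega
  refine Subtype.ext (funext fun i => funext fun j => Fin.ext ?_)
  have h1 := finrank_stdFlag_inf_tailSubspace (K := K) n (flagElem S j) i
  have h2 := finrank_stdFlag_inf_tailSubspace (K := K) n' (flagElem S j) i
  rw [hfin, hfin, h2, flagIndex_flagElem] at h1
  have h3 := (n.1 i j).2
  have h4 := (n'.1 i j).2
  omega

/-- Counting commuting pairs with an invariant flag through the preorders `O(S, n)`. -/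
theorem sum_card_invFlag (S : Finset ℕ) [Fintype (matCommPairs K (complPreorder D))] :
    ∑ x : matCommPairs K (complPreorder D),
        Nat.card (InvFlag (aboveMap e x.1.1) (aboveMap e x.1.2) S) =
      Nat.card (preorderGroup K (complPreorder D)) *
        ∑ n : FlagTuple l S, rho K (flagPreorder D e n) := by
  let := flagAction (K := K) e S
  have : Finite (Submodule K (BlockChain l → K)) := inferInstance
  have := Fintype.ofFinite (SubspaceFlag K (BlockChain l → K) S)
  let o : FlagTuple l S → Set (SubspaceFlag K (BlockChain l → K) S) := fun n =>
    MulAction.orbit (preorderGroup K (complPreorder D)) (n.stdFlag K)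
  -- Double counting of the incidences between commuting pairs and invariant flags.
  have h1 : ∑ x : matCommPairs K (complPreorder D),
        Nat.card (InvFlag (aboveMap e x.1.1) (aboveMap e x.1.2) S) =
      ∑ F : SubspaceFlag K (BlockChain l → K) S, Nat.card (FlagPairs e F) := by
    rw [← Nat.card_sigma, ← Nat.card_sigma]
    exact Nat.card_congr
      { toFun := fun x => ⟨x.2.1, ⟨x.1, x.2.2⟩⟩
        invFun := fun x => ⟨x.2.1, ⟨x.1, x.2.2⟩⟩
        left_inv := fun x => rfl
        right_inv := fun x => rfl }
  have := fun n => Fintype.ofFinite (o n)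
  -- The orbits of the standard flags are disjoint and cover all flags.
  let E : (Σ n, o n) ≃ SubspaceFlag K (BlockChain l → K) S := Equiv.ofBijective (fun x => x.2.1) (by
    constructor
    · rintro ⟨n, F, g, hg⟩ ⟨n', F', g', hg'⟩ H
      change F = F' at H
      subst H
      have : (g'⁻¹ * g) • n.stdFlag K = n'.stdFlag K := by
        rw [mul_smul]
        exact inv_smul_eq_iff.mpr (hg.trans hg'.symm)
      obtain rfl := stdFlag_eq_of_smul_eq e this
      rfl
    · intro F
      obtain ⟨n, g, h⟩ := exists_smul_eq_stdFlag e F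
      exact ⟨⟨n, F, g⁻¹, inv_smul_eq_iff.mpr h.symm⟩, rfl⟩)
  have h2 : ∀ (n : FlagTuple l S) (F : o n), Nat.card (FlagPairs e F.1) =
      rho K (flagPreorder D e n) * Nat.card (preorderGroup K (flagPreorder D e n)) := by
    rintro n ⟨_, g, rfl⟩
    rw [← card_matCommPairs_eq_rho_mul, ← card_flagPairs_stdFlag]
    exact card_flagPairs_smul e g _
  have h3 : ∀ n : FlagTuple l S, Nat.card (o n) *
      Nat.card (preorderGroup K (flagPreorder D e n)) =
        Nat.card (preorderGroup K (complPreorder D)) := by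
    intro n
    rw [← card_stabilizer_stdFlag e n, ← Nat.card_prod]
    exact Nat.card_congr (MulAction.orbitProdStabilizerEquivGroup _ _)
  rw [h1, ← E.sum_comp, Fintype.sum_sigma, Finset.mul_sum]
  refine Finset.sum_congr rfl fun n _ => ?_
  change ∑ F : o n, Nat.card (FlagPairs e F.1) = _
  rw [Finset.sum_congr rfl fun F _ => h2 n F, Finset.sum_const, Finset.card_univ, smul_eq_mul,
    ← Nat.card_eq_fintype_card, ← h3 n]
  ring

end FlagAction

/-! ### The recursion for `ρ` -/

section RhoRecursion

variable {K : Type*} [Field K] {C : Type*} [Fintype C] [DecidableEq C] [P : Preorder C]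
  {D : Finset C} {s : ℕ} {l : Fin s → ℕ} 

theorem finrank_blockChain (e : aboveClot D ≃o BlockChain l) : finrank K (BlockChain l → K) = (aboveClot D).ncard := by
  rw [finrank_fintype_fun_eq_card, ← Nat.card_eq_fintype_card, ← Nat.card_coe_set_eq]
  exact (Nat.card_congr e.toEquiv).symm

theorem aboveMap_pow (e : aboveClot D ≃o BlockChain l) {X : Matrix {x : C // x ∉ D} {x : C // x ∉ D} K}
    (hX : X ∈ preorderMatrix K (complPreorder D)) (n : ℕ) :
    aboveMap e (X ^ n) = aboveMap e X ^ n := by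
  induction n with
  | zero => rw [pow_zero, pow_zero, aboveMap_one]; rfl
  | succ n ih => rw [pow_succ, aboveMap_mul e (pow_mem hX n), ih, pow_succ']; rfl

variable [Finite K]

theorem homCount_aboveMap (e : aboveClot D ≃o BlockChain l)
    (x : matCommPairs K (complPreorder D)) :
    homCount ({x : C // x ∈ D} → K) (aboveMap e x.1.1) (aboveMap e x.1.2) ⊥ =
      cardGL K ({x : C // x ∈ D} → K) *
        ∑ j ∈ Finset.range (D.card + 1), partitionCount (D.card - j) *
          ∑ S ∈ (Finset.Icc 1 ((aboveClot D).ncard - 1)).powerset,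
            (exactPartitionCount j S + exactPartitionCount j (S ∪ {(aboveClot D).ncard})) *
              Nat.card (InvFlag (aboveMap e x.1.1) (aboveMap e x.1.2) S) := by
  obtain ⟨hX, hZ, hu, ⟨n, hn⟩, hc⟩ := x.2
  have h1 : IsUnit (aboveMap e x.1.1) :=
    (End.isUnit_iff _).mpr (aboveMap_bijective e ⟨hu.unit, hX⟩)
  have h2 : IsNilpotent (aboveMap e x.1.2) := by
    refine ⟨n, ?_⟩
    rw [← aboveMap_pow e hZ, hn]
    exact LinearMap.ext fun u => Matrix.vecMul_zero u
  have h3 : Commute (aboveMap e x.1.1) (aboveMap e x.1.2) :=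
    ((aboveMap_mul e hZ).symm.trans (by rw [hc.eq])).trans (aboveMap_mul e hX)
  rw [homCount_eq_cardGL_mul_chainTotal (fun n => by
    rw [card_commPairs, finrank_fin_fun]) h1 h2 h3, chainTotal, finrank_fintype_fun_eq_card,
    Fintype.card_coe]
  simp only [card_multichains_eq_sum, finrank_blockChain e]

end RhoRecursion

theorem mainTheorem8 {K : Type*} [Field K] [Finite K] {C : Type*} [Fintype C] [DecidableEq C]
    [P : Preorder C] (D : Finset C) (hD : IsMinimalClot D)
    {s : ℕ} (l : Fin s → ℕ) (e : aboveClot D ≃o BlockChain l) :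
    Fintype.card {x : C // x ∉ D} < Fintype.card C ∧
    rho K P =
      ∑ j ∈ Finset.range (D.card + 1), partitionCount (D.card - j) *
        ∑ S ∈ (Finset.Icc 1 ((aboveClot D).ncard - 1)).powerset,
          (exactPartitionCount j S + exactPartitionCount j (S ∪ {(aboveClot D).ncard})) *
            ∑ n : FlagTuple l S, rho K (flagPreorder D e n) := by
  constructor
  · obtain ⟨x, hx⟩ := hD.isClot
    exact Fintype.card_subtype_lt (x := x) fun h => h ((hx x).mpr ⟨le_rfl, le_rfl⟩)
  have hfin : Finite (({x : C // x ∈ D} → K) →ₗ[K] (BlockChain l → K)) :=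
    Module.finite_of_finite K
  have : Finite (matCommPairs K (complPreorder D)) := Subtype.finite
  have := Fintype.ofFinite (matCommPairs K (complPreorder D))
  have hpos : 0 < Nat.card (preorderGroup K P) := Nat.card_pos
  -- After multiplication by `|P^C|` the left side counts commuting pairs.
  refine Nat.eq_of_mul_eq_mul_right hpos ?_
  rw [← card_matCommPairs_eq_rho_mul, card_matCommPairs e hD, card_preorderGroup e hD]
  have hsum : ∑ x : matCommPairs K (complPreorder D),
      homCount ({x : C // x ∈ D} → K) (aboveMap e x.1.1) (aboveMap e x.1.2) ⊥ =
      cardGL K ({x : C // x ∈ D} → K) *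
        ∑ j ∈ Finset.range (D.card + 1), partitionCount (D.card - j) *
          ∑ S ∈ (Finset.Icc 1 ((aboveClot D).ncard - 1)).powerset,
            (exactPartitionCount j S + exactPartitionCount j (S ∪ {(aboveClot D).ncard})) *
              (Nat.card (preorderGroup K (complPreorder D)) *
                ∑ n : FlagTuple l S, rho K (flagPreorder D e n)) := by
    simp only [homCount_aboveMap e, ← sum_card_invFlag e]
    rw [← Finset.mul_sum, Finset.sum_comm]
    congr 1
    refine Finset.sum_congr rfl fun j _ => ?_
    rw [← Finset.mul_sum, Finset.sum_comm]
    congr 1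
    exact Finset.sum_congr rfl fun S _ => (Finset.mul_sum _ _ _).symm
  rw [hsum]
  -- Both sides now carry the factors `|GL(K^D)|`, `|Hom(K^D, K^{C'})|` and `|P^{C∖D}|`, and agree
  -- term by term.
  simp only [Finset.mul_sum, Finset.sum_mul]
  refine Finset.sum_congr rfl fun j _ => Finset.sum_congr rfl fun S _ =>
    Finset.sum_congr rfl fun n _ => ?_
  ring
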